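/- Let $n\ge 3$ and let $(\tilde M,\tilde g)$ be a smooth $n$-dimensional Riemannian manifold (a "space") or Lorentzian manifold of signature $(-,+,\dots,+)$ (a "space-time") of constant sectional curvature $\lambda$, i.e. $\tilde R_{ABCD}=\lambda(\tilde g_{AC}\tilde g_{BD}-\tilde g_{AD}\tilde g_{BC})$. An *everywhere umbilical hypersurface* is a connected smooth $(n-1)$-manifold $\Sigma$ with a smooth immersion $f:\Sigma\to\tilde M$ and a smooth unit normal field along $f$ such that the extrinsic curvature is pointwise proportional to the induced metric $g$, $K_{ij}=\sigma g_{ij}$, for some function $\sigma:\Sigma\to\mathbb R$; in a space-time $\Sigma$ is assumed to be time-like (so $g$ is Lorentzian and the unit normal is space-like). (1) Let $\Sigma$ be an everywhere umbilical hypersurface of $\tilde M$. Then $\sigma$ is constant, and the induced metric $g$ has constant sectional curvature $\lambda+\sigma^2$. (2) Consider the following functions $\rho$ and constants $\ell>0$, $K$: - $\lambda=0$: ($\rho(\chi)=\chi$, $K=1$) or ($\rho(\chi)=1$, $K=0$), with $\ell>0$ arbitrary; - $\lambda=1/\ell^2$: $\rho(\chi)=\sin\chi$, $K=1$; - $\lambda=-1/\ell^2$: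 ($\rho(\chi)=\sinh\chi$, $K=1$) or ($\rho(\chi)=e^\chi$, $K=0$) or ($\rho(\chi)=\cosh\chi$, $K=-1$). There are $\ell,\rho,K$ in this list and $v_0\in\mathbb R$ with $\rho(v_0/\ell)\ne0$ and $\bigl(\rho'(v_0/\ell)/(\ell\rho(v_0/\ell))\bigr)^2=\sigma^2$. For every such choice there is a metric $d\sigma_K^2$ of constant curvature $K$ on $\Sigma$, of the same kind (Riemannian or Lorentzian) as $\tilde g$, such that every point of $\Sigma$ has an open neighbourhood $W\subset\Sigma$ for which a neighbourhood of $f(W)$ has Gaussian normal coordinates $(v,x)\in(v_0-\varepsilon,v_0+\varepsilon)\times W$ in which $f(W)$ is the slice $v=v_0$ (with $f(x)$ having coordinates $(v_0,x)$) and $$d\tilde s^2=dv^2+\ell^2\rho(v/\ell)^2\,d\sigma_K^2 .$$ (3) (Rigidity.) Let $f_1:\Sigma_1\to\tilde M$ and $f_2:\Sigma_2\to\tilde M$ be everywhere umbilical hypersurfaces with the same value of $\sigma^2$, and let $p_1\in\Sigma_1$, $p_2\in\Sigma_2$. Then there is an isometry $\Phi$ from an open neighbourhood of $f_1(p_1)$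 in $\tilde M$ onto an open neighbourhood of $f_2(p_2)$ with $\Phi(f_1(p_1))=f_2(p_2)$ that maps $f_1(W_1)$ onto $f_2(W_2)$ for some open neighbourhoods $W_i\subset\Sigma_i$ of $p_i$. If $\tilde M$ is one of the standard spaces or space-times $E^n,S^n,H^n$, Minkowski space-time $E^{n-1,1}$, $\mathrm{dS}^n$, $\mathrm{AdS}^n$ described in (4), then $\Phi$ can be taken to be an isometry of the whole of $\tilde M$, and if moreover $f_1(\Sigma_1)$ and $f_2(\Sigma_2)$ are closed in $\tilde M$, then this $\Phi$ satisfies $\Phi(f_1(\Sigma_1))=f_2(\Sigma_2)$. (4) ("Hyperplane or hypersphere" theorem.) Realize the standard space(-time)s isometrically as follows: for $\lambda\neq 0$ as the quadric $Y\cdot Y=1/\lambda$ in $\mathbb R^{n+1}$ with the pseudo-Euclidean form having $0$ ($S^n$), $1$ ($H^n$ and $\mathrm{dS}^n$) or $2$ ($\mathrm{AdS}^n$) negative directions, with only the sheet $Y^0>0$ for $H^n$; for $\lambda=0$ as $\mathbb R^n$ with the Euclidean or Minkowski form. Then an everywhere umbilical hypersurface of such an $\tilde M$ is contained in, and if its image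 is closed in $\tilde M$ equals, a hypersurface of the following form: - $\lambda\ne0$: $\{Y\in\tilde M: P\cdot Y=\sigma/\lambda\}$ with $P\in\mathbb R^{n+1}$, $P\cdot P=1+\sigma^2/\lambda$; - $\lambda=0$, $\sigma=0$: $\{Y: P\cdot Y=c\}$ with $P\cdot P=1$, $c\in\mathbb R$; - $\lambda=0$, $\sigma\ne0$: $\{Y:(Y-A)\cdot(Y-A)=1/\sigma^2\}$ for some point $A$. -/

import Mathlib

open Set
open scoped Manifold ContDiff Topology

noncomputable section

/-- Coordinate space `ℝⁿ`. -/
abbrev Coord (n : ℕ) : Type := EuclideanSpace ℝ (Fin n)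

/-- The two kinds of geometry: a (Riemannian) space, or a (Lorentzian) space-time with
signature `(-, +, …, +)`. -/
inductive GeometryKind : Type
  | space : GeometryKind
  | spacetime : GeometryKind

/-- The form `B` is positive definite (space), respectively has exactly one negative direction and
is positive definite on its orthogonal complement (space-time). -/
def HasSignature {V : Type*} [Zero V] (kind : GeometryKind) (B : V → V → ℝ) : Prop :=
  match kind with
  | GeometryKind.space => ∀ u, u ≠ 0 → 0 < B u u
  | GeometryKind.spacetime => ∃ e, B e e < 0 ∧ ∀ u, B e u = 0 → u ≠ 0 → 0 < B u u

section Coordinates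

variable {n : ℕ}

/-- The Christoffel symbol of the first kind of the coordinate metric `G`, as a covector:
`w ↦ ½ (∂_u G(v, w) + ∂_v G(u, w) - ∂_w G(u, v))`. -/
def christoffelLower (G : Coord n → Coord n →L[ℝ] Coord n →L[ℝ] ℝ) (y u v : Coord n) :
    Coord n →L[ℝ] ℝ :=
  (1 / 2 : ℝ) • (fderiv ℝ G y u v + fderiv ℝ G y v u - ((fderiv ℝ G y).flip u).flip v)

/-- The Christoffel symbol `Γ(u, v)` (second kind): the index is raised with the inverse metric. -/
def christoffel (G : Coord n → Coord n →L[ℝ] Coord n →L[ℝ] ℝ) (y u v : Coord n) : Coord n :=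
  ContinuousLinearMap.inverse (G y) (christoffelLower G y u v)

/-- The Riemann curvature `R(u, v) w` of the coordinate metric `G` at `y`,
`∂_u Γ(v, w) - ∂_v Γ(u, w) + Γ(u, Γ(v, w)) - Γ(v, Γ(u, w))`. -/
def curvature (G : Coord n → Coord n →L[ℝ] Coord n →L[ℝ] ℝ) (y u v w : Coord n) : Coord n :=
  fderiv ℝ (fun z => christoffel G z v w) y u - fderiv ℝ (fun z => christoffel G z u w) y v
    + christoffel G y u (christoffel G y v w) - christoffel G y v (christoffel G y u w)

end Coordinates

section Manifolds

variable {n : ℕ} {M : Type*} [TopologicalSpace M] [ChartedSpace (Coord n) M]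

/-- A field of bilinear forms on the tangent spaces of an `n`-manifold. -/
abbrev BilinField (n : ℕ) (M : Type*) [TopologicalSpace M] [ChartedSpace (Coord n) M] : Type _ :=
  ∀ x : M, TangentSpace (𝓡 n) x →L[ℝ] TangentSpace (𝓡 n) x →L[ℝ] ℝ

/-- The coordinate expression of `g` in the chart `e`, at the point with coordinates `y`. -/
def chartMetric (g : BilinField n M) (e : OpenPartialHomeomorph M (Coord n)) (y : Coord n) :
    Coord n →L[ℝ] Coord n →L[ℝ] ℝ :=
  let B : Coord n →L[ℝ] Coord n →L[ℝ] ℝ := g (e.symm y)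
  let L : Coord n →L[ℝ] Coord n := mfderiv (𝓡 n) (𝓡 n) e.symm y
  B.bilinearComp L L

/-- `g` is a smooth Riemannian (space) or Lorentzian (space-time) metric. -/
structure IsMetric (kind : GeometryKind) (g : BilinField n M) : Prop where
  symm : ∀ (x : M) (u v : TangentSpace (𝓡 n) x), g x u v = g x v u
  signature : ∀ x : M, HasSignature kind (fun u v : TangentSpace (𝓡 n) x => g x u v)
  smooth : ∀ e ∈ IsManifold.maximalAtlas (𝓡 n) ∞ M, ContDiffOn ℝ ∞ (chartMetric g e) e.target

/-- `g` is a metric of constant sectional curvature `κ`. In index notation the last field is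
`R_{ijkl} = κ (g_{ik} g_{jl} - g_{il} g_{jk})`. -/
structure IsConstantCurvatureMetric (kind : GeometryKind) (κ : ℝ) (g : BilinField n M) : Prop
    extends IsMetric kind g where
  curvature_eq : ∀ e ∈ IsManifold.maximalAtlas (𝓡 n) ∞ M, ∀ y ∈ e.target, ∀ u v w : Coord n,
    curvature (chartMetric g e) y u v w
      = κ • (chartMetric g e y v w • u - chartMetric g e y u w • v)

/-- The Levi-Civita curvature of a metric of constant curvature `κ` gives every nondegenerate
coordinate plane the sectional curvature `κ`. -/
theorem IsConstantCurvatureMetric.sectional {kind : GeometryKind} {κ : ℝ} {g : BilinField n M}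
    (h : IsConstantCurvatureMetric kind κ g) {e : OpenPartialHomeomorph M (Coord n)}
    (he : e ∈ IsManifold.maximalAtlas (𝓡 n) ∞ M) {y : Coord n} (hy : y ∈ e.target)
    (u v : Coord n)
    (hne : chartMetric g e y u u * chartMetric g e y v v
      - chartMetric g e y u v * chartMetric g e y u v ≠ 0) :
    chartMetric g e y (curvature (chartMetric g e) y u v v) u
      / (chartMetric g e y u u * chartMetric g e y v v
        - chartMetric g e y u v * chartMetric g e y u v) = κ := by
  have hs : chartMetric g e y v u = chartMetric g e y u v := h.symm _ _ _
  rw [h.curvature_eq e he y hy, div_eq_iff hne]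
  simp only [map_smul, map_sub, smul_apply, sub_apply,
    smul_eq_mul, hs]
  ring

variable {m : ℕ} {N : Type*} [TopologicalSpace N] [ChartedSpace (Coord m) N]

/-- The first fundamental form (pullback metric) of `f : N → M`. -/
def inducedMetric (g : BilinField n M) (f : N → M) : BilinField m N := fun x =>
  let B : Coord n →L[ℝ] Coord n →L[ℝ] ℝ := g (f x)
  let L : Coord m →L[ℝ] Coord n := mfderiv (𝓡 m) (𝓡 n) f x
  B.bilinearComp L L

/-- The extrinsic curvature of `f : N → M` with respect to the normal field `ν`, at `x`, applied to
vectors `u, w` given in the chart `φ` of `N`, and computed with the chart `e` of `M`: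
`K_{ij} = n_L (Γ^L_{AB} ∂_i x^A ∂_j x^B + ∂_i ∂_j x^L)`. -/
def extrinsicCurvature (g : BilinField n M) (f : N → M) (ν : ∀ x : N, TangentSpace (𝓡 n) (f x))
    (e : OpenPartialHomeomorph M (Coord n)) (φ : OpenPartialHomeomorph N (Coord m))
    (x : N) (u w : Coord m) : ℝ :=
  let F : Coord m → Coord n := fun z => e (f (φ.symm z))
  let ν' : Coord n := mfderiv (𝓡 n) (𝓡 n) e (f x) (ν x)
  chartMetric g e (e (f x)) ν'
    (christoffel (chartMetric g e) (e (f x)) (fderiv ℝ F (φ x) u) (fderiv ℝ F (φ x) w)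
      + fderiv ℝ (fderiv ℝ F) (φ x) u w)

/-- An isometry between open subsets of `M`. -/
structure IsLocalIsometry (g : BilinField n M) (Φ : OpenPartialHomeomorph M M) : Prop where
  smooth : ContMDiffOn (𝓡 n) (𝓡 n) ∞ Φ Φ.source
  smooth_symm : ContMDiffOn (𝓡 n) (𝓡 n) ∞ Φ.symm Φ.target
  isometry : ∀ x ∈ Φ.source, ∀ u w : TangentSpace (𝓡 n) x,
    g (Φ x) (mfderiv (𝓡 n) (𝓡 n) Φ x u) (mfderiv (𝓡 n) (𝓡 n) Φ x w) = g x u w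

/-- A global isometry of `M`. -/
def IsGlobalIsometry (g : BilinField n M) (Φ : M ≃ₘ^∞⟮𝓡 n, 𝓡 n⟯ M) : Prop :=
  ∀ (x : M) (u w : TangentSpace (𝓡 n) x),
    g (Φ x) (mfderiv (𝓡 n) (𝓡 n) Φ x u) (mfderiv (𝓡 n) (𝓡 n) Φ x w) = g x u w

end Manifolds

section Hypersurfaces

variable {m : ℕ} {M : Type*} [TopologicalSpace M] [ChartedSpace (Coord (m + 1)) M]
  [IsManifold (𝓡 (m + 1)) ∞ M] {N : Type*} [TopologicalSpace N] [ChartedSpace (Coord m) N]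

/-- `f : N → M` is an everywhere umbilical (immersed) hypersurface with smooth unit normal field `ν`
and `K_{ij} = σ g_{ij}`. In a space-time the hypersurface is time-like: its induced metric is
Lorentzian and its unit normal is space-like. -/
structure IsUmbilicalHypersurface (kind : GeometryKind) (g : BilinField (m + 1) M) (f : N → M)
    (ν : ∀ x : N, TangentSpace (𝓡 (m + 1)) (f x)) (σ : N → ℝ) : Prop where
  smooth : ContMDiff (𝓡 m) (𝓡 (m + 1)) ∞ f
  immersion : ∀ x, Function.Injective (mfderiv (𝓡 m) (𝓡 (m + 1)) f x)
  signature : ∀ x : N,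
    HasSignature kind (fun u v : TangentSpace (𝓡 m) x => inducedMetric g f x u v)
  normal_smooth : ContMDiff (𝓡 m) (𝓡 (m + 1)).tangent ∞
    (fun x => (⟨f x, ν x⟩ : TangentBundle (𝓡 (m + 1)) M))
  normal_unit : ∀ x, g (f x) (ν x) (ν x) = 1
  normal_orthogonal : ∀ x (u : TangentSpace (𝓡 m) x),
    g (f x) (ν x) (mfderiv (𝓡 m) (𝓡 (m + 1)) f x u) = 0
  umbilical : ∀ e ∈ IsManifold.maximalAtlas (𝓡 (m + 1)) ∞ M,
    ∀ φ ∈ IsManifold.maximalAtlas (𝓡 m) ∞ N, ∀ x ∈ φ.source, f x ∈ e.source →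
      ∀ u w : Coord m, extrinsicCurvature g f ν e φ x u w
        = σ x * chartMetric (inducedMetric g f) φ (φ x) u w

/-- The warping functions `ρ` of the line element `dv² + ℓ² ρ(v/ℓ)² dσ_K²`, with `K`. -/
def IsWarping (lam ℓ : ℝ) (ρ : ℝ → ℝ) (K : ℝ) : Prop :=
  0 < ℓ ∧
    ((lam = 0 ∧ ((ρ = (fun χ => χ) ∧ K = 1) ∨ (ρ = (fun _ => 1) ∧ K = 0))) ∨
     (lam = 1 / ℓ ^ 2 ∧ ρ = Real.sin ∧ K = 1) ∨
     (lam = -1 / ℓ ^ 2 ∧ ((ρ = Real.sinh ∧ K = 1) ∨ (ρ = Real.exp ∧ K = 0) ∨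
       (ρ = Real.cosh ∧ K = -1))))

/-- The slice `v = v₀` of `dv² + ℓ² ρ(v/ℓ)² dσ_K²` is nonsingular, and its extrinsic curvature
`k(v₀) g_{ij}`, `k(v) = ρ'(v/ℓ) / (ℓ ρ(v/ℓ))`, satisfies `k(v₀)² = σ²`. -/
def IsAdmissibleSlice (sigma ℓ : ℝ) (ρ : ℝ → ℝ) (v₀ : ℝ) : Prop :=
  ρ (v₀ / ℓ) ≠ 0 ∧ (deriv ρ (v₀ / ℓ) / (ℓ * ρ (v₀ / ℓ))) ^ 2 = sigma ^ 2

/-- Near each of its points the hypersurface `f` has Gaussian normal coordinates `(v, x)`, with `x`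
in an open piece of `N`, in which `f` is the slice `v = v₀` and the ambient metric is
`dv² + ℓ² ρ(v/ℓ)² γ`. -/
def HasWarpedNormalForm (g : BilinField (m + 1) M) (f : N → M) (ℓ : ℝ) (ρ : ℝ → ℝ) (v₀ : ℝ)
    (γ : BilinField m N) : Prop :=
  ∀ x₀ : N, ∃ (ε : ℝ) (W : Set N) (Ψ : OpenPartialHomeomorph (ℝ × N) M),
    0 < ε ∧ IsOpen W ∧ x₀ ∈ W ∧ Ψ.source = Ioo (v₀ - ε) (v₀ + ε) ×ˢ W ∧
    ContMDiffOn (𝓘(ℝ, ℝ).prod (𝓡 m)) (𝓡 (m + 1)) ∞ Ψ Ψ.source ∧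
    ContMDiffOn (𝓡 (m + 1)) (𝓘(ℝ, ℝ).prod (𝓡 m)) ∞ Ψ.symm Ψ.target ∧
    (∀ x ∈ W, Ψ (v₀, x) = f x) ∧
    ∀ p ∈ Ψ.source, ∀ (a b : ℝ) (u w : TangentSpace (𝓡 m) p.2),
      g (Ψ p) (mfderiv (𝓘(ℝ, ℝ).prod (𝓡 m)) (𝓡 (m + 1)) Ψ p ((a, u) : ℝ × Coord m))
          (mfderiv (𝓘(ℝ, ℝ).prod (𝓡 m)) (𝓡 (m + 1)) Ψ p ((b, w) : ℝ × Coord m))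
        = a * b + ℓ ^ 2 * ρ (p.1 / ℓ) ^ 2 * γ p.2 u w

end Hypersurfaces

section Models

/-- The number of negative directions of the ambient form of the model: `0` for `Eⁿ`, `Sⁿ`;
`1` for `Hⁿ`, Minkowski and de Sitter space-time; `2` for anti-de Sitter space-time. -/
def modelIndex (kind : GeometryKind) (lam : ℝ) : ℕ :=
  (match kind with
    | GeometryKind.space => 0
    | GeometryKind.spacetime => 1) + (open Classical in if lam < 0 then 1 else 0)

/-- The pseudo-Euclidean form `Y · Y'` on the ambient `ℝⁿ⁺¹` of the `n`-dimensional model. -/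
def modelForm (kind : GeometryKind) (lam : ℝ) {n : ℕ} (Y Z : Coord (n + 1)) : ℝ :=
  ∑ i : Fin (n + 1), (if (i : ℕ) < modelIndex kind lam then -1 else 1) * (Y i * Z i)

/-- The standard `n`-dimensional (`n ≥ 2`) space(-time) of constant curvature `lam`, as a subset of
`ℝⁿ⁺¹`: the hyperplane `Yⁿ = 0` if `lam = 0`, and otherwise the quadric `Y · Y = 1 / lam`, of which
only the sheet `Y⁰ > 0` is taken for hyperbolic space. -/
def modelSet (kind : GeometryKind) (lam : ℝ) (n : ℕ) : Set (Coord (n + 1)) :=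
  {Y | (lam = 0 → Y (Fin.last n) = 0) ∧
    (lam ≠ 0 → modelForm kind lam Y Y = 1 / lam) ∧
    (kind = GeometryKind.space → lam < 0 → 0 < Y 0)}

/-- `(M, g)` is the standard space(-time) of constant curvature `lam` (`Eⁿ`, `Sⁿ`, `Hⁿ`, Minkowski,
de Sitter or anti-de Sitter), identified through the isometric embedding `ι` onto `modelSet`. -/
structure IsModelEmbedding (kind : GeometryKind) (lam : ℝ) {n : ℕ} {M : Type*}
    [TopologicalSpace M] [ChartedSpace (Coord n) M] (g : BilinField n M)
    (ι : M → Coord (n + 1)) : Prop where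
  smooth : ContMDiff (𝓡 n) (𝓡 (n + 1)) ∞ ι
  embedding : Topology.IsEmbedding ι
  range_eq : range ι = modelSet kind lam n
  isometry : ∀ (x : M) (u w : TangentSpace (𝓡 n) x),
    g x u w = modelForm kind lam (mfderiv (𝓡 n) (𝓡 (n + 1)) ι x u : Coord (n + 1))
      (mfderiv (𝓡 n) (𝓡 (n + 1)) ι x w : Coord (n + 1))

/-- `S` is one of the complete umbilical hypersurfaces of the standard space(-time), with
extrinsic curvature `±sigma g_{ij}`: for `lam ≠ 0` a section by a hyperplane `P · Y = sigma / lam`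
with `P · P = 1 + sigma² / lam`; for `lam = 0` a hyperplane with unit normal `P` (`sigma = 0`), or
the hypersphere / hyperboloid with centre `A` and radius `1 / |sigma|` (`sigma ≠ 0`). -/
def IsModelSlice (kind : GeometryKind) (lam sigma : ℝ) {n : ℕ} (S : Set (Coord (n + 1))) : Prop :=
  (lam ≠ 0 ∧ ∃ P : Coord (n + 1), modelForm kind lam P P = 1 + sigma ^ 2 / lam ∧
    S = {Y | Y ∈ modelSet kind lam n ∧ modelForm kind lam P Y = sigma / lam}) ∨
  (lam = 0 ∧ sigma = 0 ∧ ∃ P ∈ modelSet kind lam n, ∃ c : ℝ, modelForm kind lam P P = 1 ∧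
    S = {Y | Y ∈ modelSet kind lam n ∧ modelForm kind lam P Y = c}) ∨
  (lam = 0 ∧ sigma ≠ 0 ∧ ∃ A ∈ modelSet kind lam n,
    S = {Y | Y ∈ modelSet kind lam n ∧ modelForm kind lam (Y - A) (Y - A) = 1 / sigma ^ 2})

end Models

end

/-!
The ambient manifold is compared with a quadric. A metric `g` of constant curvature `lam = εκ²`,
`ε = ± 1`, is locally isometric to a hypersurface `2 B(c, Y) + κ B(Y, Y) = d` of a
pseudo-Euclidean space of one dimension more, on which `ξ = c + κ Y` is a normal vector of square
`ε`; for `κ = 0` this is a hyperplane, so that flat metrics need no separate treatment. Such a map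
`j` is a *development* (`IsDevelopment`). It solves the linear total differential equation
`dj = L`, `dξ = κ L`, `∇L = -εκ g ξ`, whose integrability condition is the constancy of the curvature
(`developmentSystem_flat`), so it exists by the linear Frobenius theorem `exists_solution_of_flat`
(`IsConstantCurvatureMetric.exists_development`). The standard embeddings of the models are global
developments (`IsModelEmbedding.exists_isDevelopment`).

For an umbilical hypersurface `f` put `F = j ∘ f`, and let `η` be the developed unit normal. The
umbilicity becomes the equation of Weingarten `dη = -σ dF`
(`IsUmbilicalHypersurface.isUmbilicalDevelopment`). Differentiating once more and using the
symmetry of second derivatives shows that `σ` is locally constant in dimension at least two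
(`eventually_eq_of_fderiv_eq_smul`). The equation of Gauss then gives the intrinsic curvature
`lam + σ²`, and explicit normal geodesics `F + s η - εκ e ξ` of the quadric give Gaussian normal
coordinates with the metric `dt² + (1 - lam e - σ s)² f^*g`
(`IsUmbilicalDevelopment.exists_normal_coordinates`); the addition theorem for the functions `ρ`
identifies the factor with the one of the line element.

Since `dη = -σ dF`, the vector `η + σ F` and the constant term of
`2 B(η, Y - F) - σ B(Y - F, Y - F)` (`sliceFunction`) do not depend on the point of the hypersurface: this function vanishes on
the hypersurface, and near each of its points the hypersurface is exactly its zero set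
(`IsUmbilicalDevelopment.exists_isOpen_image_eq`). Two hypersurfaces with the same `σ²` have,
after a change of sign of a normal, congruent frames of tangent vectors, `η` and `ξ`; the rigid
motion of the pseudo-Euclidean spaces which matches the frames respects the quadrics and the slice
functions, and therefore induces the required isometry, locally in general and globally for the
models.

In the models the zero set of the slice function is one of the listed hypersurfaces. In the
coordinates of the frame it is a graph or a family of spheres over a connected base, hence
connected (`isPreconnected_sliceCoordinates`), and a closed umbilical hypersurface, being open and
closed in it, is all of it.
-/

/-! ### Linear total differential equations -/

section TotalDifferentialEquations

set_option maxSynthPendingDepth 3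

variable {V E : Type*} [NormedAddCommGroup V] [NormedSpace ℝ V]
  [NormedAddCommGroup E] [NormedSpace ℝ E]

/-- Gronwall's lemma along the rays of a ball: a function whose derivative is bounded by a multiple
of its norm and which vanishes at the centre is zero. -/
theorem eq_zero_of_norm_fderiv_le {Z : V → E} {Z' : V → V →L[ℝ] E} {y₀ : V} {r C : ℝ}
    (hZ : ∀ y ∈ Metric.ball y₀ r, HasFDerivAt Z (Z' y) y)
    (hC : ∀ y ∈ Metric.ball y₀ r, ‖Z' y‖ ≤ C * ‖Z y‖) (h0 : Z y₀ = 0) :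
    ∀ y ∈ Metric.ball y₀ r, Z y = 0 := by
  intro y hy
  have hmem : ∀ t ∈ Icc (0 : ℝ) 1, y₀ + t • (y - y₀) ∈ Metric.ball y₀ r := by
    intro t ht
    rw [mem_ball_iff_norm] at hy ⊢
    rw [add_sub_cancel_left, norm_smul, Real.norm_of_nonneg ht.1]
    exact (mul_le_of_le_one_left (norm_nonneg _) ht.2).trans_lt hy
  have hd : ∀ t ∈ Icc (0 : ℝ) 1, HasDerivAt (fun t : ℝ => Z (y₀ + t • (y - y₀)))
      (Z' (y₀ + t • (y - y₀)) (y - y₀)) t := by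
    intro t ht
    have h1 : HasDerivAt (fun t : ℝ => y₀ + t • (y - y₀)) (y - y₀) t := by
      simpa using ((hasDerivAt_id t).smul_const (y - y₀)).const_add y₀
    exact (hZ _ (hmem t ht)).comp_hasDerivAt t h1
  have := eq_zero_of_abs_deriv_le_mul_abs_self_of_eq_zero_right (K := C * ‖y - y₀‖)
    (fun t ht => (hd t ht).continuousAt.continuousWithinAt)
    (fun t ht => (hd t (Ico_subset_Icc_self ht)).hasDerivWithinAt) (by simp [h0])
    (fun t ht => by
      refine (ContinuousLinearMap.le_opNorm _ _).trans ?_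
      have := hC _ (hmem t (Ico_subset_Icc_self ht))
      nlinarith [norm_nonneg (y - y₀)]) 1 (by simp)
  simpa using this

/-- Solutions of a linear ordinary differential equation with small coefficients exist on the unit
interval. -/
theorem exists_linear_ode_solution [CompleteSpace E] {B : ℝ → E →L[ℝ] E}
    (hB : ContinuousOn B (Icc 0 1)) (hK : ∀ t ∈ Icc (0 : ℝ) 1, ‖B t‖ ≤ 1 / 2) (X₀ : E) :
    ∃ a : ℝ → E, a 0 = X₀ ∧
      ∀ t ∈ Icc (0 : ℝ) 1, HasDerivWithinAt a (B t (a t)) (Icc 0 1) t := by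
  have hpl : IsPicardLindelof (fun t x => B t x) (⟨0, by simp⟩ : Icc (0 : ℝ) 1) X₀
      ‖X₀‖₊ 0 ‖X₀‖₊ (1 / 2) := by
    refine ⟨fun t ht => ?_, fun x _ => hB.clm_apply continuousOn_const, fun t ht x hx => ?_, ?_⟩
    · refine LipschitzOnWith.of_dist_le_mul fun x _ y _ => ?_
      rw [dist_eq_norm, dist_eq_norm, ← map_sub]
      refine ((B t).le_opNorm _).trans ?_
      push_cast
      exact mul_le_mul_of_nonneg_right (hK t ht) (norm_nonneg _)
    · have h1 : ‖x‖ ≤ 2 * ‖X₀‖ := by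
        have := norm_le_of_mem_closedBall hx
        push_cast at this
        linarith
      refine ((B t).le_opNorm _).trans ?_
      push_cast
      nlinarith [hK t ht, norm_nonneg (B t), norm_nonneg x]
    · simp
  exact hpl.exists_eq_forall_mem_Icc_hasDerivWithinAt₀

/-- The discrepancy `b - a - t A(v) a` between neighbouring radial solutions `a`, `b` of a flat
linear system solves a linear equation whose inhomogeneity is this expression; flatness makes it
quadratic in `v`. -/
theorem flat_remainder_eq {A₁ A₀ Δ : V →L[ℝ] E →L[ℝ] E} {A' : V →L[ℝ] V →L[ℝ] E →L[ℝ] E} {t : ℝ}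
    {y v : V} (a : E) (hΔ : A₁ = A₀ + t • A' v + Δ)
    (flat : A' y v + A₀ v ∘L A₀ y = A' v y + A₀ y ∘L A₀ v) :
    A₁ (y + v) (a + t • A₀ v a) - A₀ y a
        - ((A₀ v a + t • A' y v a) + t • A₀ v (A₀ y a))
      = t • A₀ v (A₀ v a) + t ^ 2 • A' v y (A₀ v a) + t • A' v v (a + t • A₀ v a)
        + Δ (y + v) (a + t • A₀ v a) := by
  have h := congrArg (fun T : E →L[ℝ] E => t • T a) flat
  simp only [add_apply, ContinuousLinearMap.comp_apply, smul_add] at h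
  subst hΔ
  simp only [add_apply, smul_apply, map_add, map_smul, smul_add, smul_smul, ← sq]
  rw [← sub_eq_zero] at h ⊢
  rw [← neg_eq_zero, ← h]
  module

/-- Gronwall's hypothesis for the discrepancy of neighbouring radial solutions. -/
theorem norm_flat_discrepancy_le {A₁ A₀ Δ : V →L[ℝ] E →L[ℝ] E} {A' : V →L[ℝ] V →L[ℝ] E →L[ℝ] E}
    {t K Ma : ℝ} {y v : V} {a b : E} (hK1 : 1 ≤ K) (ht0 : 0 ≤ t) (ht1 : t ≤ 1)
    (hΔ : A₁ = A₀ + t • A' v + Δ)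
    (flat : A' y v + A₀ v ∘L A₀ y = A' v y + A₀ y ∘L A₀ v)
    (hAn : ‖A₀‖ ≤ K) (hAn1 : ‖A₁‖ ≤ K) (hAn' : ‖A'‖ ≤ K) (hΔn : ‖Δ‖ ≤ K * ‖v‖ ^ 2)
    (hy1 : ‖y‖ ≤ 1) (hy1' : ‖y + v‖ ≤ 1) (hav : ‖a‖ ≤ Ma) :
    ‖A₁ (y + v) b - A₀ y a - ((A₀ v a + t • A' y v a) + t • A₀ v (A₀ y a))‖
      ≤ K * ‖b - a - t • A₀ v a‖ + 8 * K ^ 2 * Ma * ‖v‖ ^ 2 := by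
  have hK0 : 0 < K := by linarith
  have hMa0 : 0 ≤ Ma := (norm_nonneg _).trans hav
  have hsplit : A₁ (y + v) b - A₀ y a - ((A₀ v a + t • A' y v a) + t • A₀ v (A₀ y a))
      = A₁ (y + v) (b - a - t • A₀ v a)
        + (t • A₀ v (A₀ v a) + t ^ 2 • A' v y (A₀ v a) + t • A' v v (a + t • A₀ v a)
          + Δ (y + v) (a + t • A₀ v a)) := by
    rw [← flat_remainder_eq a hΔ flat]
    simp only [map_sub, map_add]
    abel
  have hA0v : ∀ x, ‖A₀ v x‖ ≤ K * ‖v‖ * ‖x‖ := fun x => (A₀.le_opNorm₂ v x).trans (by gcongr)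
  have hA'n : ∀ w x, ‖A' v w x‖ ≤ K * ‖v‖ * ‖w‖ * ‖x‖ := fun w x =>
    ((A' v).le_opNorm₂ w x).trans (by gcongr; exact (A'.le_opNorm v).trans (by gcongr))
  have hv1 : ‖v‖ ≤ 2 := by
    calc ‖v‖ = ‖(y + v) - (y)‖ := by congr 1; abel
      _ ≤ 1 + 1 := (norm_sub_le _ _).trans (add_le_add hy1' hy1)
      _ = 2 := by norm_num
  have hb : ‖a + t • A₀ v a‖ ≤ (1 + K * ‖v‖) * Ma := by
    refine (norm_add_le _ _).trans ?_
    rw [norm_smul, Real.norm_of_nonneg ht0]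
    have := hA0v a
    calc _ ≤ Ma + 1 * (K * ‖v‖ * Ma) := by
          gcongr
          exact this.trans (by gcongr)
      _ = _ := by ring
  have hb3 : (1 + K * ‖v‖) * Ma ≤ 3 * K * Ma := by
    gcongr
    nlinarith
  have hb' := hb.trans hb3
  have e0 : ‖A₁ (y + v) (b - a - t • A₀ v a)‖ ≤ K * ‖b - a - t • A₀ v a‖ :=
    calc _ ≤ ‖A₁‖ * ‖y + v‖ * ‖b - a - t • A₀ v a‖ := A₁.le_opNorm₂ _ _
      _ ≤ K * 1 * ‖b - a - t • A₀ v a‖ := by gcongr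
      _ = _ := by ring
  have e1 : ‖t • A₀ v (A₀ v a)‖ ≤ K ^ 2 * Ma * ‖v‖ ^ 2 := by
    rw [norm_smul, Real.norm_of_nonneg ht0]
    calc _ ≤ 1 * (K * ‖v‖ * (K * ‖v‖ * Ma)) := by
          gcongr
          exact (hA0v _).trans (by gcongr; exact (hA0v _).trans (by gcongr))
      _ = _ := by ring
  have e2 : ‖t ^ 2 • A' v (y) (A₀ v a)‖ ≤ K ^ 2 * Ma * ‖v‖ ^ 2 := by
    rw [norm_smul, Real.norm_of_nonneg (sq_nonneg t)]
    calc _ ≤ 1 * (K * ‖v‖ * 1 * (K * ‖v‖ * Ma)) := by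
          gcongr
          · exact pow_le_one₀ ht0 ht1
          · exact (hA'n _ _).trans (by gcongr; exact (hA0v _).trans (by gcongr))
      _ = _ := by ring
  have e3 : ‖t • A' v v (a + t • A₀ v a)‖ ≤ 3 * K ^ 2 * Ma * ‖v‖ ^ 2 := by
    rw [norm_smul, Real.norm_of_nonneg ht0]
    calc _ ≤ 1 * (K * ‖v‖ * ‖v‖ * (3 * K * Ma)) := by
          gcongr
          exact (hA'n _ _).trans (by gcongr)
      _ = _ := by ring
  have e4 : ‖Δ (y + v) (a + t • A₀ v a)‖ ≤ 3 * K ^ 2 * Ma * ‖v‖ ^ 2 :=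
    calc _ ≤ ‖Δ‖ * ‖y + v‖ * ‖a + t • A₀ v a‖ := Δ.le_opNorm₂ _ _
      _ ≤ K * ‖v‖ ^ 2 * 1 * (3 * K * Ma) := by gcongr
      _ = _ := by ring
  rw [hsplit]
  calc _ ≤ _ := norm_add_le _ _
    _ ≤ K * ‖b - a - t • A₀ v a‖ + (K ^ 2 * Ma * ‖v‖ ^ 2 + K ^ 2 * Ma * ‖v‖ ^ 2 + 3 * K ^ 2 * Ma * ‖v‖ ^ 2
          + 3 * K ^ 2 * Ma * ‖v‖ ^ 2) := by
        gcongr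
        exact norm_add_le_of_le (norm_add_le_of_le (norm_add_le_of_le e1 e2) e3) e4
    _ = _ := by ring

/-- **Linear Frobenius theorem.** The system `dX(v) = A(v) X` has a local solution with any initial
value if its curvature `dA - A ∧ A` vanishes. -/
theorem exists_solution_of_flat [CompleteSpace E] {A : V → V →L[ℝ] E →L[ℝ] E} {y₀ : V}
    (hA : ContDiffAt ℝ 2 A y₀)
    (flat : ∀ᶠ y in 𝓝 y₀, ∀ u v, fderiv ℝ A y u v + A y v ∘L A y u
      = fderiv ℝ A y v u + A y u ∘L A y v) (X₀ : E) :
    ∃ (r : ℝ) (X : V → E), 0 < r ∧ X y₀ = X₀ ∧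
      ∀ y ∈ Metric.ball y₀ r, HasFDerivAt X ((A y).flip (X y)) y := by
  -- bounds for `A`, its derivative, and the Lipschitz constant of the derivative
  obtain ⟨L, s, hs, hL⟩ :=
    (hA.fderiv_right (m := 1) (by norm_num)).exists_lipschitzOnWith
  have hb1 : ∀ᶠ y in 𝓝 y₀, ‖A y‖ < ‖A y₀‖ + 1 :=
    (tendsto_norm.comp hA.continuousAt).eventually_lt_const (by linarith)
  have hb2 : ∀ᶠ y in 𝓝 y₀, ‖fderiv ℝ A y‖ < ‖fderiv ℝ A y₀‖ + 1 :=
    (tendsto_norm.comp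
      (hA.fderiv_right (m := 1) (by norm_num)).continuousAt).eventually_lt_const (by linarith)
  have hd : ∀ᶠ y in 𝓝 y₀, DifferentiableAt ℝ A y :=
    (hA.eventually (by simp)).mono fun y hy => hy.differentiableAt (by norm_num)
  obtain ⟨K, hK1, hKA, hKD, hKL⟩ : ∃ K : ℝ, 1 ≤ K ∧ ‖A y₀‖ + 1 ≤ K ∧ ‖fderiv ℝ A y₀‖ + 1 ≤ K ∧
      (L : ℝ) ≤ K := by
    refine ⟨max (max 1 (‖A y₀‖ + 1)) (max (‖fderiv ℝ A y₀‖ + 1) L), ?_, ?_, ?_, ?_⟩ <;> simp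
  obtain ⟨R, hR, hball⟩ := Metric.eventually_nhds_iff_ball.1
    (hb1.and (hb2.and (hd.and (flat.and hs))))
  -- the radius makes the radial equations contractive, with coefficients of norm at most `1 / 2`
  set r : ℝ := min (min R 1) (1 / (2 * K)) with hr
  have hK0 : 0 < K := by linarith
  have hrpos : 0 < r := by positivity
  have hr1 : r ≤ 1 := (min_le_left _ _).trans (min_le_right _ _)
  have hrK : r * K ≤ 1 / 2 := by
    have : r ≤ 1 / (2 * K) := min_le_right _ _
    calc r * K ≤ 1 / (2 * K) * K := by gcongr
      _ = 1 / 2 := by field_simp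
  have hsub : Metric.ball y₀ r ⊆ Metric.ball y₀ R :=
    Metric.ball_subset_ball ((min_le_left _ _).trans (min_le_left _ _))
  have hAK : ∀ y ∈ Metric.ball y₀ r, ‖A y‖ ≤ K := fun y hy =>
    (hball y (hsub hy)).1.le.trans hKA
  have hDK : ∀ y ∈ Metric.ball y₀ r, ‖fderiv ℝ A y‖ ≤ K := fun y hy =>
    (hball y (hsub hy)).2.1.le.trans hKD
  have hdiff : ∀ y ∈ Metric.ball y₀ r, DifferentiableAt ℝ A y := fun y hy =>
    (hball y (hsub hy)).2.2.1
  have hflat := fun y (hy : y ∈ Metric.ball y₀ r) => (hball y (hsub hy)).2.2.2.1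
  -- points of the rays
  have hmem : ∀ y ∈ Metric.ball y₀ r, ∀ t ∈ Icc (0 : ℝ) 1,
      y₀ + t • (y - y₀) ∈ Metric.ball y₀ r := by
    intro y hy t ht
    rw [mem_ball_iff_norm] at hy ⊢
    rw [add_sub_cancel_left, norm_smul, Real.norm_of_nonneg ht.1]
    exact (mul_le_of_le_one_left (norm_nonneg _) ht.2).trans_lt hy
  have hray : ∀ (y : V) (t : ℝ), HasDerivAt (fun t : ℝ => y₀ + t • (y - y₀)) (y - y₀) t := by
    intro y t
    simpa using ((hasDerivAt_id t).smul_const (y - y₀)).const_add y₀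
  -- the radial solutions
  have hex : ∀ y ∈ Metric.ball y₀ r, ∃ a : ℝ → E, a 0 = X₀ ∧ ∀ t ∈ Icc (0 : ℝ) 1,
      HasDerivWithinAt a (A (y₀ + t • (y - y₀)) (y - y₀) (a t)) (Icc 0 1) t := by
    intro y hy
    refine exists_linear_ode_solution (B := fun t => A (y₀ + t • (y - y₀)) (y - y₀)) ?_ ?_ X₀
    · intro t ht
      have := (hdiff _ (hmem y hy t ht)).continuousAt.comp_of_eq (hray y t).continuousAt rfl
      exact (this.clm_apply continuousAt_const).continuousWithinAt
    · intro t ht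
      refine (ContinuousLinearMap.le_opNorm _ _).trans ?_
      have h1 := hAK _ (hmem y hy t ht)
      have h2 : ‖y - y₀‖ ≤ r := (mem_ball_iff_norm.1 hy).le
      calc _ ≤ K * r := by gcongr
        _ ≤ 1 / 2 := by linarith
  choose! a ha0 ha using hex
  -- they are uniformly bounded
  set Ma : ℝ := ‖X₀‖ * Real.exp K with hMa
  have hMa0 : 0 ≤ Ma := by positivity
  have hIci : ∀ {f : ℝ → E} {f' : E} {t : ℝ}, t ∈ Ico (0 : ℝ) 1 →
      HasDerivWithinAt f f' (Icc 0 1) t → HasDerivWithinAt f f' (Ici t) t :=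
    fun ht h => h.mono_of_mem_nhdsWithin (Icc_mem_nhdsGE_of_mem ht)
  have hbound : ∀ y ∈ Metric.ball y₀ r, ∀ t ∈ Icc (0 : ℝ) 1, ‖a y t‖ ≤ Ma := by
    intro y hy t ht
    have := norm_le_gronwallBound_of_norm_deriv_right_le (K := K) (ε := 0) (δ := ‖X₀‖)
      (fun t ht => (ha y hy t ht).continuousWithinAt)
      (fun t ht => hIci ht (ha y hy t (Ico_subset_Icc_self ht))) (by rw [ha0 y hy])
      (fun t ht => by
        have h1 := hAK _ (hmem y hy t (Ico_subset_Icc_self ht))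
        have h2 : ‖y - y₀‖ ≤ 1 := (mem_ball_iff_norm.1 hy).le.trans hr1
        calc _ ≤ ‖A (y₀ + t • (y - y₀))‖ * ‖y - y₀‖ * ‖a y t‖ :=
              (A (y₀ + t • (y - y₀))).le_opNorm₂ _ _
          _ ≤ K * 1 * ‖a y t‖ := by gcongr
          _ = K * ‖a y t‖ + 0 := by ring) t ht
    rw [gronwallBound_ε0, sub_zero] at this
    refine this.trans ?_
    rw [hMa]
    gcongr
    nlinarith [ht.2]
  -- the solution is the endpoint map `y ↦ a y 1`; flatness makes it differentiable
  refine ⟨r, fun y => a y 1, hrpos, ?_, ?_⟩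
  · have hy0 : y₀ ∈ Metric.ball y₀ r := Metric.mem_ball_self hrpos
    have := norm_image_sub_le_of_norm_deriv_le_segment_01' (C := 0) (ha y₀ hy0) (by simp)
    rw [norm_le_zero_iff, sub_eq_zero, ha0 y₀ hy0] at this
    exact this
  intro y hy
  set C : ℝ := 8 * K ^ 2 * Ma with hC
  have hC0 : 0 ≤ C := by positivity
  -- the discrepancy from the claimed derivative is quadratic in `v`, by Gronwall along the ray
  have key : ∀ v, y + v ∈ Metric.ball y₀ r →
      ‖a (y + v) 1 - a y 1 - A y v (a y 1)‖ ≤ gronwallBound 0 K 1 1 * C * ‖v‖ ^ 2 := by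
    intro v hyv
    set z : ℝ → V := fun t => y₀ + t • (y - y₀) with hz
    set z₁ : ℝ → V := fun t => y₀ + t • (y + v - y₀) with hz1
    have hzz : ∀ t, z₁ t = z t + t • v := fun t => by simp only [hz, hz1]; module
    have hy1 : ‖y - y₀‖ ≤ 1 := (mem_ball_iff_norm.1 hy).le.trans hr1
    have hy1' : ‖(y - y₀) + v‖ ≤ 1 := by
      rw [show (y - y₀) + v = (y + v) - y₀ by abel]
      exact (mem_ball_iff_norm.1 hyv).le.trans hr1
    set D : ℝ → E := fun t => a (y + v) t - a y t - t • A (z t) v (a y t) with hD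
    set D' : ℝ → E := fun t => A (z₁ t) (y + v - y₀) (a (y + v) t) - A (z t) (y - y₀) (a y t)
      - ((A (z t) v (a y t) + t • fderiv ℝ A (z t) (y - y₀) v (a y t))
        + t • A (z t) v (A (z t) (y - y₀) (a y t))) with hD'
    have hderiv : ∀ t ∈ Icc (0 : ℝ) 1, HasDerivWithinAt D (D' t) (Icc 0 1) t := by
      intro t ht
      have hAz : HasDerivWithinAt (fun t => A (z t)) (fderiv ℝ A (z t) (y - y₀)) (Icc 0 1) t :=
        ((hdiff _ (hmem y hy t ht)).hasFDerivAt.comp_hasDerivAt t (hray y t)).hasDerivWithinAt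
      have h1 := (hAz.clm_apply (hasDerivWithinAt_const t (Icc 0 1) v)).clm_apply (ha y hy t ht)
      have h2 := (hasDerivWithinAt_id t (Icc 0 1)).smul h1
      refine (((ha _ hyv t ht).sub (ha _ hy t ht)).sub h2).congr_deriv ?_
      simp only [hD', id, map_zero, add_zero, one_smul, smul_add]
      abel
    have hest : ∀ t ∈ Ico (0 : ℝ) 1, ‖D' t‖ ≤ K * ‖D t‖ + C * ‖v‖ ^ 2 := by
      intro t ht'
      have ht := Ico_subset_Icc_self ht'
      set A₀ := A (z t) with hA0
      set A₁ := A (z₁ t) with hA1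
      set A' := fderiv ℝ A (z t) with hA'
      set Δ := A₁ - A₀ - t • A' v with hΔ
      have hAn : ‖A₀‖ ≤ K := hAK _ (hmem y hy t ht)
      have hAn1 : ‖A₁‖ ≤ K := hAK _ (hmem _ hyv t ht)
      have hAn' : ‖A'‖ ≤ K := hDK _ (hmem y hy t ht)
      -- Taylor's estimate for `A`, from the Lipschitz bound of its derivative
      have hΔn : ‖Δ‖ ≤ K * ‖v‖ ^ 2 := by
        have hseg : segment ℝ (z t) (z₁ t) ⊆ Metric.ball y₀ r :=
          (convex_ball y₀ r).segment_subset (hmem y hy t ht) (hmem _ hyv t ht)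
        have h1 := (convex_segment (z t) (z₁ t)).norm_image_sub_le_of_norm_hasFDerivWithin_le'
          (f := A) (f' := fderiv ℝ A) (φ := A') (C := K * ‖v‖)
          (fun x hx => (hdiff x (hseg hx)).hasFDerivAt.hasFDerivWithinAt)
          (fun x hx => by
            have h2 := hL.dist_le_mul x ((hball _ (hsub (hseg hx))).2.2.2.2) (z t)
              ((hball _ (hsub (hmem y hy t ht))).2.2.2.2)
            rw [dist_eq_norm, dist_eq_norm] at h2
            have h3 : ‖x - z t‖ ≤ ‖v‖ := by
              obtain ⟨θ, hθ, rfl⟩ := segment_eq_image ℝ (z t) (z₁ t) ▸ hx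
              rw [hzz, show (1 - θ) • z t + θ • (z t + t • v) - z t = (θ * t) • v by module,
                norm_smul, Real.norm_of_nonneg (mul_nonneg hθ.1 ht.1)]
              have : θ * t ≤ 1 := by nlinarith [hθ.1, hθ.2, ht.1, ht.2]
              exact mul_le_of_le_one_left (norm_nonneg _) this
            calc _ ≤ (L : ℝ) * ‖x - z t‖ := h2
              _ ≤ K * ‖v‖ := by gcongr)
          (left_mem_segment ℝ _ _) (right_mem_segment ℝ _ _)
        rw [hzz t, add_sub_cancel_left, ← hzz t, map_smul] at h1
        refine h1.trans ?_
        rw [norm_smul, Real.norm_of_nonneg ht.1]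
        have := ht.2
        calc K * ‖v‖ * (t * ‖v‖) ≤ K * ‖v‖ * (1 * ‖v‖) := by gcongr
          _ = _ := by ring
      have h1 := norm_flat_discrepancy_le (A₁ := A₁) (A₀ := A₀) (A' := A') (Δ := Δ) (t := t)
        (y := y - y₀) (v := v) (a := a y t) (b := a (y + v) t) hK1 ht.1 ht.2 (by rw [hΔ]; abel)
        (hflat _ (hmem y hy t ht) (y - y₀) v) hAn hAn1 hAn' hΔn hy1 hy1' (hbound y hy t ht)
      rw [← show y + v - y₀ = y - y₀ + v by abel] at h1
      exact h1
    have := norm_le_gronwallBound_of_norm_deriv_right_le (K := K) (ε := C * ‖v‖ ^ 2) (δ := 0)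
      (fun t ht => (hderiv t ht).continuousWithinAt)
      (fun t ht => hIci ht (hderiv t (Ico_subset_Icc_self ht)))
      (by simp [hD, ha0 y hy, ha0 _ hyv]) hest 1 (by simp)
    rw [sub_zero] at this
    simp only [hD, hz, one_smul, add_sub_cancel] at this
    refine this.trans (le_of_eq ?_)
    rw [gronwallBound_of_K_ne_0 hK0.ne', gronwallBound_of_K_ne_0 hK0.ne']
    ring
  rw [hasFDerivAt_iff_isLittleO_nhds_zero]
  refine Asymptotics.IsBigO.trans_isLittleO (g := fun v : V => ‖v‖ ^ 2) ?_ ?_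
  · refine Asymptotics.IsBigO.of_bound (gronwallBound 0 K 1 1 * C) ?_
    have : ∀ᶠ v in 𝓝 (0 : V), y + v ∈ Metric.ball y₀ r :=
      (continuous_const.add continuous_id).continuousAt.eventually_mem
        (Metric.isOpen_ball.mem_nhds (by simpa using hy))
    filter_upwards [this] with v hv
    simpa using key v hv
  · simpa using (Asymptotics.isLittleO_norm_pow_id (E' := V) (n := 2) one_lt_two)

/-- Solutions of `dX = A X` inherit the smoothness of the coefficients. -/
theorem contDiffOn_of_hasFDerivAt_linear {A : V → V →L[ℝ] E →L[ℝ] E} {X : V → E} {s : Set V}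
    (hs : IsOpen s) (hA : ContDiffOn ℝ ∞ A s)
    (hX : ∀ y ∈ s, HasFDerivAt X ((A y).flip (X y)) y) : ContDiffOn ℝ ∞ X s := by
  rw [contDiffOn_infty]
  intro k
  induction k with
  | zero =>
    exact contDiffOn_zero.2 fun y hy => (hX y hy).continuousAt.continuousWithinAt
  | succ k ih =>
    have h : ContDiffOn ℝ k (fun y => (A y).flip (X y)) s :=
      (((ContinuousLinearMap.flipₗᵢ ℝ V E E).contDiff.comp_contDiffOn
        (hA.of_le (by exact_mod_cast le_top)))).clm_apply ih
    push_cast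
    rw [contDiffOn_succ_iff_fderiv_of_isOpen hs]
    refine ⟨fun y hy => (hX y hy).differentiableAt.differentiableWithinAt, by simp, ?_⟩
    exact h.congr fun y hy => (hX y hy).fderiv

end TotalDifferentialEquations

/-! ### Metrics in coordinates -/

section CoordinateMetrics

set_option maxSynthPendingDepth 3

variable {n : ℕ}

/-- A smooth nondegenerate symmetric metric on an open set `O` of coordinate space. -/
structure IsCoordMetric (G : Coord n → Coord n →L[ℝ] Coord n →L[ℝ] ℝ) (O : Set (Coord n)) :
    Prop where
  isOpen : IsOpen O
  smooth : ContDiffOn ℝ ∞ G O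
  symm : ∀ y ∈ O, ∀ u v, G y u v = G y v u
  nondegenerate : ∀ y ∈ O, ∀ u, (∀ v, G y u v = 0) → u = 0

theorem isInvertible_of_nondegenerate {b : Coord n →L[ℝ] Coord n →L[ℝ] ℝ}
    (h : ∀ u, (∀ v, b u v = 0) → u = 0) : b.IsInvertible := by
  have hinj : Function.Injective (b : Coord n →ₗ[ℝ] (Coord n →L[ℝ] ℝ)) := by
    rw [← LinearMap.ker_eq_bot, LinearMap.ker_eq_bot']
    intro u hu
    exact h u fun v => by simpa using DFunLike.congr_fun hu v
  have hfr : Module.finrank ℝ (Coord n) = Module.finrank ℝ (Coord n →L[ℝ] ℝ) := by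
    rw [← (LinearMap.toContinuousLinearMap (𝕜 := ℝ) (E := Coord n) (F' := ℝ)).finrank_eq]
    exact (Subspace.dual_finrank_eq).symm
  have : FiniteDimensional ℝ (Coord n →L[ℝ] ℝ) :=
    (LinearMap.toContinuousLinearMap (𝕜 := ℝ) (E := Coord n) (F' := ℝ)).finiteDimensional
  exact ⟨(LinearMap.linearEquivOfInjective _ hinj hfr).toContinuousLinearEquiv, by ext; rfl⟩

/-- The Christoffel symbols of the first kind as a continuous trilinear form. -/
noncomputable def christoffelLowerMap (G : Coord n → Coord n →L[ℝ] Coord n →L[ℝ] ℝ) (y : Coord n) :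
    Coord n →L[ℝ] Coord n →L[ℝ] Coord n →L[ℝ] ℝ :=
  (1 / 2 : ℝ) • (fderiv ℝ G y + (fderiv ℝ G y).flip -
    ((ContinuousLinearMap.flipₗᵢ ℝ (Coord n) (Coord n) ℝ).toContinuousLinearEquiv :
      (Coord n →L[ℝ] Coord n →L[ℝ] ℝ) →L[ℝ] _) ∘L (fderiv ℝ G y).flip)

/-- The Christoffel symbols of the second kind as a continuous bilinear map. -/
noncomputable def christoffelMap (G : Coord n → Coord n →L[ℝ] Coord n →L[ℝ] ℝ) (y : Coord n) :
    Coord n →L[ℝ] Coord n →L[ℝ] Coord n :=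
  (ContinuousLinearMap.compL ℝ (Coord n) (Coord n →L[ℝ] ℝ) (Coord n)
    (ContinuousLinearMap.inverse (G y))) ∘L christoffelLowerMap G y

theorem christoffelLowerMap_apply (G : Coord n → Coord n →L[ℝ] Coord n →L[ℝ] ℝ) (y u v : Coord n) :
    christoffelLowerMap G y u v = christoffelLower G y u v := by
  ext w
  simp [christoffelLowerMap, christoffelLower]

theorem christoffelMap_apply (G : Coord n → Coord n →L[ℝ] Coord n →L[ℝ] ℝ) (y u v : Coord n) :
    christoffelMap G y u v = christoffel G y u v := by
  simp [christoffelMap, christoffel, christoffelLowerMap_apply]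

theorem christoffelLower_apply (G : Coord n → Coord n →L[ℝ] Coord n →L[ℝ] ℝ) (y u v w : Coord n) :
    christoffelLower G y u v w
      = (1 / 2) * (fderiv ℝ G y u v w + fderiv ℝ G y v u w - fderiv ℝ G y w u v) := by
  simp [christoffelLower]

namespace IsCoordMetric

variable {G : Coord n → Coord n →L[ℝ] Coord n →L[ℝ] ℝ} {O : Set (Coord n)} (hG : IsCoordMetric G O)
  {y : Coord n}
include hG

theorem mono {O' : Set (Coord n)} (hO : IsOpen O') (h : O' ⊆ O) : IsCoordMetric G O' :=
  ⟨hO, hG.smooth.mono h, fun y hy => hG.symm y (h hy), fun y hy => hG.nondegenerate y (h hy)⟩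

theorem isInvertible (hy : y ∈ O) : (G y).IsInvertible :=
  isInvertible_of_nondegenerate (hG.nondegenerate y hy)

theorem differentiableAt (hy : y ∈ O) : DifferentiableAt ℝ G y :=
  (hG.smooth.contDiffAt (hG.isOpen.mem_nhds hy)).differentiableAt (by simp)

theorem contDiffOn_christoffelMap : ContDiffOn ℝ ∞ (christoffelMap G) O := by
  have hT : ContDiffOn ℝ ∞ (fderiv ℝ G) O := hG.smooth.fderiv_of_isOpen hG.isOpen le_rfl
  have hT' : ContDiffOn ℝ ∞ (fun y => (fderiv ℝ G y).flip) O :=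
    (ContinuousLinearMap.flipₗᵢ ℝ (Coord n) (Coord n)
      (Coord n →L[ℝ] ℝ)).contDiff.comp_contDiffOn hT
  have hinv : ContDiffOn ℝ ∞ (fun y => ContinuousLinearMap.inverse (G y)) O := fun y hy =>
    ((hG.isInvertible hy).contDiffAt_map_inverse.comp y
      (hG.smooth.contDiffAt (hG.isOpen.mem_nhds hy))).contDiffWithinAt
  refine ContDiffOn.clm_comp ((ContinuousLinearMap.compL ℝ (Coord n) (Coord n →L[ℝ] ℝ)
    (Coord n)).contDiff.comp_contDiffOn hinv) ?_
  exact (contDiff_const_smul (1 / 2 : ℝ)).comp_contDiffOn ((hT.add hT').sub (contDiffOn_const.clm_comp hT'))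

theorem apply_christoffel (hy : y ∈ O) (u v w : Coord n) :
    G y (christoffel G y u v) w = christoffelLower G y u v w := by
  rw [christoffel, (hG.isInvertible hy).self_apply_inverse]

theorem hasFDerivAt_apply (hy : y ∈ O) (v w : Coord n) :
    HasFDerivAt (fun z => G z v w) (((fderiv ℝ G y).flip v).flip w) y := by
  have h := ((hG.differentiableAt hy).hasFDerivAt.clm_apply (hasFDerivAt_const v y)).clm_apply
    (hasFDerivAt_const w y)
  refine h.congr_fderiv ?_
  ext u
  simp

theorem fderiv_symm (hy : y ∈ O) (u v w : Coord n) :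
    fderiv ℝ G y u v w = fderiv ℝ G y u w v := by
  have h : (fun z => G z v w) =ᶠ[𝓝 y] fun z => G z w v := by
    filter_upwards [hG.isOpen.mem_nhds hy] with z hz using hG.symm z hz v w
  have h1 := (hG.hasFDerivAt_apply hy v w).unique
    ((hG.hasFDerivAt_apply hy w v).congr_of_eventuallyEq h)
  simpa using DFunLike.congr_fun h1 u

theorem christoffel_symm (hy : y ∈ O) (u v : Coord n) :
    christoffel G y u v = christoffel G y v u := by
  rw [christoffel, christoffel]
  congr 1
  ext w
  rw [christoffelLower_apply, christoffelLower_apply, hG.fderiv_symm hy w u v]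
  ring

/-- The Levi-Civita connection is metric. -/
theorem fderiv_eq (hy : y ∈ O) (u v w : Coord n) :
    fderiv ℝ G y u v w = G y (christoffel G y u v) w + G y v (christoffel G y u w) := by
  rw [hG.symm y hy v, hG.apply_christoffel hy, hG.apply_christoffel hy, christoffelLower_apply,
    christoffelLower_apply, hG.fderiv_symm hy u w v, hG.fderiv_symm hy w u v,
    hG.fderiv_symm hy v u w]
  ring

theorem differentiableAt_christoffel (hy : y ∈ O) (v w : Coord n) :
    DifferentiableAt ℝ (fun z => christoffel G z v w) y := by
  have h := (hG.contDiffOn_christoffelMap.contDiffAt (hG.isOpen.mem_nhds hy)).differentiableAt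
    (by simp)
  refine ((h.clm_apply (differentiableAt_const v)).clm_apply
    (differentiableAt_const w)).congr_of_eventuallyEq ?_
  exact Filter.Eventually.of_forall fun z => (christoffelMap_apply G z v w).symm

/-- The derivative of the Christoffel map, evaluated on constant vectors. -/
theorem fderiv_christoffelMap_apply (hy : y ∈ O) (u v w : Coord n) :
    fderiv ℝ (christoffelMap G) y u v w = fderiv ℝ (fun z => christoffel G z v w) y u := by
  have h := ((hG.contDiffOn_christoffelMap.contDiffAt (hG.isOpen.mem_nhds hy)).differentiableAt
    (by simp)).hasFDerivAt
  have h2 := (h.clm_apply (hasFDerivAt_const v y)).clm_apply (hasFDerivAt_const w y)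
  have h3 : (fun z => christoffelMap G z v w) = fun z => christoffel G z v w := by
    ext1 z; exact christoffelMap_apply G z v w
  rw [h3] at h2
  rw [h2.fderiv]
  simp

end IsCoordMetric

end CoordinateMetrics

section ImmersedMetrics

set_option maxSynthPendingDepth 3

variable {n : ℕ} {E : Type*} [NormedAddCommGroup E] [NormedSpace ℝ E]
  {G : Coord n → Coord n →L[ℝ] Coord n →L[ℝ] ℝ} {O : Set (Coord n)} {y : Coord n}
  {B : E →L[ℝ] E →L[ℝ] ℝ} {F : Coord n → E}

theorem ContDiffOn.differentiableAt_fderiv {V : Type*} [NormedAddCommGroup V] [NormedSpace ℝ V]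
    {F : V → E} {O : Set V} {y : V} (hF : ContDiffOn ℝ ∞ F O) (hO : IsOpen O) (hy : y ∈ O) :
    DifferentiableAt ℝ (fderiv ℝ F) y :=
  ((hF.fderiv_of_isOpen hO (m := ∞) le_rfl).contDiffAt (hO.mem_nhds hy)).differentiableAt (by simp)

theorem ContDiffOn.fderiv_fderiv_symm {V : Type*} [NormedAddCommGroup V] [NormedSpace ℝ V]
    {F : V → E} {O : Set V} {y : V} (hF : ContDiffOn ℝ ∞ F O) (hO : IsOpen O) (hy : y ∈ O)
    (u v : V) : fderiv ℝ (fderiv ℝ F) y u v = fderiv ℝ (fderiv ℝ F) y v u :=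
  (hF.contDiffAt (hO.mem_nhds hy)).isSymmSndFDerivAt
    (by rw [minSmoothness_of_isRCLikeNormedField]; exact WithTop.coe_le_coe.2 le_top) u v

/-- The Christoffel symbols of an induced metric. -/
theorem christoffelLower_eq_of_induced (hO : IsOpen O) (hF : ContDiffOn ℝ ∞ F O)
    (hG : IsCoordMetric G O) (hB : ∀ a b, B a b = B b a)
    (h : ∀ y ∈ O, ∀ u v, G y u v = B (fderiv ℝ F y u) (fderiv ℝ F y v)) (hy : y ∈ O)
    (u v w : Coord n) :
    christoffelLower G y u v w = B (fderiv ℝ (fderiv ℝ F) y u v) (fderiv ℝ F y w) := by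
  have hd (v w : Coord n) (u : Coord n) : fderiv ℝ G y u v w
      = B (fderiv ℝ (fderiv ℝ F) y u v) (fderiv ℝ F y w)
        + B (fderiv ℝ F y v) (fderiv ℝ (fderiv ℝ F) y u w) := by
    have h1 := (hF.differentiableAt_fderiv hO hy).hasFDerivAt
    have hv := h1.clm_apply (hasFDerivAt_const v y)
    have hw := h1.clm_apply (hasFDerivAt_const w y)
    have h2 := ((B.hasFDerivAt.comp y hv).clm_apply hw)
    have h3 : (fun z => G z v w) =ᶠ[𝓝 y] fun z => B (fderiv ℝ F z v) (fderiv ℝ F z w) := by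
      filter_upwards [hO.mem_nhds hy] with z hz using h z hz v w
    have h4 := (hG.hasFDerivAt_apply hy v w).unique (h2.congr_of_eventuallyEq h3)
    have h5 := DFunLike.congr_fun h4 u
    simpa [add_comm] using h5
  have hs := hF.fderiv_fderiv_symm hO hy
  rw [christoffelLower_apply, hd, hd, hd, hs v u, hs w u, hs w v, hB (fderiv ℝ F y v)]
  ring

/-- If the second derivative of an immersion is `DF Γ - G q` with `Dq = μ DF`, the metric `G` has
constant curvature `μ`: this is the Gauss equation of an umbilical immersion. -/
theorem curvature_eq_of_umbilical {q : Coord n → E} {μ : ℝ} (hO : IsOpen O)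
    (hF : ContDiffOn ℝ ∞ F O) (hG : IsCoordMetric G O)
    (hinj : ∀ y ∈ O, Function.Injective (fderiv ℝ F y))
    (h2 : ∀ y ∈ O, ∀ u v, fderiv ℝ (fderiv ℝ F) y u v
      = fderiv ℝ F y (christoffel G y u v) - G y u v • q y)
    (hq : ∀ y ∈ O, HasFDerivAt q (μ • fderiv ℝ F y) y) (hy : y ∈ O) (u v w : Coord n) :
    curvature G y u v w = μ • (G y v w • u - G y u w • v) := by
  have hDF : ContDiffOn ℝ ∞ (fderiv ℝ F) O := hF.fderiv_of_isOpen hO le_rfl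
  have h3 (u v w : Coord n) : fderiv ℝ (fderiv ℝ (fderiv ℝ F)) y u v w
      = fderiv ℝ F y (christoffel G y u (christoffel G y v w)
          + fderiv ℝ (fun z => christoffel G z v w) y u - (μ * G y v w) • u)
        - (G y u (christoffel G y v w) + fderiv ℝ G y u v w) • q y := by
    have e1 := (((hDF.differentiableAt_fderiv hO hy).hasFDerivAt.clm_apply
      (hasFDerivAt_const v y)).clm_apply (hasFDerivAt_const w y))
    have e2 := ((hF.differentiableAt_fderiv hO hy).hasFDerivAt.clm_apply
      (hG.differentiableAt_christoffel hy v w).hasFDerivAt).sub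
      ((hG.hasFDerivAt_apply hy v w).smul (hq y hy))
    have e3 : (fun z => fderiv ℝ (fderiv ℝ F) z v w) =ᶠ[𝓝 y]
        fun z => fderiv ℝ F z (christoffel G z v w) - G z v w • q z := by
      filter_upwards [hO.mem_nhds hy] with z hz using h2 z hz v w
    have e4 := DFunLike.congr_fun (e1.unique (e2.congr_of_eventuallyEq e3)) u
    simp only [add_apply, ContinuousLinearMap.comp_apply,
      ContinuousLinearMap.flip_apply, zero_apply, map_zero,
      zero_add, sub_apply, smul_apply,
      ContinuousLinearMap.smulRight_apply] at e4
    rw [e4, h2 y hy u]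
    simp only [map_add, map_sub, map_smul]
    module
  have hs := DFunLike.congr_fun (hDF.fderiv_fderiv_symm hO hy u v) w
  rw [h3, h3] at hs
  have hc : G y u (christoffel G y v w) + fderiv ℝ G y u v w
      = G y v (christoffel G y u w) + fderiv ℝ G y v u w := by
    rw [hG.fderiv_eq hy, hG.fderiv_eq hy, hG.christoffel_symm hy v u]
    ring
  rw [hc, sub_left_inj] at hs
  have h4 := hinj y hy hs
  rw [curvature, ← sub_eq_zero]
  rw [← sub_eq_zero] at h4
  rw [← h4]
  module

end ImmersedMetrics

/-! ### Developing a metric of constant curvature into a quadric -/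

section Development

set_option maxSynthPendingDepth 3

variable {n : ℕ} {E : Type*} [NormedAddCommGroup E] [NormedSpace ℝ E]

/-- The equations `dJ = L`, `dξ = κ L`, `∇L = -εκ G ξ` of a development `J` with unit normal `ξ`,
written as a linear system `dX(u) = A(u) X` for `X = (J, ξ, L)`. -/
noncomputable def developmentSystem [FiniteDimensional ℝ E]
    (G : Coord n → Coord n →L[ℝ] Coord n →L[ℝ] ℝ) (ε κ : ℝ) (y : Coord n) :
    Coord n →L[ℝ] (E × E × (Coord n →L[ℝ] E)) →L[ℝ] (E × E × (Coord n →L[ℝ] E)) :=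
  LinearMap.toContinuousBilinearMap <| LinearMap.mk₂ ℝ
    (fun u X => (X.2.2 u, κ • X.2.2 u,
      X.2.2 ∘L christoffelMap G y u - (ε * κ) • (G y u).smulRight X.2.1))
    (fun u u' X => by
      ext <;> simp [add_smul]; abel)
    (fun c u X => by
      ext <;> simp <;> module)
    (fun u X X' => by
      ext <;> simp; abel)
    (fun c u X => by
      ext <;> simp <;> module)

/-- The system of linear equations satisfied by the defects `S₁ = B(L, L) - G`, `S₂ = B(ξ, L)`,
`S₃ = B(ξ, ξ) - ε` of a solution of `developmentSystem`. -/
noncomputable def defectSystem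
    (G : Coord n → Coord n →L[ℝ] Coord n →L[ℝ] ℝ) (ε κ : ℝ) (y : Coord n) :
    Coord n →L[ℝ] ((Coord n →L[ℝ] Coord n →L[ℝ] ℝ) × (Coord n →L[ℝ] ℝ) × ℝ) →L[ℝ]
      ((Coord n →L[ℝ] Coord n →L[ℝ] ℝ) × (Coord n →L[ℝ] ℝ) × ℝ) :=
  LinearMap.toContinuousBilinearMap <| LinearMap.mk₂ ℝ
    (fun u S => (S.1 ∘L christoffelMap G y u + (S.1.flip ∘L christoffelMap G y u).flip
        - (ε * κ) • ((G y u).smulRight S.2.1 + S.2.1.smulRight (G y u)),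
      κ • S.1 u + S.2.1 ∘L christoffelMap G y u - (ε * κ * S.2.2) • G y u,
      2 * κ * S.2.1 u))
    (fun u u' X => by
      ext <;> simp <;> ring)
    (fun c u X => by
      ext <;> simp <;> ring)
    (fun u X X' => by
      ext <;> simp <;> ring)
    (fun c u X => by
      ext <;> simp <;> ring)

theorem developmentSystem_apply [FiniteDimensional ℝ E]
    (G : Coord n → Coord n →L[ℝ] Coord n →L[ℝ] ℝ) (ε κ : ℝ) (y u : Coord n)
    (X : E × E × (Coord n →L[ℝ] E)) :
    developmentSystem G ε κ y u X = (X.2.2 u, κ • X.2.2 u,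
      X.2.2 ∘L christoffelMap G y u - (ε * κ) • (G y u).smulRight X.2.1) := rfl

theorem defectSystem_apply (G : Coord n → Coord n →L[ℝ] Coord n →L[ℝ] ℝ) (ε κ : ℝ) (y u : Coord n)
    (S : (Coord n →L[ℝ] Coord n →L[ℝ] ℝ) × (Coord n →L[ℝ] ℝ) × ℝ) :
    defectSystem G ε κ y u S =
      (S.1 ∘L christoffelMap G y u + (S.1.flip ∘L christoffelMap G y u).flip
        - (ε * κ) • ((G y u).smulRight S.2.1 + S.2.1.smulRight (G y u)),
      κ • S.1 u + S.2.1 ∘L christoffelMap G y u - (ε * κ * S.2.2) • G y u,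
      2 * κ * S.2.1 u) := rfl

variable {G : Coord n → Coord n →L[ℝ] Coord n →L[ℝ] ℝ} {O : Set (Coord n)} {ε κ : ℝ}

theorem contDiffOn_developmentSystem [FiniteDimensional ℝ E] (hG : IsCoordMetric G O) :
    ContDiffOn ℝ ∞ (developmentSystem (E := E) G ε κ) O := by
  rw [contDiffOn_clm_apply]
  intro u
  rw [contDiffOn_clm_apply]
  intro X
  simp only [developmentSystem_apply]
  refine contDiffOn_const.prodMk (contDiffOn_const.prodMk ?_)
  rw [contDiffOn_clm_apply]
  intro v
  have h1 : ContDiffOn ℝ ∞ (fun y => christoffelMap G y u v) O :=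
    (hG.contDiffOn_christoffelMap.clm_apply contDiffOn_const).clm_apply contDiffOn_const
  have h2 : ContDiffOn ℝ ∞ (fun y => G y u v) O :=
    (hG.smooth.clm_apply contDiffOn_const).clm_apply contDiffOn_const
  simpa using (X.2.2.contDiff.comp_contDiffOn h1).sub
    ((h2.smul contDiffOn_const).const_smul (ε * κ))

theorem continuousOn_defectSystem (hG : IsCoordMetric G O) :
    ContinuousOn (defectSystem G ε κ) O := by
  suffices h : ContDiffOn ℝ ∞ (defectSystem G ε κ) O from h.continuousOn
  have hΓ (u v : Coord n) : ContDiffOn ℝ ∞ (fun y => christoffelMap G y u v) O :=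
    (hG.contDiffOn_christoffelMap.clm_apply contDiffOn_const).clm_apply contDiffOn_const
  have hg (u v : Coord n) : ContDiffOn ℝ ∞ (fun y => G y u v) O :=
    (hG.smooth.clm_apply contDiffOn_const).clm_apply contDiffOn_const
  rw [contDiffOn_clm_apply]
  intro u
  rw [contDiffOn_clm_apply]
  intro S
  simp only [defectSystem_apply]
  refine ContDiffOn.prodMk ?_ (ContDiffOn.prodMk ?_ contDiffOn_const)
  · rw [contDiffOn_clm_apply]
    intro v
    rw [contDiffOn_clm_apply]
    intro w
    simpa [mul_add] using ((((S.1.flip w).contDiff.comp_contDiffOn (hΓ u v)).add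
      ((S.1 v).contDiff.comp_contDiffOn (hΓ u w))).sub
      ((contDiffOn_const (c := ε * κ)).mul (((hg u v).mul (contDiffOn_const (c := S.2.1 w))).add
        ((contDiffOn_const (c := S.2.1 v)).mul (hg u w)))))
  · rw [contDiffOn_clm_apply]
    intro v
    simpa using ((contDiffOn_const.add (S.2.1.contDiff.comp_contDiffOn (hΓ u v))).sub
      (contDiffOn_const.mul (hg u v)))

theorem fderiv_developmentSystem_apply [FiniteDimensional ℝ E] (hG : IsCoordMetric G O)
    {y : Coord n} (hy : y ∈ O) (u v : Coord n) (X : E × E × (Coord n →L[ℝ] E)) :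
    fderiv ℝ (developmentSystem (E := E) G ε κ) y u v X
      = (0, 0, X.2.2 ∘L (fderiv ℝ (christoffelMap G) y u v)
          - (ε * κ) • (fderiv ℝ G y u v).smulRight X.2.1) := by
  have h1 := ((contDiffOn_developmentSystem (E := E) (ε := ε) (κ := κ) hG).contDiffAt
    (hG.isOpen.mem_nhds hy)).differentiableAt (by simp)
  have hX := (h1.hasFDerivAt.clm_apply (hasFDerivAt_const v y)).clm_apply (hasFDerivAt_const X y)
  have e1 : HasFDerivAt (fun z => (developmentSystem (E := E) G ε κ z v X).1) (0 : Coord n →L[ℝ] E) y := by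
    exact hasFDerivAt_const (X.2.2 v) y
  have e2 : HasFDerivAt (fun z => (developmentSystem (E := E) G ε κ z v X).2.1) (0 : Coord n →L[ℝ] E) y := by
    exact hasFDerivAt_const (κ • X.2.2 v) y
  refine Prod.ext ?_ (Prod.ext ?_ ?_)
  · simpa using DFunLike.congr_fun (hX.fst.unique e1) u
  · simpa using DFunLike.congr_fun (hX.snd.fst.unique e2) u
  · ext w
    have hw := hX.snd.snd.clm_apply (hasFDerivAt_const w y)
    have hΓ := ((((hG.contDiffOn_christoffelMap.contDiffAt (hG.isOpen.mem_nhds hy)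
      ).differentiableAt (by simp)).hasFDerivAt.clm_apply (hasFDerivAt_const v y)).clm_apply
        (hasFDerivAt_const w y))
    have e3 : HasFDerivAt (fun z => (developmentSystem (E := E) G ε κ z v X).2.2 w) _ y :=
      (X.2.2.hasFDerivAt.comp y hΓ).sub
        (((hG.hasFDerivAt_apply hy v w).smul (hasFDerivAt_const X.2.1 y)).const_smul (ε * κ))
    simpa using DFunLike.congr_fun (hw.unique e3) u

/-- The development system is flat because the metric has constant curvature `εκ²`. -/
theorem developmentSystem_flat [FiniteDimensional ℝ E] (hG : IsCoordMetric G O) {y : Coord n}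
    (hy : y ∈ O)
    (hc : ∀ u v w, curvature G y u v w = (ε * κ ^ 2) • (G y v w • u - G y u w • v))
    (u v : Coord n) :
    fderiv ℝ (developmentSystem (E := E) G ε κ) y u v
        + developmentSystem G ε κ y v ∘L developmentSystem G ε κ y u
      = fderiv ℝ (developmentSystem G ε κ) y v u
        + developmentSystem G ε κ y u ∘L developmentSystem G ε κ y v := by
  have hcc (w : Coord n) : fderiv ℝ (christoffelMap G) y u v w
        + christoffel G y u (christoffel G y v w)
      = fderiv ℝ (christoffelMap G) y v u w + christoffel G y v (christoffel G y u w)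
        + (ε * κ ^ 2) • (G y v w • u - G y u w • v) := by
    rw [← hc, curvature, hG.fderiv_christoffelMap_apply hy, hG.fderiv_christoffelMap_apply hy]
    abel
  refine ContinuousLinearMap.ext fun X => ?_
  rw [add_apply, add_apply, fderiv_developmentSystem_apply hG hy,
    fderiv_developmentSystem_apply hG hy, ContinuousLinearMap.comp_apply, ContinuousLinearMap.comp_apply]
  simp only [developmentSystem_apply]
  refine Prod.ext ?_ (Prod.ext ?_ ?_)
  · simp [christoffelMap_apply, hG.christoffel_symm hy v u, hG.symm y hy v u]
  · simp [christoffelMap_apply, hG.christoffel_symm hy v u, hG.symm y hy v u]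
  · ext1 w
    have h1 := congrArg X.2.2 (hcc w)
    simp only [map_add, map_smul, map_sub] at h1
    have h2 : G y u (christoffel G y v w) + fderiv ℝ G y u v w
        = G y v (christoffel G y u w) + fderiv ℝ G y v u w := by
      rw [hG.fderiv_eq hy, hG.fderiv_eq hy, hG.christoffel_symm hy v u]
      ring
    have h3 := congrArg (fun t : ℝ => (ε * κ * t) • X.2.1) h2
    simp only [Prod.snd_add, add_apply, sub_apply, smul_apply,
      ContinuousLinearMap.comp_apply, ContinuousLinearMap.smulRight_apply, christoffelMap_apply]
    rw [← sub_eq_zero] at h1 h3 ⊢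
    linear_combination (norm := module) h1 - h3

end Development

section DevelopmentExistence

set_option maxSynthPendingDepth 3

variable {n : ℕ} {E : Type*} [NormedAddCommGroup E] [NormedSpace ℝ E]
  {G : Coord n → Coord n →L[ℝ] Coord n →L[ℝ] ℝ} {O : Set (Coord n)} {ε κ : ℝ}
  {B : E →L[ℝ] E →L[ℝ] ℝ} {s : Set (Coord n)}

/-- The defects `(B(L, L) - G, B(ξ, L), B(ξ, ξ) - ε)` measuring how far a solution `(ξ, L)` of the
development equations is from being an isometry with unit normal `ξ`. -/
noncomputable def developmentDefect (G : Coord n → Coord n →L[ℝ] Coord n →L[ℝ] ℝ)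
    (B : E →L[ℝ] E →L[ℝ] ℝ) (ε : ℝ) (ξ : Coord n → E) (L : Coord n → Coord n →L[ℝ] E)
    (y : Coord n) : (Coord n →L[ℝ] Coord n →L[ℝ] ℝ) × (Coord n →L[ℝ] ℝ) × ℝ :=
  (B.bilinearComp (L y) (L y) - G y, B (ξ y) ∘L L y, B (ξ y) (ξ y) - ε)

/-- The defects of a solution of the development equations solve the linear system `defectSystem`. -/
theorem hasFDerivAt_developmentDefect (hG : IsCoordMetric G O) (hε : ε * ε = 1)
    (hB : ∀ a b, B a b = B b a) {ξ : Coord n → E} {L : Coord n → Coord n →L[ℝ] E} (hs : IsOpen s)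
    (hsO : s ⊆ O) (hξs : ContDiffOn ℝ ∞ ξ s) (hLs : ContDiffOn ℝ ∞ L s)
    {y : Coord n} (hy : y ∈ s) (hξ : HasFDerivAt ξ (κ • L y) y)
    (hL : ∀ v, HasFDerivAt (fun z => L z v)
      (L y ∘L (christoffelMap G y).flip v - (ε * κ) • ((G y).flip v).smulRight (ξ y)) y) :
    HasFDerivAt (developmentDefect G B ε ξ L)
      ((defectSystem G ε κ y).flip (developmentDefect G B ε ξ L y)) y := by
  have hsmooth : ContDiffOn ℝ ∞ (developmentDefect G B ε ξ L) s := by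
    refine ContDiffOn.prodMk (ContDiffOn.sub ?_ (hG.smooth.mono hsO)) (ContDiffOn.prodMk ?_ ?_)
    · rw [contDiffOn_clm_apply]
      intro v
      rw [contDiffOn_clm_apply]
      intro w
      exact (B.contDiff.comp_contDiffOn (hLs.clm_apply contDiffOn_const)).clm_apply
        (hLs.clm_apply contDiffOn_const)
    · exact (B.contDiff.comp_contDiffOn hξs).clm_comp hLs
    · exact ((B.contDiff.comp_contDiffOn hξs).clm_apply hξs).sub contDiffOn_const
  have hD := ((hsmooth.contDiffAt (hs.mem_nhds hy)).differentiableAt (by simp)).hasFDerivAt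
  refine hD.congr_fderiv (ContinuousLinearMap.ext fun u => ?_)
  rw [ContinuousLinearMap.flip_apply, defectSystem_apply]
  refine Prod.ext ?_ (Prod.ext ?_ ?_)
  · refine ContinuousLinearMap.ext fun v => ContinuousLinearMap.ext fun w => ?_
    have h1 := (hD.fst.clm_apply (hasFDerivAt_const v y)).clm_apply (hasFDerivAt_const w y)
    have h2 := ((B.hasFDerivAt.comp y (hL v)).clm_apply (hL w)).sub
      (hG.hasFDerivAt_apply (hsO hy) v w)
    have h3 := DFunLike.congr_fun (h1.unique h2) u
    have h4 : fderiv ℝ G y u v w = _ := hG.fderiv_eq (hsO hy) u v w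
    simp [developmentDefect, christoffelMap_apply] at h3 ⊢
    rw [h3, h4, hB (L y v) (ξ y)]
    ring
  · refine ContinuousLinearMap.ext fun v => ?_
    have h1 := hD.snd.fst.clm_apply (hasFDerivAt_const v y)
    have h2 := (B.hasFDerivAt.comp y hξ).clm_apply (hL v)
    have h3 := DFunLike.congr_fun (h1.unique h2) u
    simp [developmentDefect, christoffelMap_apply] at h3 ⊢
    rw [h3]
    linear_combination (-(κ * G y u v)) * hε
  · have h1 := hD.snd.snd
    have h2 := ((B.hasFDerivAt.comp y hξ).clm_apply hξ).sub (hasFDerivAt_const ε y)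
    have h3 := DFunLike.congr_fun (h1.unique h2) u
    simp [developmentDefect] at h3 ⊢
    rw [h3, hB (L y u) (ξ y)]
    ring

/-- Defects which vanish at the base point vanish: isometric initial values give isometric
solutions. -/
theorem developmentDefect_eq_zero (hG : IsCoordMetric G O) (hε : ε * ε = 1)
    (hB : ∀ a b, B a b = B b a) {ξ : Coord n → E} {L : Coord n → Coord n →L[ℝ] E} {y₀ : Coord n}
    {r C : ℝ} (hsO : Metric.ball y₀ r ⊆ O)
    (hC : ∀ y ∈ Metric.ball y₀ r, ‖defectSystem G ε κ y‖ ≤ C)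
    (hξs : ContDiffOn ℝ ∞ ξ (Metric.ball y₀ r)) (hLs : ContDiffOn ℝ ∞ L (Metric.ball y₀ r))
    (hξ : ∀ y ∈ Metric.ball y₀ r, HasFDerivAt ξ (κ • L y) y)
    (hL : ∀ y ∈ Metric.ball y₀ r, ∀ v, HasFDerivAt (fun z => L z v)
      (L y ∘L (christoffelMap G y).flip v - (ε * κ) • ((G y).flip v).smulRight (ξ y)) y)
    (h₁ : ∀ u v, B (L y₀ u) (L y₀ v) = G y₀ u v) (h₂ : ∀ u, B (ξ y₀) (L y₀ u) = 0)
    (h₃ : B (ξ y₀) (ξ y₀) = ε) :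
    ∀ y ∈ Metric.ball y₀ r, developmentDefect G B ε ξ L y = 0 := by
  refine eq_zero_of_norm_fderiv_le (C := C)
    (fun y hy => hasFDerivAt_developmentDefect hG hε hB Metric.isOpen_ball hsO hξs
      hLs hy (hξ y hy) (hL y hy)) (fun y hy => ?_) ?_
  · refine ContinuousLinearMap.opNorm_le_bound _
      (mul_nonneg (le_trans (norm_nonneg (defectSystem G ε κ y)) (hC y hy)) (norm_nonneg _)) fun u => ?_
    rw [ContinuousLinearMap.flip_apply]
    refine (ContinuousLinearMap.le_opNorm₂ _ _ _).trans ?_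
    have := hC y hy
    rw [mul_right_comm]
    gcongr
  · refine Prod.ext ?_ (Prod.ext ?_ ?_)
    · ext u v
      simp [developmentDefect, h₁]
    · ext u
      simp [developmentDefect, h₂]
    · simp [developmentDefect, h₃]

/-- A solution `J` of the development equations stays in a quadric. -/
theorem quadric_of_development (hB : ∀ a b, B a b = B b a) {J ξ : Coord n → E}
    {L : Coord n → Coord n →L[ℝ] E} {y₀ : Coord n} {r : ℝ} {ξ₀ : E}
    (hJ : ∀ y ∈ Metric.ball y₀ r, HasFDerivAt J (L y) y)
    (hξ : ∀ y ∈ Metric.ball y₀ r, HasFDerivAt ξ (κ • L y) y) (hJ0 : J y₀ = 0) (hξ0 : ξ y₀ = ξ₀)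
    (h : ∀ y ∈ Metric.ball y₀ r, ∀ u, B (ξ y) (L y u) = 0) :
    ∀ y ∈ Metric.ball y₀ r, 2 * B ξ₀ (J y) + κ * B (J y) (J y) = 0 := by
  -- `ξ - κ J` is constant
  have hξJ : ∀ y ∈ Metric.ball y₀ r, ξ y - ξ₀ - κ • J y = 0 :=
    eq_zero_of_norm_fderiv_le (C := 0) (fun y hy =>
      ((hξ y hy).sub_const ξ₀).sub ((hJ y hy).const_smul κ)) (fun y hy => by simp)
      (by simp [hJ0, hξ0])
  refine eq_zero_of_norm_fderiv_le (C := 0) (fun y hy =>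
    (((B ξ₀).hasFDerivAt.comp y (hJ y hy)).const_mul 2).add
      (((B.hasFDerivAt.comp y (hJ y hy)).clm_apply (hJ y hy)).const_mul κ)) (fun y hy => ?_)
    (by simp [hJ0])
  rw [zero_mul, norm_le_zero_iff]
  refine ContinuousLinearMap.ext fun u => ?_
  have h4 := h y hy u
  have h5 : ξ y = ξ₀ + κ • J y := by
    have := hξJ y hy
    rw [sub_sub, sub_eq_zero] at this
    exact this
  simp [h5] at h4 ⊢
  rw [hB (L y u)]
  linear_combination 2 * h4

/-- A metric of constant curvature `εκ²` is locally isometric to the quadric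
`2 B(ξ₀, Y) + κ B(Y, Y) = 0`, for any linear isometry at the base point. -/
theorem exists_coordinate_development [FiniteDimensional ℝ E] (hG : IsCoordMetric G O)
    (hε : ε * ε = 1)
    (hc : ∀ y ∈ O, ∀ u v w,
      curvature G y u v w = (ε * κ ^ 2) • (G y v w • u - G y u w • v))
    {y₀ : Coord n} (hy₀ : y₀ ∈ O) (hB : ∀ a b, B a b = B b a) (ξ₀ : E) (L₀ : Coord n →L[ℝ] E)
    (h₁ : ∀ u v, B (L₀ u) (L₀ v) = G y₀ u v) (h₂ : ∀ u, B ξ₀ (L₀ u) = 0) (h₃ : B ξ₀ ξ₀ = ε) :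
    ∃ (r : ℝ) (J : Coord n → E), 0 < r ∧ Metric.ball y₀ r ⊆ O ∧
      ContDiffOn ℝ ∞ J (Metric.ball y₀ r) ∧
      (∀ y ∈ Metric.ball y₀ r, ∀ u v, B (fderiv ℝ J y u) (fderiv ℝ J y v) = G y u v) ∧
      ∀ y ∈ Metric.ball y₀ r, 2 * B ξ₀ (J y) + κ * B (J y) (J y) = 0 := by
  have hO := hG.isOpen.mem_nhds hy₀
  obtain ⟨r₁, X, hr₁, hX0, hX⟩ := exists_solution_of_flat
    (((contDiffOn_developmentSystem (E := E) (ε := ε) (κ := κ) hG).contDiffAt hO).of_le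
      (WithTop.coe_le_coe.2 le_top))
    (by filter_upwards [hO] with y hy using developmentSystem_flat hG hy (hc y hy))
    ((0, ξ₀, L₀) : E × E × (Coord n →L[ℝ] E))
  -- on a small ball the coefficients of the defect system are bounded
  have hbd : ∀ᶠ y in 𝓝 y₀, ‖defectSystem G ε κ y‖ < ‖defectSystem G ε κ y₀‖ + 1 :=
    (ContinuousAt.norm (f := defectSystem G ε κ)
      ((continuousOn_defectSystem hG).continuousAt hO)).eventually_lt_const (by linarith)
  obtain ⟨r₂, hr₂, hball⟩ := Metric.eventually_nhds_iff_ball.1 (hbd.and hO)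
  set r := min r₁ r₂ with hr
  have hr0 : 0 < r := lt_min hr₁ hr₂
  have hs1 : Metric.ball y₀ r ⊆ Metric.ball y₀ r₁ := Metric.ball_subset_ball (min_le_left _ _)
  have hs2 : Metric.ball y₀ r ⊆ Metric.ball y₀ r₂ := Metric.ball_subset_ball (min_le_right _ _)
  have hsO : Metric.ball y₀ r ⊆ O := fun y hy => (hball y (hs2 hy)).2
  have hXs : ContDiffOn ℝ ∞ X (Metric.ball y₀ r) :=
    contDiffOn_of_hasFDerivAt_linear Metric.isOpen_ball
      ((contDiffOn_developmentSystem (E := E) (ε := ε) (κ := κ) hG).mono hsO)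
      fun y hy => hX y (hs1 hy)
  have hmem0 : y₀ ∈ Metric.ball y₀ r := Metric.mem_ball_self hr0
  have hJ : ∀ y ∈ Metric.ball y₀ r, HasFDerivAt (fun z => (X z).1) (X y).2.2 y := fun y hy => by
    refine (hX y (hs1 hy)).fst.congr_fderiv (ContinuousLinearMap.ext fun u => ?_)
    simp [developmentSystem_apply]
  have hξ : ∀ y ∈ Metric.ball y₀ r, HasFDerivAt (fun z => (X z).2.1) (κ • (X y).2.2) y :=
    fun y hy => by
      refine (hX y (hs1 hy)).snd.fst.congr_fderiv (ContinuousLinearMap.ext fun u => ?_)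
      simp [developmentSystem_apply]
  have hL : ∀ y ∈ Metric.ball y₀ r, ∀ v, HasFDerivAt (fun z => (X z).2.2 v)
      ((X y).2.2 ∘L (christoffelMap G y).flip v
        - (ε * κ) • ((G y).flip v).smulRight (X y).2.1) y := fun y hy v => by
    refine ((hX y (hs1 hy)).snd.snd.clm_apply (hasFDerivAt_const v y)).congr_fderiv
      (ContinuousLinearMap.ext fun u => ?_)
    simp [developmentSystem_apply]
  have hdef := developmentDefect_eq_zero (C := ‖defectSystem G ε κ y₀‖ + 1) hG hε hB hsO
    (fun y hy => (hball y (hs2 hy)).1.le) hXs.snd.fst hXs.snd.snd hξ hL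
    (by simpa [hX0] using h₁) (by simpa [hX0] using h₂) (by simpa [hX0] using h₃)
  refine ⟨r, fun z => (X z).1, hr0, hsO, hXs.fst, fun y hy u v => ?_, ?_⟩
  · rw [(hJ y hy).fderiv]
    exact sub_eq_zero.1 (congrArg (fun S => S.1 u v) (hdef y hy))
  · exact quadric_of_development hB hJ hξ (congrArg (fun S => S.1) hX0)
      (congrArg (fun S => S.2.1) hX0) fun y hy u => congrArg (fun S => S.2.1 u) (hdef y hy)

end DevelopmentExistence

/-! ### Inverse functions and charts -/

section InverseFunction

variable {E E' : Type*} [NormedAddCommGroup E] [NormedSpace ℝ E] [FiniteDimensional ℝ E]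
  [NormedAddCommGroup E'] [NormedSpace ℝ E'] [FiniteDimensional ℝ E']

theorem exists_continuousLinearEquiv_of_injective {f : E →L[ℝ] E'} (hf : Function.Injective f)
    (hfr : Module.finrank ℝ E = Module.finrank ℝ E') :
    ∃ f' : E ≃L[ℝ] E', (f' : E →L[ℝ] E') = f :=
  ⟨(LinearMap.linearEquivOfInjective (f : E →ₗ[ℝ] E') hf hfr).toContinuousLinearEquiv,
    by ext; rfl⟩

/-- The inverse function theorem, with a smooth inverse on a whole neighbourhood. -/
theorem exists_openPartialHomeomorph_of_fderiv_injective {f : E → E'} {O : Set E} (hO : IsOpen O)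
    (hf : ContDiffOn ℝ ∞ f O) {x : E} (hx : x ∈ O) (hinj : Function.Injective (fderiv ℝ f x))
    (hfr : Module.finrank ℝ E = Module.finrank ℝ E') :
    ∃ P : OpenPartialHomeomorph E E', x ∈ P.source ∧ P.source ⊆ O ∧ (∀ y, P y = f y) ∧
      ContDiffOn ℝ ∞ P.symm P.target := by
  have hat : ∀ y ∈ O, ContDiffAt ℝ ∞ f y := fun y hy => hf.contDiffAt (hO.mem_nhds hy)
  obtain ⟨f', hf'⟩ := exists_continuousLinearEquiv_of_injective hinj hfr
  have hd : HasFDerivAt f (f' : E →L[ℝ] E') x := by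
    rw [hf']
    exact ((hat x hx).differentiableAt (by simp)).hasFDerivAt
  set Q := (hat x hx).toOpenPartialHomeomorph f hd (by simp) with hQ
  -- nearby derivatives are invertible as well
  have hopen : IsOpen (O ∩ fderiv ℝ f ⁻¹' (range ((↑) : (E ≃L[ℝ] E') → E →L[ℝ] E'))) :=
    (hf.fderiv_of_isOpen hO (m := ∞) le_rfl).continuousOn.isOpen_inter_preimage hO
      ContinuousLinearEquiv.isOpen
  refine ⟨Q.restrOpen _ hopen, ⟨(hat x hx).mem_toOpenPartialHomeomorph_source hd (by simp), hx,
    f', hf'⟩, fun y hy => hy.2.1, fun y => rfl, fun z hz => ContDiffAt.contDiffWithinAt ?_⟩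
  obtain ⟨hz1, hz2, e, he⟩ : (Q.restrOpen _ hopen).symm z ∈ (Q.restrOpen _ hopen).source :=
    (Q.restrOpen _ hopen).map_target hz
  refine (Q.restrOpen _ hopen).contDiffAt_symm (f₀' := e) hz ?_ (hat _ hz2)
  rw [he]
  exact ((hat _ hz2).differentiableAt (by simp)).hasFDerivAt

variable {H H' : Type*} [TopologicalSpace H] [TopologicalSpace H'] {I : ModelWithCorners ℝ E H}
  {I' : ModelWithCorners ℝ E' H'} [I.Boundaryless] [I'.Boundaryless]
  {X Y : Type*} [TopologicalSpace X] [ChartedSpace H X] [IsManifold I ∞ X]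
  [TopologicalSpace Y] [ChartedSpace H' Y] [IsManifold I' ∞ Y]

omit [FiniteDimensional ℝ E] in
variable (I) in
/-- A chart of a boundaryless manifold with values in the model vector space. -/
theorem exists_vector_chart (x : X) :
    ∃ e : OpenPartialHomeomorph X E, x ∈ e.source ∧ ContMDiffOn I 𝓘(ℝ, E) ∞ e e.source ∧
      ContMDiffOn 𝓘(ℝ, E) I ∞ e.symm e.target := by
  refine ⟨(chartAt H x).trans I.toHomeomorph.toOpenPartialHomeomorph, ?_, ?_, ?_⟩
  · simp
  · exact (contMDiffOn_extChartAt (I := I) (n := ∞) (x := x)).mono fun y hy => hy.1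
  · refine (contMDiffOn_extChartAt_symm (I := I) (n := ∞) x).mono fun y hy => ?_
    rw [extChartAt_target]
    exact ⟨hy.2, by simp [I.range_eq_univ]⟩

/-- The inverse function theorem between boundaryless manifolds of the same dimension. -/
theorem exists_openPartialHomeomorph_of_mfderiv_injective {f : X → Y} {O : Set X} (hO : IsOpen O)
    (hf : ContMDiffOn I I' ∞ f O) {x : X} (hx : x ∈ O)
    (hinj : Function.Injective (mfderiv I I' f x))
    (hfr : Module.finrank ℝ E = Module.finrank ℝ E') :
    ∃ P : OpenPartialHomeomorph X Y, x ∈ P.source ∧ P.source ⊆ O ∧ EqOn P f P.source ∧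
      ContMDiffOn I' I ∞ P.symm P.target := by
  obtain ⟨e, hxe, he, hes⟩ := exists_vector_chart I x
  obtain ⟨e', hxe', he', hes'⟩ := exists_vector_chart I' (f x)
  have hO' : IsOpen (O ∩ f ⁻¹' e'.source) := hf.continuousOn.isOpen_inter_preimage hO e'.open_source
  have hO'' : IsOpen (e.target ∩ e.symm ⁻¹' (O ∩ f ⁻¹' e'.source)) :=
    e.symm.isOpen_inter_preimage hO'
  have hsm : ContDiffOn ℝ ∞ (e' ∘ f ∘ e.symm) (e.target ∩ e.symm ⁻¹' (O ∩ f ⁻¹' e'.source)) := by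
    rw [← contMDiffOn_iff_contDiffOn]
    exact he'.comp (hf.comp (hes.mono inter_subset_left) fun y hy => hy.2.1) fun y hy => hy.2.2
  have hmem : e x ∈ e.target ∩ e.symm ⁻¹' (O ∩ f ⁻¹' e'.source) :=
    ⟨e.map_source hxe, by simpa [e.left_inv hxe] using ⟨hx, hxe'⟩⟩
  have hem : e.MDifferentiable I 𝓘(ℝ, E) :=
    ⟨he.mdifferentiableOn (by simp), hes.mdifferentiableOn (by simp)⟩
  have hem' : e'.MDifferentiable I' 𝓘(ℝ, E') :=
    ⟨he'.mdifferentiableOn (by simp), hes'.mdifferentiableOn (by simp)⟩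
  have hfd : MDifferentiableAt I I' f x :=
    (hf.contMDiffAt (hO.mem_nhds hx)).mdifferentiableAt (by simp)
  have hder : Function.Injective (fderiv ℝ (e' ∘ f ∘ e.symm) (e x)) := by
    have h1 : HasMFDerivAt 𝓘(ℝ, E) I e.symm (e x) (mfderiv 𝓘(ℝ, E) I e.symm (e x)) :=
      (hem.mdifferentiableAt_symm (e.map_source hxe)).hasMFDerivAt
    have h2 : HasMFDerivAt I I' f (e.symm (e x)) (mfderiv I I' f (e.symm (e x))) := by
      rw [e.left_inv hxe]
      exact hfd.hasMFDerivAt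
    have h3 : HasMFDerivAt I' 𝓘(ℝ, E') e' (f (e.symm (e x)))
        (mfderiv I' 𝓘(ℝ, E') e' (f (e.symm (e x)))) := by
      rw [e.left_inv hxe]
      exact (hem'.mdifferentiableAt hxe').hasMFDerivAt
    have h4 := (h3.comp (e x) (h2.comp (e x) h1)).mfderiv
    rw [mfderiv_eq_fderiv] at h4
    rw [h4]
    refine Function.Injective.comp (g := mfderiv I' 𝓘(ℝ, E') e' (f (e.symm (e x)))) ?_
      (Function.Injective.comp (g := mfderiv I I' f (e.symm (e x))) ?_
        (hem.symm.mfderiv_injective (e.map_source hxe)))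
    · rw [e.left_inv hxe]
      exact hem'.mfderiv_injective hxe'
    · rw [e.left_inv hxe]
      exact hinj
  obtain ⟨Q, hQ1, hQ2, hQ3, hQ4⟩ :=
    exists_openPartialHomeomorph_of_fderiv_injective hO'' hsm hmem hder hfr
  refine ⟨(e.trans Q).trans e'.symm, ?_, ?_, ?_, ?_⟩
  · refine ⟨⟨hxe, hQ1⟩, ?_⟩
    simpa [hQ3, e.left_inv hxe] using e'.map_source hxe'
  · rintro y ⟨⟨hy1, hy2⟩, -⟩
    simpa [e.left_inv hy1] using (hQ2 hy2).2.1
  · rintro y ⟨⟨hy1, hy2⟩, -⟩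
    replace hy1 : y ∈ e.source := hy1
    have h1 : f (e.symm (e y)) ∈ e'.source := (hQ2 hy2).2.2
    rw [e.left_inv hy1] at h1
    simp [hQ3, e.left_inv hy1, e'.left_inv h1]
  · have hsub : ((e.trans Q).trans e'.symm).target
        ⊆ e'.source ∩ e' ⁻¹' (Q.target ∩ Q.symm ⁻¹' e.target) := by
      rintro y ⟨hy1, hy2⟩
      exact ⟨hy1, hy2.1, hy2.2⟩
    exact hes.comp ((contMDiffOn_iff_contDiffOn.2 hQ4).comp (he'.mono fun y hy => (hsub hy).1)
      fun y hy => (hsub hy).2.1) fun y hy => (hsub hy).2.2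

end InverseFunction

/-! ### Charts and induced metrics -/

section Charts

variable {n : ℕ} {M : Type*} [TopologicalSpace M] [ChartedSpace (Coord n) M] [IsManifold (𝓡 n) ∞ M]
  {E : Type*} [NormedAddCommGroup E] [NormedSpace ℝ E]
  {e : OpenPartialHomeomorph M (Coord n)}

omit [IsManifold (𝓡 n) ∞ M] in
theorem mdifferentiable_of_mem_maximalAtlas (he : e ∈ IsManifold.maximalAtlas (𝓡 n) ∞ M) :
    e.MDifferentiable (𝓡 n) (𝓡 n) :=
  ⟨(contMDiffOn_of_mem_maximalAtlas he).mdifferentiableOn (by simp),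
    (contMDiffOn_symm_of_mem_maximalAtlas he).mdifferentiableOn (by simp)⟩

omit [IsManifold (𝓡 n) ∞ M] in
theorem mfderiv_symm_mfderiv (he : e ∈ IsManifold.maximalAtlas (𝓡 n) ∞ M) {q : M}
    (hq : q ∈ e.source) (u : TangentSpace (𝓡 n) q) :
    mfderiv (𝓡 n) (𝓡 n) e.symm (e q) (mfderiv (𝓡 n) (𝓡 n) e q u : Coord n) = u :=
  DFunLike.congr_fun ((mdifferentiable_of_mem_maximalAtlas he).symm_comp_deriv hq) u

theorem HasSignature.nondegenerate {V : Type*} [AddCommGroup V] [Module ℝ V] {kind : GeometryKind}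
    {b : V → V → ℝ} (h : HasSignature kind b) (hsymm : ∀ u v, b u v = b v u) {u : V}
    (hu : ∀ v, b u v = 0) : u = 0 := by
  by_contra hne
  cases kind with
  | space => exact (h u hne).ne' (hu u)
  | spacetime =>
    obtain ⟨e, -, he⟩ := h
    exact (he u (by rw [hsymm, hu]) hne).ne' (hu u)

omit [IsManifold (𝓡 n) ∞ M] in
theorem IsMetric.isCoordMetric {kind : GeometryKind} {g : BilinField n M} (h : IsMetric kind g)
    (he : e ∈ IsManifold.maximalAtlas (𝓡 n) ∞ M) : IsCoordMetric (chartMetric g e) e.target where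
  isOpen := e.open_target
  smooth := h.smooth e he
  symm y _ u v := h.symm _ _ _
  nondegenerate y hy u hu := by
    have hs := (mdifferentiable_of_mem_maximalAtlas he).symm.mfderiv_surjective hy
    have hi := (mdifferentiable_of_mem_maximalAtlas he).symm.mfderiv_injective hy
    refine (map_eq_zero_iff _ hi).1 ((h.signature (e.symm y)).nondegenerate (h.symm _) fun v => ?_)
    obtain ⟨v, rfl⟩ := hs v
    exact hu v

omit [IsManifold (𝓡 n) ∞ M] in
/-- The coordinate expression of a smooth vector-valued function. -/
theorem ContMDiffOn.contDiffOn_comp_symm {j : M → E} {U : Set M}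
    (hj : ContMDiffOn (𝓡 n) 𝓘(ℝ, E) ∞ j U) (he : e ∈ IsManifold.maximalAtlas (𝓡 n) ∞ M) :
    ContDiffOn ℝ ∞ (j ∘ e.symm) (e.target ∩ e.symm ⁻¹' U) := by
  rw [← contMDiffOn_iff_contDiffOn]
  exact hj.comp ((contMDiffOn_symm_of_mem_maximalAtlas he).mono inter_subset_left)
    fun y hy => hy.2

omit [IsManifold (𝓡 n) ∞ M] in
theorem fderiv_comp_symm {j : M → E} (he : e ∈ IsManifold.maximalAtlas (𝓡 n) ∞ M) {y : Coord n}
    (hy : y ∈ e.target) (hj : MDifferentiableAt (𝓡 n) 𝓘(ℝ, E) j (e.symm y)) (u : Coord n) :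
    fderiv ℝ (j ∘ e.symm) y u
      = mfderiv (𝓡 n) 𝓘(ℝ, E) j (e.symm y) (mfderiv (𝓡 n) (𝓡 n) e.symm y u) := by
  rw [← mfderiv_eq_fderiv,
    mfderiv_comp y hj ((mdifferentiable_of_mem_maximalAtlas he).mdifferentiableAt_symm hy)]
  rfl

omit [IsManifold (𝓡 n) ∞ M] in
theorem fderiv_comp_symm_mfderiv {j : M → E} (he : e ∈ IsManifold.maximalAtlas (𝓡 n) ∞ M) {q : M}
    (hq : q ∈ e.source) (hj : MDifferentiableAt (𝓡 n) 𝓘(ℝ, E) j q) (u : TangentSpace (𝓡 n) q) :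
    fderiv ℝ (j ∘ e.symm) (e q) (mfderiv (𝓡 n) (𝓡 n) e q u : Coord n)
      = mfderiv (𝓡 n) 𝓘(ℝ, E) j q u := by
  refine (fderiv_comp_symm he (e.map_source hq) (by rwa [e.left_inv hq]) _).trans ?_
  refine (congrArg (mfderiv (𝓡 n) 𝓘(ℝ, E) j (e.symm (e q)))
    (mfderiv_symm_mfderiv he hq u)).trans ?_
  exact congrArg (fun p => (mfderiv (𝓡 n) 𝓘(ℝ, E) j p : Coord n →L[ℝ] E) u) (e.left_inv hq)

end Charts

section Developments

variable {n : ℕ} {M : Type*} [TopologicalSpace M] [ChartedSpace (Coord n) M]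
  {E : Type*} [NormedAddCommGroup E] [NormedSpace ℝ E]

/-- A development of the metric `g` of constant curvature `lam = εκ²` on the open set `U`: an
isometric map `j` into the quadric `2 B(c, Y) + κ B(Y, Y) = d` of a pseudo-Euclidean space of one
dimension more. At the point `Y` of the quadric, `c + κ Y` is a normal vector of square `ε = ± 1`.
The flat case is `κ = 0`, where the quadric is a hyperplane. -/
structure IsDevelopment (g : BilinField n M) (lam : ℝ) (B : E →L[ℝ] E →L[ℝ] ℝ) (ε κ : ℝ) (c : E)
    (d : ℝ) (j : M → E) (U : Set M) : Prop where
  isOpen : IsOpen U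
  finrank_eq : Module.finrank ℝ E = n + 1
  symm : ∀ a b, B a b = B b a
  sign : ε * ε = 1
  curv : lam = ε * κ ^ 2
  norm_eq : B c c + κ * d = ε
  smooth : ContMDiffOn (𝓡 n) 𝓘(ℝ, E) ∞ j U
  isometry : ∀ q ∈ U, ∀ u w : TangentSpace (𝓡 n) q,
    B (mfderiv (𝓡 n) 𝓘(ℝ, E) j q u) (mfderiv (𝓡 n) 𝓘(ℝ, E) j q w) = g q u w
  quadric : ∀ q ∈ U, 2 * B c (j q) + κ * B (j q) (j q) = d

/-- The curvature of a quadric as sign and square; the sign is not determined when `lam = 0`. -/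
theorem exists_sign_mul_sq (lam : ℝ) : ∃ ε κ : ℝ, ε * ε = 1 ∧ lam = ε * κ ^ 2 := by
  rcases le_total 0 lam with h | h
  · exact ⟨1, √lam, by norm_num, by rw [Real.sq_sqrt h, one_mul]⟩
  · exact ⟨-1, √(-lam), by norm_num, by rw [Real.sq_sqrt (by linarith)]; ring⟩

/-- The pseudo-Euclidean form `b ⊕ ε` on `ℝ × ℝⁿ`. -/
noncomputable def extendedForm (ε : ℝ) (b : Coord n →L[ℝ] Coord n →L[ℝ] ℝ) :
    (ℝ × Coord n) →L[ℝ] (ℝ × Coord n) →L[ℝ] ℝ :=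
  ε • (ContinuousLinearMap.mul ℝ ℝ).bilinearComp (ContinuousLinearMap.fst ℝ ℝ (Coord n))
      (ContinuousLinearMap.fst ℝ ℝ (Coord n))
    + b.bilinearComp (ContinuousLinearMap.snd ℝ ℝ (Coord n)) (ContinuousLinearMap.snd ℝ ℝ (Coord n))

theorem extendedForm_apply (ε : ℝ) (b : Coord n →L[ℝ] Coord n →L[ℝ] ℝ) (x y : ℝ × Coord n) :
    extendedForm ε b x y = ε * (x.1 * y.1) + b x.2 y.2 := by
  simp [extendedForm]

/-- A metric of constant curvature has a development near every point. -/
theorem IsConstantCurvatureMetric.exists_development [IsManifold (𝓡 n) ∞ M] {kind : GeometryKind}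
    {lam : ℝ} {g : BilinField n M} (hg : IsConstantCurvatureMetric kind lam g) {ε κ : ℝ}
    (hε : ε * ε = 1) (hlam : lam = ε * κ ^ 2) (p : M) :
    ∃ (B : (ℝ × Coord n) →L[ℝ] (ℝ × Coord n) →L[ℝ] ℝ) (c : ℝ × Coord n) (d : ℝ)
      (j : M → ℝ × Coord n) (U : Set M), p ∈ U ∧ IsDevelopment g lam B ε κ c d j U := by
  -- develop the coordinate metric of a chart, with base value `0` and normal `(1, 0)`
  set e := chartAt (Coord n) p with he_def
  have he : e ∈ IsManifold.maximalAtlas (𝓡 n) ∞ M := IsManifold.chart_mem_maximalAtlas p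
  have hp : p ∈ e.source := mem_chart_source (Coord n) p
  have hG := hg.toIsMetric.isCoordMetric he
  have hpt := e.map_source hp
  set B := extendedForm ε (chartMetric g e (e p)) with hB
  have hBs : ∀ a b, B a b = B b a := fun a b => by
    rw [hB, extendedForm_apply, extendedForm_apply, hG.symm _ hpt, mul_comm a.1]
  obtain ⟨r, J, hr, hball, hJ, hiso, hquad⟩ := exists_coordinate_development (E := ℝ × Coord n)
    (ε := ε) (κ := κ) (B := B) hG hε
    (fun y hy u v w => by rw [← hlam]; exact hg.curvature_eq e he y hy u v w) hpt hBs (1, 0)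
    (ContinuousLinearMap.inr ℝ ℝ (Coord n)) (fun u v => by simp [hB, extendedForm_apply])
    (fun u => by simp [hB, extendedForm_apply]) (by simp [hB, extendedForm_apply])
  have hj : ContMDiffOn (𝓡 n) 𝓘(ℝ, ℝ × Coord n) ∞ (J ∘ e)
      (e.source ∩ e ⁻¹' Metric.ball (e p) r) :=
    (contMDiffOn_iff_contDiffOn.2 hJ).comp
      ((contMDiffOn_of_mem_maximalAtlas he).mono inter_subset_left) fun q hq => hq.2
  refine ⟨B, (1, 0), 0, J ∘ e, e.source ∩ e ⁻¹' Metric.ball (e p) r,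
    ⟨hp, Metric.mem_ball_self hr⟩, e.isOpen_inter_preimage Metric.isOpen_ball, ?_, hBs, hε, hlam,
    ?_, hj, ?_, fun q hq => hquad _ hq.2⟩
  · rw [Module.finrank_prod, Module.finrank_self, finrank_euclideanSpace_fin, add_comm]
  · simp [hB, extendedForm_apply]
  · intro q hq u w
    have hJd : MDifferentiableAt (𝓡 n) 𝓘(ℝ, ℝ × Coord n) J (e q) :=
      ((hJ.contDiffAt (Metric.isOpen_ball.mem_nhds hq.2)).differentiableAt
        (by simp)).mdifferentiableAt
    rw [mfderiv_comp q hJd ((mdifferentiable_of_mem_maximalAtlas he).mdifferentiableAt hq.1),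
      mfderiv_eq_fderiv]
    refine (hiso _ hq.2 _ _).trans ?_
    refine (congrArg₂ (fun a b : Coord n => (g (e.symm (e q)) : Coord n →L[ℝ] Coord n →L[ℝ] ℝ) a b)
      (mfderiv_symm_mfderiv he hq.1 u) (mfderiv_symm_mfderiv he hq.1 w)).trans ?_
    exact congrArg (fun p => (g p : Coord n →L[ℝ] Coord n →L[ℝ] ℝ) u w) (e.left_inv hq.1)

end Developments

section DevelopmentInverse

variable {n : ℕ} {M : Type*} [TopologicalSpace M] [ChartedSpace (Coord n) M]
  {E : Type*} [NormedAddCommGroup E] [NormedSpace ℝ E]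
  {g : BilinField n M} {lam : ℝ} {B : E →L[ℝ] E →L[ℝ] ℝ} {ε κ : ℝ} {c : E} {d : ℝ} {j : M → E}
  {U : Set M}

theorem IsDevelopment.mono (h : IsDevelopment g lam B ε κ c d j U) {U' : Set M} (hU : U' ⊆ U)
    (hU' : IsOpen U') : IsDevelopment g lam B ε κ c d j U' :=
  { h with
    isOpen := hU'
    smooth := h.smooth.mono hU
    isometry := fun q hq => h.isometry q (hU hq)
    quadric := fun q hq => h.quadric q (hU hq) }

theorem IsDevelopment.finiteDimensional (h : IsDevelopment g lam B ε κ c d j U) :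
    FiniteDimensional ℝ E :=
  FiniteDimensional.of_finrank_pos (by rw [h.finrank_eq]; omega)

theorem IsDevelopment.mdifferentiableAt (h : IsDevelopment g lam B ε κ c d j U) {q : M}
    (hq : q ∈ U) : MDifferentiableAt (𝓡 n) 𝓘(ℝ, E) j q :=
  (h.smooth.contMDiffAt (h.isOpen.mem_nhds hq)).mdifferentiableAt (by simp)

/-- The normal vector `c + κ Y` of the quadric has square `ε`. -/
theorem normal_sq_of_quadric (hB : ∀ a b, B a b = B b a) (hn : B c c + κ * d = ε) {Y : E}
    (hY : 2 * B c Y + κ * B Y Y = d) : B (c + κ • Y) (c + κ • Y) = ε := by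
  simp only [map_add, map_smul, add_apply, smul_apply, smul_eq_mul, hB Y c]
  linear_combination hn + κ * hY

/-- The normal vector `c + κ F` of the quadric is orthogonal to any map `F` into the quadric. -/
theorem normal_orthogonal_of_quadric {V H X : Type*} [NormedAddCommGroup V] [NormedSpace ℝ V]
    [TopologicalSpace H] {I : ModelWithCorners ℝ V H} [TopologicalSpace X] [ChartedSpace H X]
    {F : X → E} {O : Set X} (hB : ∀ a b, B a b = B b a) (hO : IsOpen O)
    (hF : ∀ x ∈ O, 2 * B c (F x) + κ * B (F x) (F x) = d) {x : X} (hx : x ∈ O)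
    (hd : MDifferentiableAt I 𝓘(ℝ, E) F x) (u : TangentSpace I x) :
    B (c + κ • F x) (mfderiv I 𝓘(ℝ, E) F x u) = 0 := by
  set φ : E → ℝ := fun Y => 2 * B c Y + κ * B Y Y with hφ
  have h1 : HasFDerivAt φ ((2 : ℝ) • B c + κ • (B (F x) + B.flip (F x))) (F x) := by
    have h2 := ((B c).hasFDerivAt (x := F x)).const_mul 2
    have h3 := (B.hasFDerivAt_of_bilinear (hasFDerivAt_id (F x)) (hasFDerivAt_id (F x))).const_mul κ
    refine (h2.add h3).congr_fderiv ?_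
    ext z
    simp
  have h2 : HasMFDerivAt I 𝓘(ℝ, ℝ) (φ ∘ F) x _ := h1.hasMFDerivAt.comp x hd.hasMFDerivAt
  have h3 : mfderiv I 𝓘(ℝ, ℝ) (φ ∘ F) x = 0 := by
    have h4 : φ ∘ F =ᶠ[𝓝 x] fun _ => d := Filter.mem_of_superset (hO.mem_nhds hx) hF
    rw [h4.mfderiv_eq]
    exact mfderiv_const
  rw [h2.mfderiv] at h3
  have key : ∀ z : E, ((2 : ℝ) • B c + κ • (B (F x) + B.flip (F x))) z = 0 →
      B (c + κ • F x) z = 0 := fun z hz => by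
    simp only [map_add, map_smul, add_apply, smul_apply, smul_eq_mul,
      ContinuousLinearMap.flip_apply] at hz ⊢
    rw [hB z (F x)] at hz
    linear_combination hz / 2
  exact key _ (DFunLike.congr_fun h3 u)

theorem IsDevelopment.normal_sq (h : IsDevelopment g lam B ε κ c d j U) {q : M} (hq : q ∈ U) :
    B (c + κ • j q) (c + κ • j q) = ε :=
  normal_sq_of_quadric h.symm h.norm_eq (h.quadric q hq)

theorem IsDevelopment.normal_orthogonal (h : IsDevelopment g lam B ε κ c d j U) {q : M}
    (hq : q ∈ U) (u : TangentSpace (𝓡 n) q) :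
    B (c + κ • j q) (mfderiv (𝓡 n) 𝓘(ℝ, E) j q u) = 0 :=
  normal_orthogonal_of_quadric h.symm h.isOpen h.quadric hq (h.mdifferentiableAt hq) u

theorem IsDevelopment.sign_ne_zero (h : IsDevelopment g lam B ε κ c d j U) : ε ≠ 0 := by
  intro h0
  have := h.sign
  rw [h0] at this
  norm_num at this

theorem IsDevelopment.mfderiv_injective (h : IsDevelopment g lam B ε κ c d j U)
    {kind : GeometryKind} (hg : IsMetric kind g) {q : M} (hq : q ∈ U) :
    Function.Injective (mfderiv (𝓡 n) 𝓘(ℝ, E) j q) := by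
  refine (injective_iff_map_eq_zero _).2 fun u hu => ?_
  refine (hg.signature q).nondegenerate (hg.symm q) fun v => ?_
  rw [← h.isometry q hq, hu]
  exact congrArg (fun T : E →L[ℝ] ℝ => T _) (map_zero B)

/-- A smooth local retraction `π` onto the manifold along the development `j`: it is defined on an
open set `V` of the pseudo-Euclidean space, and it inverts `j` on the part of the quadric in `V`. -/
structure IsDevelopmentInverse (B : E →L[ℝ] E →L[ℝ] ℝ) (κ : ℝ) (c : E) (d : ℝ) (j : M → E)
    (U : Set M) (V : Set E) (π : E → M) : Prop where
  isOpen : IsOpen V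
  smooth : ContMDiffOn 𝓘(ℝ, E) (𝓡 n) ∞ π V
  mapsTo : MapsTo j U V
  mapsTo_inv : MapsTo π V U
  left_inv : ∀ q ∈ U, π (j q) = q
  right_inv : ∀ Y ∈ V, 2 * B c Y + κ * B Y Y = d → j (π Y) = Y

/-- The image of a development is locally the whole quadric. The retraction is the first component of
the local inverse of `(q, a) ↦ j q + a ξ`, with `ξ` the normal vector at the base point. -/
theorem IsDevelopment.exists_inverse [IsManifold (𝓡 n) ∞ M]
    (h : IsDevelopment g lam B ε κ c d j U) {kind : GeometryKind} (hg : IsMetric kind g) {p : M}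
    (hp : p ∈ U) :
    ∃ (U' : Set M) (V : Set E) (π : E → M), p ∈ U' ∧ U' ⊆ U ∧ IsOpen U' ∧
      IsDevelopmentInverse (n := n) B κ c d j U' V π := by
  have := h.finiteDimensional
  set ξ : E := c + κ • j p with hξ
  have hξ2 : B ξ ξ = ε := h.normal_sq hp
  set Q : M × ℝ → E := fun x => j x.1 + x.2 • ξ with hQ
  -- on `O`, the point `Q (q, a)` lies on the quadric only for `a = 0`
  set θ : M × ℝ → ℝ := fun x => 2 * ε + 2 * κ * B ξ (j x.1 - j p) + κ * x.2 * ε with hθ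
  have hj : ContMDiffOn ((𝓡 n).prod 𝓘(ℝ, ℝ)) 𝓘(ℝ, E) ∞ (fun x : M × ℝ => j x.1)
      (U ×ˢ univ) := h.smooth.comp contMDiffOn_fst fun x hx => hx.1
  have hθc : ContinuousOn θ (U ×ˢ univ) := by
    have h1 : ContinuousOn (fun x : M × ℝ => B ξ (j x.1 - j p)) (U ×ˢ univ) :=
      (B ξ).continuous.comp_continuousOn (hj.continuousOn.sub continuousOn_const)
    exact (continuousOn_const.add (continuousOn_const.mul h1)).add
      ((continuousOn_const.mul continuous_snd.continuousOn).mul continuousOn_const)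
  have hUo : IsOpen (U ×ˢ (univ : Set ℝ)) := h.isOpen.prod isOpen_univ
  have hO : IsOpen ((U ×ˢ univ) ∩ θ ⁻¹' {0}ᶜ) :=
    hθc.isOpen_inter_preimage hUo isOpen_compl_singleton
  have hQs : ContMDiffOn ((𝓡 n).prod 𝓘(ℝ, ℝ)) 𝓘(ℝ, E) ∞ Q (U ×ˢ univ) :=
    hj.add (((ContinuousLinearMap.toSpanSingleton ℝ ξ).contMDiff.contMDiffOn (s := univ)).comp
      contMDiffOn_snd fun x _ => mem_univ _)
  have hmem : (p, (0 : ℝ)) ∈ (U ×ˢ univ) ∩ θ ⁻¹' {0}ᶜ :=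
    ⟨⟨hp, mem_univ _⟩, by simp [hθ, h.sign_ne_zero]⟩
  set D : Coord n →L[ℝ] E := mfderiv (𝓡 n) 𝓘(ℝ, E) j p with hD
  have hder : HasMFDerivAt ((𝓡 n).prod 𝓘(ℝ, ℝ)) 𝓘(ℝ, E) Q (p, (0 : ℝ))
      (D.comp (ContinuousLinearMap.fst ℝ (Coord n) ℝ)
        + (ContinuousLinearMap.toSpanSingleton ℝ ξ).comp
          (ContinuousLinearMap.snd ℝ (Coord n) ℝ)) :=
    (HasMFDerivAt.comp (p, (0 : ℝ)) (h.mdifferentiableAt hp).hasMFDerivAt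
      (hasMFDerivAt_fst (p, (0 : ℝ)))).add (HasMFDerivAt.comp (p, (0 : ℝ))
      (ContinuousLinearMap.toSpanSingleton ℝ ξ).hasMFDerivAt (hasMFDerivAt_snd (p, (0 : ℝ))))
  -- `D` is injective and orthogonal to the nonisotropic vector `ξ`
  have hinj : Function.Injective (mfderiv ((𝓡 n).prod 𝓘(ℝ, ℝ)) 𝓘(ℝ, E) Q (p, (0 : ℝ))) := by
    rw [hder.mfderiv]
    refine (injective_iff_map_eq_zero (_ : Coord n × ℝ →L[ℝ] E)).2 fun w hw => ?_
    obtain ⟨u, b⟩ := w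
    have h0 : D u + b • ξ = 0 := hw
    have h1 : B ξ (D u + b • ξ) = 0 := by rw [h0, map_zero]
    have h2 : B ξ (D u) = 0 := h.normal_orthogonal hp u
    rw [map_add, h2, map_smul, hξ2, zero_add, smul_eq_mul] at h1
    have h3 : b = 0 := (mul_eq_zero.1 h1).resolve_right h.sign_ne_zero
    rw [h3, zero_smul, add_zero] at h0
    have h4 : u = 0 := (h.mfderiv_injective hg hp) (h0.trans (map_zero _).symm)
    rw [h3, h4]
    rfl
  obtain ⟨P, hP1, hP2, hP3, hP4⟩ := exists_openPartialHomeomorph_of_mfderiv_injective hO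
    (hQs.mono inter_subset_left) hmem hinj
    (by rw [Module.finrank_prod, Module.finrank_self, finrank_euclideanSpace_fin, h.finrank_eq])
  obtain ⟨U', I', hU', hI', hpU', h0I', hsub⟩ :=
    isOpen_prod_iff.1 P.open_source p 0 hP1
  refine ⟨U', P '' (U' ×ˢ I'), fun Y => (P.symm Y).1, hpU', fun q hq => ?_, hU', ?_⟩
  · have h1 : (q, (0 : ℝ)) ∈ U' ×ˢ I' := ⟨hq, h0I'⟩
    exact (hP2 (hsub h1)).1.1
  have hPQ : ∀ x ∈ U' ×ˢ I', P x = Q x := fun x hx => hP3 (hsub hx)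
  have hQ0 : ∀ q, Q (q, 0) = j q := fun q => by simp [hQ]
  refine ⟨P.isOpen_image_of_subset_source (hU'.prod hI') hsub, ?_, fun q hq => ?_, ?_, fun q hq => ?_,
    ?_⟩
  · refine (contMDiffOn_fst (s := univ)).comp (hP4.mono ?_) fun Y _ => mem_univ _
    rintro _ ⟨x, hx, rfl⟩
    exact P.map_source (hsub hx)
  · exact ⟨(q, 0), ⟨hq, h0I'⟩, by rw [hPQ _ ⟨hq, h0I'⟩, hQ0]⟩
  · rintro _ ⟨x, hx, rfl⟩
    show (P.symm (P x)).1 ∈ U'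
    rw [P.left_inv (hsub hx)]
    exact hx.1
  · show (P.symm (j q)).1 = q
    rw [← hQ0, ← hPQ _ ⟨hq, h0I'⟩, P.left_inv (hsub ⟨hq, h0I'⟩)]
  · rintro _ ⟨⟨q, a⟩, hx, rfl⟩ hquad
    show j (P.symm (P (q, a))).1 = P (q, a)
    rw [P.left_inv (hsub hx)]
    have hxO := hP2 (hsub hx)
    rw [hPQ _ hx] at hquad ⊢
    have ha : a * θ (q, a) = 0 := by
      have h1 := h.quadric q hxO.1.1
      simp only [hQ, hθ, map_add, map_sub, map_smul, add_apply, smul_apply, smul_eq_mul, hξ2,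
        h.symm (j q) ξ] at hquad ⊢
      have h2 : B ξ (j q) = B c (j q) + κ * B (j p) (j q) := by simp [hξ]
      have h3 : B c ξ + κ * B (j p) ξ = ε := by
        rw [← hξ2]
        conv_rhs => rw [hξ]
        rw [B.map_add, B.map_smul, add_apply, smul_apply, smul_eq_mul, ← hξ]
      have h4 : B ξ (j p) = B (j p) ξ := h.symm _ _
      rw [h4]
      linear_combination hquad - h1 - 2 * a * h3
    rw [(mul_eq_zero.1 ha).resolve_right hxO.2, hQ0]

end DevelopmentInverse

/-! ### Linear algebra of the adapted frame -/

section Frames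

set_option maxSynthPendingDepth 3

variable {V E : Type*} [NormedAddCommGroup V] [NormedSpace ℝ V] [FiniteDimensional ℝ V]
  [NormedAddCommGroup E] [NormedSpace ℝ E] [FiniteDimensional ℝ E]
  {B : E →L[ℝ] E →L[ℝ] ℝ} {ε : ℝ} {D : V →L[ℝ] E} {η ξ : E}

/-- A nondegenerate subspace `D V` of codimension two and two orthogonal unit normal vectors `η`, `ξ`
span the whole space. -/
theorem exists_adapted_frame (hfr : Module.finrank ℝ E = Module.finrank ℝ V + 2)
    (hB : ∀ a b, B a b = B b a) (hD : ∀ u, (∀ w, B (D u) (D w) = 0) → u = 0) (hε : ε ≠ 0)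
    (hη : B η η = 1) (hξ : B ξ ξ = ε) (hηξ : B ξ η = 0) (hηD : ∀ u, B η (D u) = 0)
    (hξD : ∀ u, B ξ (D u) = 0) :
    ∃ L : (V × ℝ × ℝ) ≃L[ℝ] E, ∀ x, L x = D x.1 + x.2.1 • η + x.2.2 • ξ := by
  set T : (V × ℝ × ℝ) →L[ℝ] E := D.coprod
    ((ContinuousLinearMap.toSpanSingleton ℝ η).coprod (ContinuousLinearMap.toSpanSingleton ℝ ξ))
    with hT
  have hTx : ∀ x, T x = D x.1 + x.2.1 • η + x.2.2 • ξ := fun x => by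
    simp [hT, add_assoc]
  have hinj : Function.Injective T := by
    refine (injective_iff_map_eq_zero T).2 fun x hx => ?_
    have h1 : B η (T x) = 0 := by rw [hx, map_zero]
    have h2 : B ξ (T x) = 0 := by rw [hx, map_zero]
    have h3 : ∀ w, B (D w) (T x) = 0 := fun w => by rw [hx, map_zero]
    simp only [hTx, map_add, map_smul, smul_eq_mul, hηD, hξD, hη, hξ, hηξ, hB η ξ, hB (D _) η,
      hB (D _) ξ, mul_zero, add_zero, zero_add, mul_one] at h1 h2 h3
    have h4 : x.1 = 0 := hD _ fun w => by rw [hB, h3]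
    exact Prod.ext h4 (Prod.ext h1 ((mul_eq_zero.1 h2).resolve_right hε))
  obtain ⟨L, hL⟩ := exists_continuousLinearEquiv_of_injective hinj
    (by rw [Module.finrank_prod, Module.finrank_prod, Module.finrank_self, hfr])
  exact ⟨L, fun x => by rw [← hTx, ← hL]; rfl⟩

theorem eq_zero_of_orthogonal_frame (hfr : Module.finrank ℝ E = Module.finrank ℝ V + 2)
    (hB : ∀ a b, B a b = B b a) (hD : ∀ u, (∀ w, B (D u) (D w) = 0) → u = 0) (hε : ε ≠ 0)
    (hη : B η η = 1) (hξ : B ξ ξ = ε) (hηξ : B ξ η = 0) (hηD : ∀ u, B η (D u) = 0)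
    (hξD : ∀ u, B ξ (D u) = 0) {z : E} (h1 : ∀ w, B z (D w) = 0) (h2 : B z η = 0)
    (h3 : B z ξ = 0) : z = 0 := by
  obtain ⟨L, hL⟩ := exists_adapted_frame hfr hB hD hε hη hξ hηξ hηD hξD
  obtain ⟨x, rfl⟩ := L.surjective z
  simp only [hL, map_add, map_smul, add_apply, smul_apply, smul_eq_mul, hηD, hξD, hη, hξ, hηξ,
    hB η ξ, hB (D _) η, hB (D _) ξ, mul_zero, add_zero, zero_add, mul_one] at h1 h2 h3
  have h4 : x.1 = 0 := hD _ h1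
  rw [hL, h4, h2, (mul_eq_zero.1 h3).resolve_right hε]
  simp

end Frames

/-! ### Second derivatives along a hypersurface -/

section SecondDerivatives

set_option maxSynthPendingDepth 3

variable {m n : ℕ} {E : Type*} [NormedAddCommGroup E] [NormedSpace ℝ E]
  {B : E →L[ℝ] E →L[ℝ] ℝ}

theorem fderiv_fderiv_comp {V W : Type*} [NormedAddCommGroup V] [NormedSpace ℝ V]
    [NormedAddCommGroup W] [NormedSpace ℝ W] {J : V → E} {f : W → V} {O : Set V} {O' : Set W}
    (hO : IsOpen O) (hO' : IsOpen O') (hJ : ContDiffOn ℝ ∞ J O) (hf : ContDiffOn ℝ ∞ f O')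
    {y : W} (hy : y ∈ O') (hfy : f y ∈ O) (u w : W) :
    fderiv ℝ (fderiv ℝ (J ∘ f)) y u w
      = fderiv ℝ (fderiv ℝ J) (f y) (fderiv ℝ f y u) (fderiv ℝ f y w)
        + fderiv ℝ J (f y) (fderiv ℝ (fderiv ℝ f) y u w) := by
  have hJd : ∀ z ∈ O, DifferentiableAt ℝ J z := fun z hz =>
    (hJ.contDiffAt (hO.mem_nhds hz)).differentiableAt (by simp)
  have hfd : ∀ z ∈ O', DifferentiableAt ℝ f z := fun z hz =>
    (hf.contDiffAt (hO'.mem_nhds hz)).differentiableAt (by simp)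
  have h1 : fderiv ℝ (J ∘ f) =ᶠ[𝓝 y] fun z => (fderiv ℝ J (f z)).comp (fderiv ℝ f z) := by
    filter_upwards [hO'.mem_nhds hy, (hfd y hy).continuousAt (hO.mem_nhds hfy)] with z hz hz'
    exact fderiv_comp z (hJd _ hz') (hfd z hz)
  have h2 := ((hJ.differentiableAt_fderiv hO hfy).hasFDerivAt.comp y
    (hfd y hy).hasFDerivAt).clm_comp (hf.differentiableAt_fderiv hO' hy).hasFDerivAt
  rw [h1.fderiv_eq]
  have h3 := h2.fderiv
  rw [show (fun z => (fderiv ℝ J (f z)).comp (fderiv ℝ f z))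
    = fun z => ((fderiv ℝ J ∘ f) z).comp (fderiv ℝ f z) from rfl, h3]
  simp [add_comm]

/-- The extrinsic curvature is the normal component of the second derivative of the developed
hypersurface. -/
theorem normal_fderiv_fderiv_comp {J : Coord n → E} {f : Coord m → Coord n} {O : Set (Coord n)}
    {O' : Set (Coord m)} {G : Coord n → Coord n →L[ℝ] Coord n →L[ℝ] ℝ} (hG : IsCoordMetric G O)
    (hO' : IsOpen O') (hJ : ContDiffOn ℝ ∞ J O) (hf : ContDiffOn ℝ ∞ f O')
    (hB : ∀ a b, B a b = B b a)
    (h : ∀ y ∈ O, ∀ u v, G y u v = B (fderiv ℝ J y u) (fderiv ℝ J y v))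
    {y : Coord m} (hy : y ∈ O') (hfy : f y ∈ O) (v : Coord n) (u w : Coord m) :
    B (fderiv ℝ J (f y) v) (fderiv ℝ (fderiv ℝ (J ∘ f)) y u w)
      = G (f y) v (christoffel G (f y) (fderiv ℝ f y u) (fderiv ℝ f y w)
        + fderiv ℝ (fderiv ℝ f) y u w) := by
  rw [fderiv_fderiv_comp hG.isOpen hO' hJ hf hy hfy, map_add, map_add, ← h _ hfy, hB,
    ← christoffelLower_eq_of_induced hG.isOpen hJ hG hB h hfy, ← hG.apply_christoffel hfy,
    hG.symm _ hfy v, hG.symm _ hfy v]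

/-- If a derivative is proportional to another one, of an immersion of a manifold of dimension at
least two, then the factor is locally constant: the second derivatives are symmetric. -/
theorem eventually_eq_of_fderiv_eq_smul {V : Type*} [NormedAddCommGroup V] [NormedSpace ℝ V]
    [FiniteDimensional ℝ V] (hV : 2 ≤ Module.finrank ℝ V) {F η : V → E} {s : V → ℝ} {O : Set V}
    (hO : IsOpen O) (hF : ContDiffOn ℝ ∞ F O) (hη : ContDiffOn ℝ ∞ η O)
    (hinj : ∀ y ∈ O, Function.Injective (fderiv ℝ F y))
    (h : ∀ y ∈ O, fderiv ℝ η y = s y • fderiv ℝ F y) {y₀ : V} (hy₀ : y₀ ∈ O) :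
    ∀ᶠ y in 𝓝 y₀, s y = s y₀ := by
  have : Nontrivial V := Module.nontrivial_of_finrank_pos (R := ℝ) (by omega)
  have hDF := hF.fderiv_of_isOpen hO (m := ∞) le_rfl
  have hDη := hη.fderiv_of_isOpen hO (m := ∞) le_rfl
  obtain ⟨u₀, hu₀⟩ := exists_ne (0 : V)
  obtain ⟨ℓ, hℓ⟩ := SeparatingDual.exists_ne_zero (R := ℝ) (x := fderiv ℝ F y₀ u₀)
    (fun h0 => hu₀ (hinj y₀ hy₀ (h0.trans (map_zero _).symm)))
  have hℓF : ContDiffOn ℝ ∞ (fun y => ℓ (fderiv ℝ F y u₀)) O :=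
    ℓ.contDiff.comp_contDiffOn (hDF.clm_apply contDiffOn_const)
  have hℓη : ContDiffOn ℝ ∞ (fun y => ℓ (fderiv ℝ η y u₀)) O :=
    ℓ.contDiff.comp_contDiffOn (hDη.clm_apply contDiffOn_const)
  have hO1 : IsOpen (O ∩ (fun y => ℓ (fderiv ℝ F y u₀)) ⁻¹' {0}ᶜ) :=
    hℓF.continuousOn.isOpen_inter_preimage hO isOpen_compl_singleton
  obtain ⟨r, hr, hball⟩ := Metric.isOpen_iff.1 hO1 y₀ ⟨hy₀, hℓ⟩
  -- near `y₀` the factor is a quotient of smooth functions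
  have hs : DifferentiableOn ℝ s (Metric.ball y₀ r) := by
    have h1 : DifferentiableOn ℝ (fun y => ℓ (fderiv ℝ η y u₀) / ℓ (fderiv ℝ F y u₀))
        (Metric.ball y₀ r) :=
      ((hℓη.mono fun y hy => (hball hy).1).div (hℓF.mono fun y hy => (hball hy).1)
        fun y hy => (hball hy).2).differentiableOn (by simp)
    refine h1.congr fun y hy => ?_
    rw [h y (hball hy).1, smul_apply, map_smul, smul_eq_mul, mul_div_cancel_right₀]
    exact (hball hy).2
  have hder : ∀ y ∈ Metric.ball y₀ r, fderiv ℝ s y = 0 := by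
    intro y hy
    have hyO := (hball hy).1
    have hsd := (hs.differentiableAt (Metric.isOpen_ball.mem_nhds hy)).hasFDerivAt
    have h3 : fderiv ℝ η =ᶠ[𝓝 y] fun z => s z • fderiv ℝ F z :=
      Filter.mem_of_superset (hO.mem_nhds hyO) h
    have h2 := h3.fderiv_eq.trans
      (hsd.smul (hF.differentiableAt_fderiv hO hyO).hasFDerivAt).fderiv
    -- by the symmetry of both second derivatives `ds(u) DF(v) = ds(v) DF(u)`
    have h4 : ∀ u v, fderiv ℝ s y u • v = fderiv ℝ s y v • u := by
      intro u v
      have h5 := hη.fderiv_fderiv_symm hO hyO u v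
      rw [h2] at h5
      simp only [add_apply, smul_apply, ContinuousLinearMap.smulRight_apply,
        hF.fderiv_fderiv_symm hO hyO u v] at h5
      refine hinj y hyO ?_
      rw [map_smul, map_smul]
      exact add_left_cancel h5
    ext u
    by_contra hne
    have h5 : Module.finrank ℝ V ≤ 1 := finrank_le_one u fun v =>
      ⟨(fderiv ℝ s y u)⁻¹ * fderiv ℝ s y v, by
        rw [mul_smul, ← h4, smul_smul, inv_mul_cancel₀ hne, one_smul]⟩
    omega
  filter_upwards [Metric.ball_mem_nhds y₀ hr] with y hy
  exact Metric.isOpen_ball.is_const_of_fderiv_eq_zero (convex_ball _ _).isPreconnected hs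
    (fun z hz => hder z hz) hy (Metric.mem_ball_self hr)

end SecondDerivatives

/-! ### The equations of Gauss and Weingarten -/

section GaussWeingarten

set_option maxSynthPendingDepth 3

variable {m : ℕ} {E : Type*} [NormedAddCommGroup E] [NormedSpace ℝ E] [FiniteDimensional ℝ E]
  {B : E →L[ℝ] E →L[ℝ] ℝ} {ε κ σ d : ℝ} {c : E} {F η : Coord m → E} {O : Set (Coord m)}
  {y : Coord m}

omit [FiniteDimensional ℝ E] in
/-- Differentiating a constant pairing of two vector fields. -/
theorem apply_fderiv_add_eq_zero {V : Type*} [NormedAddCommGroup V] [NormedSpace ℝ V]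
    {a b : V → E} {O : Set V} {y : V} {k : ℝ} (hO : IsOpen O) (hy : y ∈ O)
    (ha : DifferentiableAt ℝ a y) (hb : DifferentiableAt ℝ b y) (h : ∀ z ∈ O, B (a z) (b z) = k)
    (u : V) : B (fderiv ℝ a y u) (b y) + B (a y) (fderiv ℝ b y u) = 0 := by
  have h1 := B.hasFDerivAt_of_bilinear ha.hasFDerivAt hb.hasFDerivAt
  have h2 : (fun z => B (a z) (b z)) =ᶠ[𝓝 y] fun _ => k := Filter.mem_of_superset (hO.mem_nhds hy) h
  have h3 : fderiv ℝ (fun z => B (a z) (b z)) y = 0 := by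
    rw [h2.fderiv_eq]
    simp
  rw [h1.fderiv] at h3
  have h4 : B (a y) (fderiv ℝ b y u) + B (fderiv ℝ a y u) (b y) = 0 := DFunLike.congr_fun h3 u
  linarith

/-- The equation of Weingarten for an umbilical hypersurface of a quadric. -/
theorem weingarten_of_umbilical (hfr : Module.finrank ℝ E = m + 2) (hO : IsOpen O)
    (hF : ContDiffOn ℝ ∞ F O) (hη : ContDiffOn ℝ ∞ η O) (hy : y ∈ O)
    (hB : ∀ a b, B a b = B b a) (hε : ε ≠ 0)
    (hD : ∀ u, (∀ w, B (fderiv ℝ F y u) (fderiv ℝ F y w) = 0) → u = 0)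
    (hξ2 : B (c + κ • F y) (c + κ • F y) = ε)
    (hξF : ∀ w, B (c + κ • F y) (fderiv ℝ F y w) = 0)
    (hξη : ∀ z ∈ O, B (c + κ • F z) (η z) = 0) (hη2 : ∀ z ∈ O, B (η z) (η z) = 1)
    (hηF : ∀ z ∈ O, ∀ w, B (η z) (fderiv ℝ F z w) = 0)
    (hu : ∀ u w, B (η y) (fderiv ℝ (fderiv ℝ F) y u w)
      = σ * B (fderiv ℝ F y u) (fderiv ℝ F y w)) (u : Coord m) :
    fderiv ℝ η y u = -σ • fderiv ℝ F y u := by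
  have hFd : DifferentiableAt ℝ F y :=
    (hF.contDiffAt (hO.mem_nhds hy)).differentiableAt (by simp)
  have hηd : DifferentiableAt ℝ η y :=
    (hη.contDiffAt (hO.mem_nhds hy)).differentiableAt (by simp)
  have hFd2 := hF.differentiableAt_fderiv hO hy
  have hfr' : Module.finrank ℝ E = Module.finrank ℝ (Coord m) + 2 := by
    rw [finrank_euclideanSpace_fin, hfr]
  refine eq_of_sub_eq_zero (eq_zero_of_orthogonal_frame hfr' hB hD hε (hη2 y hy) hξ2 (hξη y hy)
    (hηF y hy) hξF (fun w => ?_) ?_ ?_)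
  · have h1 := apply_fderiv_add_eq_zero hO hy hηd (hFd2.clm_apply (differentiableAt_const w))
      (fun z hz => hηF z hz w) u
    have h2 : fderiv ℝ (fun z => fderiv ℝ F z w) y u = fderiv ℝ (fderiv ℝ F) y u w := by
      rw [fderiv_clm_apply hFd2 (differentiableAt_const w)]
      simp
    rw [h2, hu] at h1
    simp only [map_sub, map_smul, sub_apply, smul_apply, smul_eq_mul]
    linarith
  · have h1 := apply_fderiv_add_eq_zero hO hy hηd hηd hη2 u
    rw [hB (η y)] at h1
    simp only [map_sub, map_smul, sub_apply, smul_apply, smul_eq_mul,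
      hB (fderiv ℝ F y u) (η y), hηF y hy]
    linarith
  · have hξd : DifferentiableAt ℝ (fun z => c + κ • F z) y := (hFd.const_smul κ).const_add c
    have h1 := apply_fderiv_add_eq_zero hO hy hξd hηd hξη u
    have h2 : fderiv ℝ (fun z => c + κ • F z) y u = κ • fderiv ℝ F y u := by
      rw [fderiv_const_add, fderiv_fun_const_smul hFd]
      rfl
    rw [h2, map_smul, smul_apply, hB (fderiv ℝ F y u), hηF y hy, smul_zero, zero_add] at h1
    simp only [map_sub, map_smul, sub_apply, smul_apply, smul_eq_mul]
    rw [hB (fderiv ℝ η y u), h1, hB (fderiv ℝ F y u), hξF, mul_zero, sub_zero]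

/-- The equation of Gauss for an umbilical hypersurface of a quadric. -/
theorem gauss_of_umbilical {G : Coord m → Coord m →L[ℝ] Coord m →L[ℝ] ℝ}
    (hfr : Module.finrank ℝ E = m + 2) (hG : IsCoordMetric G O)
    (hF : ContDiffOn ℝ ∞ F O) (hη : ContDiffOn ℝ ∞ η O) (hy : y ∈ O)
    (hB : ∀ a b, B a b = B b a) (hε : ε * ε = 1)
    (hGF : ∀ z ∈ O, ∀ u w, G z u w = B (fderiv ℝ F z u) (fderiv ℝ F z w))
    (hξ2 : B (c + κ • F y) (c + κ • F y) = ε)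
    (hξF : ∀ z ∈ O, ∀ w, B (c + κ • F z) (fderiv ℝ F z w) = 0)
    (hξη : B (c + κ • F y) (η y) = 0) (hη2 : B (η y) (η y) = 1)
    (hηF : ∀ z ∈ O, ∀ w, B (η z) (fderiv ℝ F z w) = 0)
    (hW : ∀ u, fderiv ℝ η y u = -σ • fderiv ℝ F y u) (u v : Coord m) :
    fderiv ℝ (fderiv ℝ F) y u v = fderiv ℝ F y (christoffel G y u v)
      - G y u v • ((ε * κ) • (c + κ • F y) - σ • η y) := by
  have hO := hG.isOpen
  have hFd : DifferentiableAt ℝ F y :=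
    (hF.contDiffAt (hO.mem_nhds hy)).differentiableAt (by simp)
  have hηd : DifferentiableAt ℝ η y :=
    (hη.contDiffAt (hO.mem_nhds hy)).differentiableAt (by simp)
  have hFd2 := hF.differentiableAt_fderiv hO hy
  have hε0 : ε ≠ 0 := by rintro rfl; norm_num at hε
  have hfr' : Module.finrank ℝ E = Module.finrank ℝ (Coord m) + 2 := by
    rw [finrank_euclideanSpace_fin, hfr]
  have hD : ∀ u, (∀ w, B (fderiv ℝ F y u) (fderiv ℝ F y w) = 0) → u = 0 := fun u hu =>
    hG.nondegenerate y hy u fun w => by rw [hGF y hy, hu]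
  have h2 : fderiv ℝ (fun z => fderiv ℝ F z v) y u = fderiv ℝ (fderiv ℝ F) y u v := by
    rw [fderiv_clm_apply hFd2 (differentiableAt_const v)]
    simp
  refine eq_of_sub_eq_zero (eq_zero_of_orthogonal_frame hfr' hB hD hε0 hη2 hξ2 hξη
    (hηF y hy) (hξF y hy) (fun w => ?_) ?_ ?_)
  · simp only [map_sub, map_smul, sub_apply, smul_apply, smul_eq_mul, hξF y hy, hηF y hy, mul_zero,
      sub_zero]
    rw [← hGF y hy, hG.apply_christoffel hy,
      christoffelLower_eq_of_induced hO hF hG hB hGF hy, sub_self]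
  · have h1 := apply_fderiv_add_eq_zero hO hy hηd (hFd2.clm_apply (differentiableAt_const v))
      (fun z hz => hηF z hz v) u
    rw [h2, hW, map_smul, smul_apply, ← hGF y hy] at h1
    rw [hB _ (η y)]
    simp only [map_sub, map_smul, smul_eq_mul, hηF y hy, hη2]
    rw [hB (η y) (c + κ • F y), hξη]
    rw [smul_eq_mul] at h1
    linarith
  · have hξd : DifferentiableAt ℝ (fun z => c + κ • F z) y := (hFd.const_smul κ).const_add c
    have h1 := apply_fderiv_add_eq_zero hO hy hξd
      (hFd2.clm_apply (differentiableAt_const v)) (fun z hz => hξF z hz v) u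
    have h3 : fderiv ℝ (fun z => c + κ • F z) y u = κ • fderiv ℝ F y u := by
      rw [fderiv_const_add, fderiv_fun_const_smul hFd]
      rfl
    rw [h2, h3, map_smul, smul_apply, ← hGF y hy, smul_eq_mul] at h1
    simp only [map_sub, map_smul, sub_apply, smul_apply, smul_eq_mul]
    rw [hB (fderiv ℝ (fderiv ℝ F) y u v), hB (fderiv ℝ F y _), hξF y hy, hB (η y), hξη, hξ2]
    linear_combination h1 + κ * G y u v * hε

/-- The intrinsic curvature of an umbilical hypersurface of a quadric. -/
theorem curvature_of_weingarten {G : Coord m → Coord m →L[ℝ] Coord m →L[ℝ] ℝ}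
    (hfr : Module.finrank ℝ E = m + 2) (hG : IsCoordMetric G O)
    (hF : ContDiffOn ℝ ∞ F O) (hη : ContDiffOn ℝ ∞ η O) (hy : y ∈ O)
    (hB : ∀ a b, B a b = B b a) (hε : ε * ε = 1)
    (hGF : ∀ z ∈ O, ∀ u w, G z u w = B (fderiv ℝ F z u) (fderiv ℝ F z w))
    (hξ2 : ∀ z ∈ O, B (c + κ • F z) (c + κ • F z) = ε)
    (hξF : ∀ z ∈ O, ∀ w, B (c + κ • F z) (fderiv ℝ F z w) = 0)
    (hξη : ∀ z ∈ O, B (c + κ • F z) (η z) = 0) (hη2 : ∀ z ∈ O, B (η z) (η z) = 1)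
    (hηF : ∀ z ∈ O, ∀ w, B (η z) (fderiv ℝ F z w) = 0)
    (hW : ∀ z ∈ O, ∀ u, fderiv ℝ η z u = -σ • fderiv ℝ F z u) (u v w : Coord m) :
    curvature G y u v w = (ε * κ ^ 2 + σ ^ 2) • (G y v w • u - G y u w • v) := by
  have hO := hG.isOpen
  refine curvature_eq_of_umbilical hO hF hG (fun z hz => ?_) (fun z hz u v =>
    gauss_of_umbilical hfr hG hF hη hz hB hε hGF (hξ2 z hz) hξF (hξη z hz) (hη2 z hz) hηF (hW z hz)
      u v) (fun z hz => ?_) hy u v w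
  · refine (injective_iff_map_eq_zero _).2 fun u hu => hG.nondegenerate z hz u fun w => ?_
    rw [hGF z hz, hu, map_zero, zero_apply]
  · have hFd := ((hF.contDiffAt (hO.mem_nhds hz)).differentiableAt (by simp)).hasFDerivAt
    have hηd := ((hη.contDiffAt (hO.mem_nhds hz)).differentiableAt (by simp)).hasFDerivAt
    refine ((((hFd.const_smul κ).const_add c).const_smul (ε * κ)).sub
      (hηd.const_smul σ)).congr_fderiv ?_
    ext u
    simp only [sub_apply, smul_apply, hW z hz]
    module

end GaussWeingarten

/-! ### Developed umbilical hypersurfaces -/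

section UmbilicalDevelopments

set_option maxSynthPendingDepth 3

variable {m : ℕ} {N : Type*} [TopologicalSpace N] [ChartedSpace (Coord m) N]
  {E : Type*} [NormedAddCommGroup E] [NormedSpace ℝ E]

variable (m) in
/-- The derivative of a vector-valued function on an `m`-manifold, as a linear map on coordinate
space (with which every tangent space is identified). -/
noncomputable def vectorDeriv (F : N → E) (x : N) : Coord m →L[ℝ] E := mfderiv (𝓡 m) 𝓘(ℝ, E) F x

theorem fderiv_comp_symm_eq_vectorDeriv {F : N → E} {O : Set N} (hO : IsOpen O)
    (hF : ContMDiffOn (𝓡 m) 𝓘(ℝ, E) ∞ F O) {φ : OpenPartialHomeomorph N (Coord m)}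
    (hφ : φ ∈ IsManifold.maximalAtlas (𝓡 m) ∞ N) {y : Coord m} (hy : y ∈ φ.target)
    (hyO : φ.symm y ∈ O) (u : Coord m) :
    fderiv ℝ (F ∘ φ.symm) y u
      = vectorDeriv m F (φ.symm y) (mfderiv (𝓡 m) (𝓡 m) φ.symm y u : Coord m) :=
  fderiv_comp_symm hφ hy ((hF.contMDiffAt (hO.mem_nhds hyO)).mdifferentiableAt (by simp)) u

/-- The image `F` of an umbilical hypersurface with extrinsic curvature `σ b` in the quadric
`2 B(c, Y) + κ B(Y, Y) = d` of a pseudo-Euclidean space, with its unit normal field `η` in the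
quadric, on the open set `O`; `b` is its induced metric. -/
structure IsUmbilicalDevelopment (b : BilinField m N) (B : E →L[ℝ] E →L[ℝ] ℝ) (ε κ : ℝ) (c : E)
    (d σ : ℝ) (F η : N → E) (O : Set N) : Prop where
  isOpen : IsOpen O
  finrank_eq : Module.finrank ℝ E = m + 2
  symm : ∀ a b, B a b = B b a
  sign : ε * ε = 1
  norm_eq : B c c + κ * d = ε
  smooth : ContMDiffOn (𝓡 m) 𝓘(ℝ, E) ∞ F O
  smooth_normal : ContMDiffOn (𝓡 m) 𝓘(ℝ, E) ∞ η O
  isometry : ∀ x ∈ O, ∀ u w : Coord m, B (vectorDeriv m F x u) (vectorDeriv m F x w) = b x u w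
  quadric : ∀ x ∈ O, 2 * B c (F x) + κ * B (F x) (F x) = d
  normal_unit : ∀ x ∈ O, B (η x) (η x) = 1
  normal_orthogonal : ∀ x ∈ O, ∀ u : Coord m, B (η x) (vectorDeriv m F x u) = 0
  normal_tangent : ∀ x ∈ O, B (c + κ • F x) (η x) = 0
  weingarten : ∀ x ∈ O, ∀ u : Coord m, vectorDeriv m η x u = -σ • vectorDeriv m F x u

namespace IsUmbilicalDevelopment

variable {b : BilinField m N} {B : E →L[ℝ] E →L[ℝ] ℝ} {ε κ : ℝ} {c : E} {d σ : ℝ} {F η : N → E}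
  {O : Set N}

theorem finiteDimensional (h : IsUmbilicalDevelopment b B ε κ c d σ F η O) :
    FiniteDimensional ℝ E :=
  FiniteDimensional.of_finrank_pos (by rw [h.finrank_eq]; omega)

theorem mdifferentiableAt (h : IsUmbilicalDevelopment b B ε κ c d σ F η O) {x : N} (hx : x ∈ O) :
    MDifferentiableAt (𝓡 m) 𝓘(ℝ, E) F x :=
  (h.smooth.contMDiffAt (h.isOpen.mem_nhds hx)).mdifferentiableAt (by simp)

theorem mdifferentiableAt_normal (h : IsUmbilicalDevelopment b B ε κ c d σ F η O) {x : N}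
    (hx : x ∈ O) : MDifferentiableAt (𝓡 m) 𝓘(ℝ, E) η x :=
  (h.smooth_normal.contMDiffAt (h.isOpen.mem_nhds hx)).mdifferentiableAt (by simp)

theorem sign_ne_zero (h : IsUmbilicalDevelopment b B ε κ c d σ F η O) : ε ≠ 0 := by
  intro h0
  have := h.sign
  rw [h0] at this
  norm_num at this

theorem quadric_sq (h : IsUmbilicalDevelopment b B ε κ c d σ F η O) {x : N} (hx : x ∈ O) :
    B (c + κ • F x) (c + κ • F x) = ε :=
  normal_sq_of_quadric h.symm h.norm_eq (h.quadric x hx)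

theorem quadric_orthogonal (h : IsUmbilicalDevelopment b B ε κ c d σ F η O) {x : N} (hx : x ∈ O)
    (u : Coord m) : B (c + κ • F x) (vectorDeriv m F x u) = 0 :=
  normal_orthogonal_of_quadric h.symm h.isOpen h.quadric hx (h.mdifferentiableAt hx) u

/-- Reversing the normal field. -/
theorem neg (h : IsUmbilicalDevelopment b B ε κ c d σ F η O) :
    IsUmbilicalDevelopment b B ε κ c d (-σ) F (-η) O :=
  { h with
    smooth_normal := h.smooth_normal.neg
    normal_unit := fun x hx => by simp [h.normal_unit x hx]
    normal_orthogonal := fun x hx u => by simp [h.normal_orthogonal x hx u]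
    normal_tangent := fun x hx => by
      rw [Pi.neg_apply, map_neg, h.normal_tangent x hx, neg_zero]
    weingarten := fun x hx u => by
      have h1 : vectorDeriv m (-η) x = -vectorDeriv m η x :=
        (h.mdifferentiableAt_normal hx).hasMFDerivAt.neg.mfderiv
      rw [h1, neg_apply, h.weingarten x hx, neg_smul, neg_neg, neg_neg] }

/-- Rescaling the hypersurface and the quadric. -/
theorem smul (h : IsUmbilicalDevelopment b B ε κ c d σ F η O) {r : ℝ} (hr : 0 < r) :
    IsUmbilicalDevelopment (r ^ 2 • b) B ε (κ / r) c (r * d) (σ / r) (r • F) η O := by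
  have hd : ∀ x ∈ O, vectorDeriv m (r • F) x = r • vectorDeriv m F x := fun x hx =>
    ((h.mdifferentiableAt hx).hasMFDerivAt.const_smul r).mfderiv
  have hκ : ∀ x, (κ / r) • (r • F) x = κ • F x := fun x => by
    rw [Pi.smul_apply, smul_smul, div_mul_cancel₀ _ hr.ne']
  exact {
    isOpen := h.isOpen
    finrank_eq := h.finrank_eq
    symm := h.symm
    sign := h.sign
    norm_eq := by
      rw [← h.norm_eq]
      field_simp
    smooth := (r • ContinuousLinearMap.id ℝ E).contMDiff.comp_contMDiffOn h.smooth
    smooth_normal := h.smooth_normal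
    isometry := fun x hx u w => by
      rw [hd x hx, smul_apply, smul_apply, map_smul, map_smul, smul_apply, h.isometry x hx, smul_smul,
        ← pow_two]
      rfl
    quadric := fun x hx => by
      rw [← h.quadric x hx, Pi.smul_apply, map_smul, map_smul, map_smul, smul_apply]
      simp only [smul_eq_mul]
      field_simp
    normal_unit := h.normal_unit
    normal_orthogonal := fun x hx u => by
      rw [hd x hx, smul_apply, map_smul, h.normal_orthogonal x hx, smul_zero]
    normal_tangent := fun x hx => by rw [hκ, h.normal_tangent x hx]
    weingarten := fun x hx u => by
      rw [hd x hx, smul_apply, smul_smul, h.weingarten x hx]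
      congr 1
      field_simp }

section Coordinates

variable {φ : OpenPartialHomeomorph N (Coord m)}

theorem contDiffOn_chartMetric (h : IsUmbilicalDevelopment b B ε κ c d σ F η O)
    (hφ : φ ∈ IsManifold.maximalAtlas (𝓡 m) ∞ N) :
    ContDiffOn ℝ ∞ (chartMetric b φ) (φ.target ∩ φ.symm ⁻¹' O) := by
  have hF := h.smooth.contDiffOn_comp_symm hφ
  have hO : IsOpen (φ.target ∩ φ.symm ⁻¹' O) := φ.symm.isOpen_inter_preimage h.isOpen
  have hDF := hF.fderiv_of_isOpen hO (m := ∞) le_rfl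
  refine contDiffOn_clm_apply.2 fun u => contDiffOn_clm_apply.2 fun w => ?_
  refine ((B.contDiff.comp_contDiffOn (hDF.clm_apply (contDiffOn_const (c := u)))).clm_apply
    (hDF.clm_apply (contDiffOn_const (c := w)))).congr fun y hy => ?_
  have hd := fderiv_comp_symm_eq_vectorDeriv h.isOpen h.smooth hφ hy.1 hy.2
  refine Eq.trans ?_ (congrArg₂ (fun a a' => B a a') (hd u) (hd w)).symm
  exact (h.isometry _ hy.2 _ _).symm

/-- A developed umbilical hypersurface has constant curvature `εκ² + σ²`. -/
theorem curvature_eq (h : IsUmbilicalDevelopment b B ε κ c d σ F η O) {kind : GeometryKind}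
    (hb : IsMetric kind b) (hφ : φ ∈ IsManifold.maximalAtlas (𝓡 m) ∞ N) {y : Coord m}
    (hy : y ∈ φ.target) (hyO : φ.symm y ∈ O) (u v w : Coord m) :
    curvature (chartMetric b φ) y u v w
      = (ε * κ ^ 2 + σ ^ 2) • (chartMetric b φ y v w • u - chartMetric b φ y u w • v) := by
  have := h.finiteDimensional
  have hO : IsOpen (φ.target ∩ φ.symm ⁻¹' O) := φ.symm.isOpen_inter_preimage h.isOpen
  have hd : ∀ z ∈ φ.target ∩ φ.symm ⁻¹' O, ∀ u, fderiv ℝ (F ∘ φ.symm) z u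
      = vectorDeriv m F (φ.symm z) (mfderiv (𝓡 m) (𝓡 m) φ.symm z u : Coord m) := fun z hz u =>
    fderiv_comp_symm_eq_vectorDeriv h.isOpen h.smooth hφ hz.1 hz.2 u
  refine curvature_of_weingarten (F := F ∘ φ.symm) (η := η ∘ φ.symm) (c := c) (B := B)
    h.finrank_eq ((hb.isCoordMetric hφ).mono hO inter_subset_left)
    (h.smooth.contDiffOn_comp_symm hφ) (h.smooth_normal.contDiffOn_comp_symm hφ) ⟨hy, hyO⟩ h.symm
    h.sign (fun z hz u w => ?_) (fun z hz => h.quadric_sq hz.2) (fun z hz w => ?_)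
    (fun z hz => h.normal_tangent _ hz.2) (fun z hz => h.normal_unit _ hz.2) (fun z hz w => ?_)
    (fun z hz u => ?_) u v w
  · rw [hd z hz, hd z hz]
    exact (h.isometry _ hz.2 _ _).symm
  · rw [hd z hz]
    exact h.quadric_orthogonal hz.2 _
  · rw [hd z hz]
    exact h.normal_orthogonal _ hz.2 _
  · rw [hd z hz, fderiv_comp_symm_eq_vectorDeriv h.isOpen h.smooth_normal hφ hz.1 hz.2]
    exact h.weingarten _ hz.2 _

end Coordinates

end IsUmbilicalDevelopment

end UmbilicalDevelopments

/-! ### Umbilical hypersurfaces are developed into umbilical hypersurfaces of quadrics -/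

section Hypersurfaces

set_option maxSynthPendingDepth 3

variable {m : ℕ} {M : Type*} [TopologicalSpace M] [ChartedSpace (Coord (m + 1)) M]
  [IsManifold (𝓡 (m + 1)) ∞ M] {N : Type*} [TopologicalSpace N] [ChartedSpace (Coord m) N]
  [IsManifold (𝓡 m) ∞ N]
  {E : Type*} [NormedAddCommGroup E] [NormedSpace ℝ E]
  {g : BilinField (m + 1) M} {lam : ℝ} {B : E →L[ℝ] E →L[ℝ] ℝ} {ε κ : ℝ} {c : E} {d : ℝ}
  {j : M → E} {U : Set M} {kind : GeometryKind} {f : N → M}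
  {ν : ∀ x : N, TangentSpace (𝓡 (m + 1)) (f x)} {σ : N → ℝ}

/-- The normal field of a hypersurface, developed along `j`. -/
noncomputable def developedNormal (j : M → E) (f : N → M)
    (ν : ∀ x : N, TangentSpace (𝓡 (m + 1)) (f x)) (x : N) : E :=
  vectorDeriv (m + 1) j (f x) (ν x)

omit [IsManifold (𝓡 (m + 1)) ∞ M] [IsManifold (𝓡 m) ∞ N] in
theorem vectorDeriv_comp {x : N} (hj : MDifferentiableAt (𝓡 (m + 1)) 𝓘(ℝ, E) j (f x))
    (hf : MDifferentiableAt (𝓡 m) (𝓡 (m + 1)) f x) (u : Coord m) :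
    vectorDeriv m (j ∘ f) x u
      = vectorDeriv (m + 1) j (f x) (mfderiv (𝓡 m) (𝓡 (m + 1)) f x u : Coord (m + 1)) :=
  DFunLike.congr_fun (mfderiv_comp x hj hf) u

omit [IsManifold (𝓡 m) ∞ N] in
theorem contMDiffOn_developedNormal (hj : ContMDiffOn (𝓡 (m + 1)) 𝓘(ℝ, E) ∞ j U) (hU : IsOpen U)
    (hν : ContMDiff (𝓡 m) (𝓡 (m + 1)).tangent ∞
      (fun x => (⟨f x, ν x⟩ : TangentBundle (𝓡 (m + 1)) M))) :
    ContMDiffOn (𝓡 m) 𝓘(ℝ, E) ∞ (developedNormal j f ν) (f ⁻¹' U) := by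
  have h1 := (contMDiff_snd_tangentBundle_modelSpace (n := ∞) E 𝓘(ℝ, E)).comp_contMDiffOn
    ((hj.contMDiffOn_tangentMapWithin (m := ∞) le_rfl hU.uniqueMDiffOn).comp
      (hν.contMDiffOn (s := f ⁻¹' U)) fun x hx => hx)
  refine h1.congr fun x hx => ?_
  show (mfderiv (𝓡 (m + 1)) 𝓘(ℝ, E) j (f x) (ν x) : E)
    = mfderivWithin (𝓡 (m + 1)) 𝓘(ℝ, E) j U (f x) (ν x)
  rw [mfderivWithin_of_isOpen hU hx]

omit [IsManifold (𝓡 m) ∞ N] in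
/-- The normal component of the second derivative of the developed hypersurface. -/
theorem IsUmbilicalHypersurface.normal_fderiv_fderiv (h : IsUmbilicalHypersurface kind g f ν σ)
    (hg : IsMetric kind g) (hdev : IsDevelopment g lam B ε κ c d j U)
    {φ : OpenPartialHomeomorph N (Coord m)} (hφ : φ ∈ IsManifold.maximalAtlas (𝓡 m) ∞ N) {x : N}
    (hxφ : x ∈ φ.source) (hx : f x ∈ U) (u w : Coord m) :
    B (developedNormal j f ν x) (fderiv ℝ (fderiv ℝ ((j ∘ f) ∘ φ.symm)) (φ x) u w)
      = σ x * chartMetric (inducedMetric (m := m) g f) φ (φ x) u w := by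
  set e := chartAt (Coord (m + 1)) (f x) with he_def
  have he : e ∈ IsManifold.maximalAtlas (𝓡 (m + 1)) ∞ M := IsManifold.chart_mem_maximalAtlas _
  have hfe : f x ∈ e.source := mem_chart_source _ _
  set J := j ∘ e.symm with hJ
  set f' : Coord m → Coord (m + 1) := fun z => e (f (φ.symm z)) with hf'
  have hfc := h.smooth.continuous
  have hOu : IsOpen (f ⁻¹' (U ∩ e.source)) := (hdev.isOpen.inter e.open_source).preimage hfc
  have hO : IsOpen (e.target ∩ e.symm ⁻¹' U) := e.symm.isOpen_inter_preimage hdev.isOpen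
  have hO' : IsOpen (φ.target ∩ φ.symm ⁻¹' (f ⁻¹' (U ∩ e.source))) :=
    φ.symm.isOpen_inter_preimage hOu
  have hsm : ContDiffOn ℝ ∞ f' (φ.target ∩ φ.symm ⁻¹' (f ⁻¹' (U ∩ e.source))) := by
    rw [← contMDiffOn_iff_contDiffOn]
    exact (contMDiffOn_of_mem_maximalAtlas he).comp (h.smooth.comp_contMDiffOn
      ((contMDiffOn_symm_of_mem_maximalAtlas hφ).mono inter_subset_left)) fun y hy => hy.2.2
  have hφx := φ.left_inv hxφ
  have hmem : φ x ∈ φ.target ∩ φ.symm ⁻¹' (f ⁻¹' (U ∩ e.source)) :=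
    ⟨φ.map_source hxφ, by simpa only [mem_preimage, hφx] using ⟨hx, hfe⟩⟩
  have hf'x : f' (φ x) = e (f x) := by simp only [hf', hφx]
  have hfx : f' (φ x) ∈ e.target ∩ e.symm ⁻¹' U := by
    rw [hf'x]
    exact ⟨e.map_source hfe, by rwa [mem_preimage, e.left_inv hfe]⟩
  have hJf : (j ∘ f) ∘ φ.symm =ᶠ[𝓝 (φ x)] J ∘ f' := by
    refine Filter.mem_of_superset (hO'.mem_nhds hmem) fun y hy => ?_
    show j (f (φ.symm y)) = j (e.symm (e (f (φ.symm y))))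
    rw [e.left_inv hy.2.2]
  have hG : IsCoordMetric (chartMetric g e) (e.target ∩ e.symm ⁻¹' U) :=
    (hg.isCoordMetric he).mono hO inter_subset_left
  have hJd : ContDiffOn ℝ ∞ J (e.target ∩ e.symm ⁻¹' U) := hdev.smooth.contDiffOn_comp_symm he
  have hν : fderiv ℝ J (f' (φ x)) (mfderiv (𝓡 (m + 1)) (𝓡 (m + 1)) e (f x) (ν x) : Coord (m + 1))
      = developedNormal j f ν x := by
    rw [hf'x]
    exact fderiv_comp_symm_mfderiv he hfe (hdev.mdifferentiableAt hx) _
  have hmain := normal_fderiv_fderiv_comp hG hO' hJd hsm hdev.symm (fun y hy a a' => by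
    have hd := fderiv_comp_symm_eq_vectorDeriv hdev.isOpen hdev.smooth he hy.1 hy.2
    refine Eq.trans ?_ (congrArg₂ (fun b b' => B b b') (hd a) (hd a')).symm
    exact (hdev.isometry _ hy.2 _ _).symm) hmem hfx
    (mfderiv (𝓡 (m + 1)) (𝓡 (m + 1)) e (f x) (ν x) : Coord (m + 1)) u w
  rw [hν] at hmain
  rw [hJf.fderiv.fderiv_eq, hmain, hf'x]
  exact h.umbilical e he φ hφ x hxφ hfe u w

omit [IsManifold (𝓡 m) ∞ N] in
theorem IsUmbilicalHypersurface.mdifferentiableAt (h : IsUmbilicalHypersurface kind g f ν σ)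
    (x : N) : MDifferentiableAt (𝓡 m) (𝓡 (m + 1)) f x :=
  h.smooth.mdifferentiable (by simp) x

omit [IsManifold (𝓡 m) ∞ N] in
theorem IsUmbilicalHypersurface.isOpen_preimage (h : IsUmbilicalHypersurface kind g f ν σ)
    (hdev : IsDevelopment g lam B ε κ c d j U) : IsOpen (f ⁻¹' U) :=
  hdev.isOpen.preimage h.smooth.continuous

omit [IsManifold (𝓡 m) ∞ N] in
theorem IsUmbilicalHypersurface.contMDiffOn_comp (h : IsUmbilicalHypersurface kind g f ν σ)
    (hdev : IsDevelopment g lam B ε κ c d j U) :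
    ContMDiffOn (𝓡 m) 𝓘(ℝ, E) ∞ (j ∘ f) (f ⁻¹' U) :=
  hdev.smooth.comp (h.smooth.contMDiffOn (s := f ⁻¹' U)) fun _ hx => hx

omit [IsManifold (𝓡 m) ∞ N] in
theorem IsUmbilicalHypersurface.apply_vectorDeriv (h : IsUmbilicalHypersurface kind g f ν σ)
    (hdev : IsDevelopment g lam B ε κ c d j U) {x : N} (hx : f x ∈ U) (u w : Coord m) :
    B (vectorDeriv m (j ∘ f) x u) (vectorDeriv m (j ∘ f) x w) = inducedMetric (m := m) g f x u w := by
  rw [vectorDeriv_comp (hdev.mdifferentiableAt hx) (h.mdifferentiableAt x),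
    vectorDeriv_comp (hdev.mdifferentiableAt hx) (h.mdifferentiableAt x)]
  exact hdev.isometry _ hx _ _

omit [IsManifold (𝓡 m) ∞ N] in
theorem IsUmbilicalHypersurface.developedNormal_orthogonal
    (h : IsUmbilicalHypersurface kind g f ν σ)
    (hdev : IsDevelopment g lam B ε κ c d j U) {x : N} (hx : f x ∈ U) (u : Coord m) :
    B (developedNormal j f ν x) (vectorDeriv m (j ∘ f) x u) = 0 := by
  rw [vectorDeriv_comp (hdev.mdifferentiableAt hx) (h.mdifferentiableAt x)]
  exact (hdev.isometry _ hx _ _).trans (h.normal_orthogonal x u)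

omit [IsManifold (𝓡 m) ∞ N] in
theorem IsUmbilicalHypersurface.inducedMetric_nondegenerate
    (h : IsUmbilicalHypersurface kind g f ν σ) (hg : IsMetric kind g) {x : N} {u : Coord m}
    (hu : ∀ w : Coord m, inducedMetric (m := m) g f x u w = 0) : u = 0 :=
  (h.signature x).nondegenerate (fun _ _ => hg.symm _ _ _) hu

omit [IsManifold (𝓡 m) ∞ N] in
/-- The developed normal field satisfies the equation of Weingarten in every chart. -/
theorem IsUmbilicalHypersurface.fderiv_developedNormal (h : IsUmbilicalHypersurface kind g f ν σ)
    (hg : IsMetric kind g) (hdev : IsDevelopment g lam B ε κ c d j U)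
    {φ : OpenPartialHomeomorph N (Coord m)} (hφ : φ ∈ IsManifold.maximalAtlas (𝓡 m) ∞ N)
    {y : Coord m} (hy : y ∈ φ.target) (hyU : f (φ.symm y) ∈ U) (u : Coord m) :
    fderiv ℝ (developedNormal j f ν ∘ φ.symm) y u
      = -σ (φ.symm y) • fderiv ℝ ((j ∘ f) ∘ φ.symm) y u := by
  have := hdev.finiteDimensional
  have hO := h.isOpen_preimage hdev
  have hF := h.contMDiffOn_comp hdev
  have hη := contMDiffOn_developedNormal hdev.smooth hdev.isOpen h.normal_smooth
  have hd : ∀ z ∈ φ.target ∩ φ.symm ⁻¹' (f ⁻¹' U), ∀ u, fderiv ℝ ((j ∘ f) ∘ φ.symm) z u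
      = vectorDeriv m (j ∘ f) (φ.symm z) (mfderiv (𝓡 m) (𝓡 m) φ.symm z u : Coord m) :=
    fun z hz u => fderiv_comp_symm_eq_vectorDeriv hO hF hφ hz.1 hz.2 u
  have hq : ∀ x ∈ f ⁻¹' U, 2 * B c ((j ∘ f) x) + κ * B ((j ∘ f) x) ((j ∘ f) x) = d :=
    fun x hx => hdev.quadric _ hx
  have hξF : ∀ z ∈ φ.target ∩ φ.symm ⁻¹' (f ⁻¹' U), ∀ w,
      B (c + κ • ((j ∘ f) ∘ φ.symm) z) (fderiv ℝ ((j ∘ f) ∘ φ.symm) z w) = 0 := fun z hz w => by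
    rw [hd z hz]
    exact normal_orthogonal_of_quadric hdev.symm hO hq hz.2
      ((hF.contMDiffAt (hO.mem_nhds hz.2)).mdifferentiableAt (by simp)) _
  refine weingarten_of_umbilical (O := φ.target ∩ φ.symm ⁻¹' (f ⁻¹' U))
    (F := (j ∘ f) ∘ φ.symm) (η := developedNormal j f ν ∘ φ.symm) (c := c) (κ := κ) (ε := ε)
    hdev.finrank_eq (φ.symm.isOpen_inter_preimage hO) (hF.contDiffOn_comp_symm hφ)
    (hη.contDiffOn_comp_symm hφ) ⟨hy, hyU⟩ hdev.symm hdev.sign_ne_zero (fun u hu => ?_)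
    (normal_sq_of_quadric hdev.symm hdev.norm_eq (hq _ hyU)) (hξF y ⟨hy, hyU⟩)
    (fun z hz => ?_) (fun z hz => ?_) (fun z hz w => ?_) (fun u w => ?_) u
  · have hs := (mdifferentiable_of_mem_maximalAtlas hφ).symm.mfderiv_surjective hy
    have hi := (mdifferentiable_of_mem_maximalAtlas hφ).symm.mfderiv_injective hy
    refine (map_eq_zero_iff _ hi).1 (h.inducedMetric_nondegenerate (x := φ.symm y) hg fun w => ?_)
    obtain ⟨w, rfl⟩ := hs w
    exact (h.apply_vectorDeriv hdev hyU _ _).symm.trans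
      ((congrArg₂ (fun a b => B a b) (hd y ⟨hy, hyU⟩ u).symm (hd y ⟨hy, hyU⟩ w).symm).trans (hu w))
  · exact hdev.normal_orthogonal hz.2 _
  · exact (hdev.isometry _ hz.2 _ _).trans (h.normal_unit _)
  · rw [hd z hz]
    exact h.developedNormal_orthogonal hdev hz.2 _
  · have h1 := h.normal_fderiv_fderiv hg hdev hφ (φ.map_target hy) hyU u w
    rw [φ.right_inv hy] at h1
    exact h1.trans (congrArg (σ (φ.symm y) * ·) ((h.apply_vectorDeriv hdev hyU _ _).symm.trans
      (congrArg₂ (fun a b => B a b) (hd y ⟨hy, hyU⟩ u).symm (hd y ⟨hy, hyU⟩ w).symm)))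

/-- The principal curvature of an umbilical hypersurface of dimension at least two is locally
constant. -/
theorem IsUmbilicalHypersurface.eventually_eq (h : IsUmbilicalHypersurface kind g f ν σ)
    (hm : 2 ≤ m) (hg : IsMetric kind g) (hdev : IsDevelopment g lam B ε κ c d j U) {x : N}
    (hx : f x ∈ U) : ∀ᶠ y in 𝓝 x, σ y = σ x := by
  set φ := chartAt (Coord m) x with hφ_def
  have hφ : φ ∈ IsManifold.maximalAtlas (𝓡 m) ∞ N := IsManifold.chart_mem_maximalAtlas x
  have hxφ : x ∈ φ.source := mem_chart_source _ _
  have hO := h.isOpen_preimage hdev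
  have hF := h.contMDiffOn_comp hdev
  have hη := contMDiffOn_developedNormal hdev.smooth hdev.isOpen h.normal_smooth
  have h1 := eventually_eq_of_fderiv_eq_smul (F := (j ∘ f) ∘ φ.symm)
    (η := developedNormal j f ν ∘ φ.symm) (s := fun y => -σ (φ.symm y))
    (O := φ.target ∩ φ.symm ⁻¹' (f ⁻¹' U)) (y₀ := φ x)
    (by rw [finrank_euclideanSpace_fin]; exact hm)
    (φ.symm.isOpen_inter_preimage hO) (hF.contDiffOn_comp_symm hφ) (hη.contDiffOn_comp_symm hφ)
    (fun y hy => (injective_iff_map_eq_zero _).2 fun u hu => ?_)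
    (fun y hy => ContinuousLinearMap.ext fun u => h.fderiv_developedNormal hg hdev hφ hy.1 hy.2 u)
    ⟨φ.map_source hxφ, by simpa only [mem_preimage, φ.left_inv hxφ] using hx⟩
  · filter_upwards [(φ.continuousAt hxφ).eventually h1, φ.open_source.mem_nhds hxφ] with y hy hyφ
    simpa only [φ.left_inv hyφ, φ.left_inv hxφ, neg_inj] using hy
  · have hi := (mdifferentiable_of_mem_maximalAtlas hφ).symm.mfderiv_injective hy.1
    refine (map_eq_zero_iff _ hi).1 (h.inducedMetric_nondegenerate (x := φ.symm y) hg fun w => ?_)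
    have h2 := (fderiv_comp_symm_eq_vectorDeriv hO hF hφ hy.1 hy.2 u).symm.trans hu
    refine (h.apply_vectorDeriv hdev hy.2 _ w).symm.trans
      ((congrArg (fun a => B a _) h2).trans ?_)
    rw [map_zero, zero_apply]

/-- A development of the ambient manifold develops each umbilical hypersurface. -/
theorem IsUmbilicalHypersurface.isUmbilicalDevelopment (h : IsUmbilicalHypersurface kind g f ν σ)
    (hg : IsMetric kind g) (hdev : IsDevelopment g lam B ε κ c d j U) {s : ℝ} (hs : ∀ x, σ x = s) :
    IsUmbilicalDevelopment (inducedMetric (m := m) g f) B ε κ c d s (j ∘ f)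
      (developedNormal j f ν) (f ⁻¹' U) where
  isOpen := h.isOpen_preimage hdev
  finrank_eq := hdev.finrank_eq
  symm := hdev.symm
  sign := hdev.sign
  norm_eq := hdev.norm_eq
  smooth := h.contMDiffOn_comp hdev
  smooth_normal := contMDiffOn_developedNormal hdev.smooth hdev.isOpen h.normal_smooth
  isometry x hx u w := h.apply_vectorDeriv hdev hx u w
  quadric x hx := hdev.quadric _ hx
  normal_unit x hx := (hdev.isometry _ hx _ _).trans (h.normal_unit _)
  normal_orthogonal x hx u := h.developedNormal_orthogonal hdev hx u
  normal_tangent x hx := hdev.normal_orthogonal hx _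
  weingarten x hx u := by
    have hη := contMDiffOn_developedNormal hdev.smooth hdev.isOpen h.normal_smooth
    set φ := chartAt (Coord m) x with hφ_def
    have hφ : φ ∈ IsManifold.maximalAtlas (𝓡 m) ∞ N := IsManifold.chart_mem_maximalAtlas x
    have hxφ : x ∈ φ.source := mem_chart_source _ _
    have h1 := h.fderiv_developedNormal hg hdev hφ (φ.map_source hxφ)
      (by rwa [φ.left_inv hxφ]) (mfderiv (𝓡 m) (𝓡 m) φ x u : Coord m)
    rw [φ.left_inv hxφ, hs] at h1
    have h2 := fderiv_comp_symm_mfderiv hφ hxφ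
      (((h.contMDiffOn_comp hdev).contMDiffAt
        ((h.isOpen_preimage hdev).mem_nhds hx)).mdifferentiableAt (by simp)) u
    have h3 := fderiv_comp_symm_mfderiv hφ hxφ
      ((hη.contMDiffAt ((h.isOpen_preimage hdev).mem_nhds hx)).mdifferentiableAt (by simp)) u
    exact h3.symm.trans (h1.trans (congrArg (fun z : E => -s • z) h2))

/-- The principal curvature of a connected umbilical hypersurface of dimension at least two of a
manifold of constant curvature is constant. -/
theorem IsUmbilicalHypersurface.exists_eq_const [PreconnectedSpace N] [Nonempty N]
    (h : IsUmbilicalHypersurface kind g f ν σ) (hm : 2 ≤ m)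
    (hg : IsConstantCurvatureMetric kind lam g) : ∃ s : ℝ, ∀ x, σ x = s := by
  have h1 : IsLocallyConstant σ := (IsLocallyConstant.iff_eventually_eq σ).2 fun x => by
    obtain ⟨ε, κ, hε, hlam⟩ := exists_sign_mul_sq lam
    obtain ⟨B, c, d, j, U, hU, hdev⟩ := hg.exists_development hε hlam (f x)
    exact h.eventually_eq hm hg.toIsMetric hdev hU
  exact ⟨σ (Classical.arbitrary N), fun x => h1.apply_eq_of_preconnectedSpace _ _⟩

/-- The metrics homothetic to the induced metric have constant curvature. -/
theorem IsUmbilicalHypersurface.isConstantCurvatureMetric_smul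
    (h : IsUmbilicalHypersurface kind g f ν σ) (hg : IsConstantCurvatureMetric kind lam g) {s : ℝ}
    (hs : ∀ x, σ x = s) {r : ℝ} (hr : 0 < r) :
    IsConstantCurvatureMetric kind ((lam + s ^ 2) / r ^ 2)
      (r ^ 2 • inducedMetric (m := m) g f) := by
  obtain ⟨ε, κ, hε, hlam⟩ := exists_sign_mul_sq lam
  have hr2 : 0 < r ^ 2 := by positivity
  have hmetric : IsMetric kind (r ^ 2 • inducedMetric (m := m) g f) := by
    refine ⟨fun x u v => ?_, fun x => ?_, fun φ hφ y hy => ?_⟩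
    · exact congrArg (r ^ 2 * ·) (hg.symm _ _ _)
    · have h1 := h.signature x
      cases kind with
      | space => exact fun u hu => mul_pos hr2 (h1 u hu)
      | spacetime =>
        obtain ⟨e, he1, he2⟩ := h1
        refine ⟨e, mul_neg_of_pos_of_neg hr2 he1, fun u hu hne => mul_pos hr2 (he2 u ?_ hne)⟩
        exact (mul_eq_zero.1 hu).resolve_left hr2.ne'
    · obtain ⟨B, c, d, j, U, hU, hdev⟩ := hg.exists_development hε hlam (f (φ.symm y))
      have h1 := (h.isUmbilicalDevelopment hg.toIsMetric hdev hs).smul hr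
      exact ((h1.contDiffOn_chartMetric hφ).contDiffAt
        ((φ.symm.isOpen_inter_preimage h1.isOpen).mem_nhds ⟨hy, hU⟩)).contDiffWithinAt
  -- the development rescaled by `r` has the metric `r²` times the induced one
  refine ⟨hmetric, fun φ hφ y hy u v w => ?_⟩
  obtain ⟨B, c, d, j, U, hU, hdev⟩ := hg.exists_development hε hlam (f (φ.symm y))
  have h1 := (h.isUmbilicalDevelopment hg.toIsMetric hdev hs).smul hr
  rw [h1.curvature_eq hmetric hφ hy hU, hlam]
  congr 1
  field_simp

end Hypersurfaces

/-! ### Gaussian normal coordinates -/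

section Profiles

/-- The normal geodesics of a manifold of constant curvature `lam` have the profile functions
`s = S(t)`, `e = ∫ S`, where `S'' = -lam S`, `S(0) = 0`, `S'(0) = 1`; in particular
`S' = 1 - lam e`. -/
structure IsProfile (lam : ℝ) (s e : ℝ → ℝ) : Prop where
  smooth_s : ContDiff ℝ ∞ s
  smooth_e : ContDiff ℝ ∞ e
  hasDerivAt_s : ∀ t, HasDerivAt s (1 - lam * e t) t
  hasDerivAt_e : ∀ t, HasDerivAt e (s t) t
  sq_add : ∀ t, s t ^ 2 + lam * e t ^ 2 = 2 * e t
  s_zero : s 0 = 0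
  e_zero : e 0 = 0

/-- The warping functions solve `ρ'' = -lam ℓ² ρ`, with first integral `K`. -/
theorem IsWarping.exists_profile {lam ℓ K : ℝ} {ρ : ℝ → ℝ} (h : IsWarping lam ℓ ρ K) :
    ∃ s e : ℝ → ℝ, IsProfile lam s e ∧
      (∀ v v₀, ρ (v / ℓ) = ρ (v₀ / ℓ) * (1 - lam * e (v - v₀))
        + deriv ρ (v₀ / ℓ) / ℓ * s (v - v₀)) ∧
      ∀ χ, lam * ℓ ^ 2 * ρ χ ^ 2 + deriv ρ χ ^ 2 = K := by
  obtain ⟨hℓ, h⟩ := h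
  have hid : ∀ t : ℝ, HasDerivAt (fun t => t / ℓ) (1 / ℓ) t := fun t => (hasDerivAt_id t).div_const ℓ
  have hdiv : ∀ v v₀ : ℝ, v / ℓ = v₀ / ℓ + (v - v₀) / ℓ := fun v v₀ => by ring
  rcases h with ⟨rfl, h⟩ | ⟨hlam, rfl, rfl⟩ | ⟨hlam, h⟩
  · refine ⟨fun t => t, fun t => t ^ 2 / 2, ⟨contDiff_id, by fun_prop, fun t => ?_, fun t => ?_,
      fun t => by ring, rfl, by simp⟩, ?_, ?_⟩
    · exact (hasDerivAt_id' t).congr_deriv (by simp)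
    · refine ((hasDerivAt_pow 2 t).div_const 2).congr_deriv ?_
      simp
    · rcases h with ⟨rfl, rfl⟩ | ⟨rfl, rfl⟩
      · intro v v₀
        rw [deriv_id'']
        ring
      · intro v v₀
        simp
    · rcases h with ⟨rfl, rfl⟩ | ⟨rfl, rfl⟩
      · intro χ
        rw [deriv_id'']
        ring
      · intro χ
        simp
  · refine ⟨fun t => ℓ * Real.sin (t / ℓ), fun t => ℓ ^ 2 * (1 - Real.cos (t / ℓ)),
      ⟨by fun_prop, by fun_prop, fun t => ?_, fun t => ?_, fun t => ?_, by simp, by simp⟩, ?_, ?_⟩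
    · refine (((hid t).sin).const_mul ℓ).congr_deriv ?_
      rw [hlam]
      field_simp
      ring
    · refine ((((hid t).cos).const_sub 1).const_mul (ℓ ^ 2)).congr_deriv ?_
      field_simp
    · rw [hlam]
      field_simp
      linear_combination Real.sin_sq_add_cos_sq (t / ℓ)
    · intro v v₀
      rw [hdiv v v₀, Real.sin_add, Real.deriv_sin, hlam]
      field_simp
      ring
    · intro χ
      rw [Real.deriv_sin, hlam]
      field_simp
      exact Real.sin_sq_add_cos_sq χ
  · refine ⟨fun t => ℓ * Real.sinh (t / ℓ), fun t => ℓ ^ 2 * (Real.cosh (t / ℓ) - 1),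
      ⟨by fun_prop, by fun_prop, fun t => ?_, fun t => ?_, fun t => ?_, by simp, by simp⟩, ?_, ?_⟩
    · refine (((hid t).sinh).const_mul ℓ).congr_deriv ?_
      rw [hlam]
      field_simp
      ring
    · refine ((((hid t).cosh).sub_const 1).const_mul (ℓ ^ 2)).congr_deriv ?_
      field_simp
    · rw [hlam]
      field_simp
      linear_combination -Real.cosh_sq_sub_sinh_sq (t / ℓ)
    · intro v v₀
      rw [hdiv v v₀, hlam]
      rcases h with ⟨rfl, rfl⟩ | ⟨rfl, rfl⟩ | ⟨rfl, rfl⟩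
      · rw [Real.sinh_add, Real.deriv_sinh]
        field_simp
        ring
      · rw [Real.exp_add, Real.deriv_exp, ← Real.cosh_add_sinh ((v - v₀) / ℓ)]
        field_simp
        ring
      · rw [Real.cosh_add, Real.deriv_cosh]
        field_simp
        ring
    · intro χ
      rw [hlam]
      rcases h with ⟨rfl, rfl⟩ | ⟨rfl, rfl⟩ | ⟨rfl, rfl⟩
      · rw [Real.deriv_sinh]
        field_simp
        linear_combination Real.cosh_sq_sub_sinh_sq χ
      · rw [Real.deriv_exp]
        field_simp
        ring
      · rw [Real.deriv_cosh]
        field_simp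
        linear_combination -Real.cosh_sq_sub_sinh_sq χ

/-- Every value of `σ²` is the squared curvature of a slice of one of the line elements. -/
theorem exists_admissibleSlice (lam sigma : ℝ) : ∃ (ℓ : ℝ) (ρ : ℝ → ℝ) (K v₀ : ℝ),
    IsWarping lam ℓ ρ K ∧ IsAdmissibleSlice sigma ℓ ρ v₀ := by
  rcases lt_trichotomy lam 0 with hlam | rfl | hlam
  · obtain ⟨ℓ, hℓ, hl⟩ : ∃ ℓ : ℝ, 0 < ℓ ∧ lam = -1 / ℓ ^ 2 := by
      refine ⟨1 / √(-lam), one_div_pos.2 (Real.sqrt_pos.2 (neg_pos.2 hlam)), ?_⟩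
      rw [div_pow, Real.sq_sqrt (neg_pos.2 hlam).le]
      field_simp
    have hℓ2 : 0 < ℓ ^ 2 := by positivity
    rcases lt_trichotomy (sigma ^ 2 * ℓ ^ 2) 1 with h | h | h
    · have h1 : 0 < 1 - sigma ^ 2 * ℓ ^ 2 := by linarith
      have h2 : (sigma * ℓ / √(1 - sigma ^ 2 * ℓ ^ 2)) ^ 2
          = sigma ^ 2 * ℓ ^ 2 / (1 - sigma ^ 2 * ℓ ^ 2) := by
        rw [div_pow, Real.sq_sqrt h1.le, mul_pow]
      refine ⟨ℓ, Real.cosh, -1, ℓ * Real.arsinh (sigma * ℓ / √(1 - sigma ^ 2 * ℓ ^ 2)),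
        ⟨hℓ, Or.inr (Or.inr ⟨hl, Or.inr (Or.inr ⟨rfl, rfl⟩)⟩)⟩, (Real.cosh_pos _).ne', ?_⟩
      rw [Real.deriv_cosh, mul_div_cancel_left₀ _ hℓ.ne', Real.sinh_arsinh, div_pow, mul_pow,
        Real.cosh_sq, Real.sinh_arsinh, h2]
      field_simp
      ring
    · refine ⟨ℓ, Real.exp, 0, 0, ⟨hℓ, Or.inr (Or.inr ⟨hl, Or.inr (Or.inl ⟨rfl, rfl⟩)⟩)⟩,
        (Real.exp_pos _).ne', ?_⟩
      rw [Real.deriv_exp, zero_div, Real.exp_zero, mul_one, div_pow, one_pow,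
        div_eq_iff hℓ2.ne', h]
    · have h1 : 0 < sigma ^ 2 * ℓ ^ 2 - 1 := by linarith
      have h2 : (1 / √(sigma ^ 2 * ℓ ^ 2 - 1)) ^ 2 = 1 / (sigma ^ 2 * ℓ ^ 2 - 1) := by
        rw [div_pow, Real.sq_sqrt h1.le, one_pow]
      have h3 : 0 < 1 / √(sigma ^ 2 * ℓ ^ 2 - 1) := one_div_pos.2 (Real.sqrt_pos.2 h1)
      refine ⟨ℓ, Real.sinh, 1, ℓ * Real.arsinh (1 / √(sigma ^ 2 * ℓ ^ 2 - 1)),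
        ⟨hℓ, Or.inr (Or.inr ⟨hl, Or.inl ⟨rfl, rfl⟩⟩)⟩, ?_, ?_⟩
      · rw [mul_div_cancel_left₀ _ hℓ.ne', Real.sinh_arsinh]
        exact h3.ne'
      · rw [Real.deriv_sinh, mul_div_cancel_left₀ _ hℓ.ne', Real.sinh_arsinh, div_pow, mul_pow,
          Real.cosh_sq, Real.sinh_arsinh, h2]
        field_simp
        ring
  · by_cases hs : sigma = 0
    · exact ⟨1, fun _ => 1, 0, 0, ⟨one_pos, Or.inl ⟨rfl, Or.inr ⟨rfl, rfl⟩⟩⟩, one_ne_zero,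
        by simp [hs]⟩
    · refine ⟨1, fun χ => χ, 1, 1 / sigma, ⟨one_pos, Or.inl ⟨rfl, Or.inl ⟨rfl, rfl⟩⟩⟩,
        by simpa using hs, ?_⟩
      rw [deriv_id'']
      simp
  · obtain ⟨ℓ, hℓ, hl⟩ : ∃ ℓ : ℝ, 0 < ℓ ∧ lam = 1 / ℓ ^ 2 := by
      refine ⟨1 / √lam, one_div_pos.2 (Real.sqrt_pos.2 hlam), ?_⟩
      rw [div_pow, Real.sq_sqrt hlam.le]
      field_simp
    refine ⟨ℓ, Real.sin, 1, ℓ * (Real.pi / 2 - Real.arctan (sigma * ℓ)),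
      ⟨hℓ, Or.inr (Or.inl ⟨hl, rfl, rfl⟩)⟩, ?_, ?_⟩
    · rw [mul_div_cancel_left₀ _ hℓ.ne', Real.sin_pi_div_two_sub]
      exact (Real.cos_arctan_pos _).ne'
    · have h1 := (Real.cos_arctan_pos (sigma * ℓ)).ne'
      have h2 : Real.sin (Real.arctan (sigma * ℓ))
          = sigma * ℓ * Real.cos (Real.arctan (sigma * ℓ)) := by
        rw [← Real.tan_mul_cos h1, Real.tan_arctan]
      rw [mul_div_cancel_left₀ _ hℓ.ne', Real.deriv_sin, Real.sin_pi_div_two_sub,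
        Real.cos_pi_div_two_sub, h2]
      field_simp

end Profiles

section NormalTube

set_option maxSynthPendingDepth 3

variable {E : Type*} [NormedAddCommGroup E] [NormedSpace ℝ E]
  {B : E →L[ℝ] E →L[ℝ] ℝ} {ε κ : ℝ} {c : E} {d σ lam : ℝ} {s e : ℝ → ℝ}

/-- The point at distance `t` on the normal geodesic which starts at the point `F` of the quadric
`2 B(c, Y) + κ B(Y, Y) = d` in the direction `η`. -/
def normalPoint (ε κ : ℝ) (c : E) (s e : ℝ → ℝ) (t : ℝ) (F η : E) : E :=
  F + s t • η - (ε * κ * e t) • (c + κ • F)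

theorem normalPoint_zero (hs : IsProfile lam s e) (F η : E) : normalPoint ε κ c s e 0 F η = F := by
  simp [normalPoint, hs.s_zero, hs.e_zero]

theorem contDiff_normalPoint (hs : IsProfile lam s e) :
    ContDiff ℝ ∞ (fun z : ℝ × E × E => normalPoint ε κ c s e z.1 z.2.1 z.2.2) := by
  have h1 := hs.smooth_s
  have h2 := hs.smooth_e
  unfold normalPoint
  fun_prop

theorem hasFDerivAt_normalPoint (hs : IsProfile lam s e) (t : ℝ) (F η : E) :
    ∃ L : ℝ × E × E →L[ℝ] E, HasFDerivAt
      (fun z : ℝ × E × E => normalPoint ε κ c s e z.1 z.2.1 z.2.2) L (t, F, η) ∧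
      ∀ a u w, L (a, u, w) = u + s t • w - (ε * κ ^ 2 * e t) • u
        + a • ((1 - lam * e t) • η - (ε * κ * s t) • (c + κ • F)) := by
  have h1 : HasFDerivAt (fun z : ℝ × E × E => z.1) (ContinuousLinearMap.fst ℝ ℝ (E × E)) (t, F, η) :=
    hasFDerivAt_fst
  have hst := HasDerivAt.comp_hasFDerivAt (f := fun z : ℝ × E × E => z.1) (t, F, η)
    (hs.hasDerivAt_s t) h1
  have het := HasDerivAt.comp_hasFDerivAt (f := fun z : ℝ × E × E => z.1) (t, F, η)
    (hs.hasDerivAt_e t) h1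
  have hF : HasFDerivAt (fun z : ℝ × E × E => z.2.1)
      ((ContinuousLinearMap.fst ℝ E E).comp (ContinuousLinearMap.snd ℝ ℝ (E × E))) (t, F, η) :=
    ((ContinuousLinearMap.fst ℝ E E).comp (ContinuousLinearMap.snd ℝ ℝ (E × E))).hasFDerivAt
  have hη : HasFDerivAt (fun z : ℝ × E × E => z.2.2)
      ((ContinuousLinearMap.snd ℝ E E).comp (ContinuousLinearMap.snd ℝ ℝ (E × E))) (t, F, η) :=
    ((ContinuousLinearMap.snd ℝ E E).comp (ContinuousLinearMap.snd ℝ ℝ (E × E))).hasFDerivAt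
  refine ⟨_, (hF.add (hst.smul hη)).sub ((het.const_mul (ε * κ)).smul ((hF.const_smul κ).const_add c)),
    fun a u w => ?_⟩
  simp
  module

theorem normalPoint_mem_quadric (hB : ∀ a b, B a b = B b a) (hs : IsProfile lam s e)
    (hε : ε * ε = 1) (hlam : lam = ε * κ ^ 2) (hn : B c c + κ * d = ε) {F η : E}
    (hF : 2 * B c F + κ * B F F = d) (hη : B η η = 1) (hξη : B (c + κ • F) η = 0) (t : ℝ) :
    2 * B c (normalPoint ε κ c s e t F η)
      + κ * B (normalPoint ε κ c s e t F η) (normalPoint ε κ c s e t F η) = d := by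
  have hξ2 := normal_sq_of_quadric hB hn hF
  have hsq := hs.sq_add t
  set ξ := c + κ • F with hξ
  have hc : c = ξ - κ • F := by rw [hξ]; module
  have h1 : normalPoint ε κ c s e t F η = F + s t • η - (ε * κ * e t) • ξ := rfl
  rw [h1]
  rw [hc] at hF ⊢
  simp only [map_add, map_sub, map_smul, add_apply, sub_apply, smul_apply, smul_eq_mul, hξ2, hη,
    hξη, hB η ξ, hB F ξ, hB η F] at hF ⊢
  rw [hlam] at hsq
  linear_combination hF + κ * hsq + κ * ε * e t ^ 2 * κ ^ 2 * hε - 2 * κ * e t * hε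

end NormalTube

section NormalCoordinates

set_option maxSynthPendingDepth 3

variable {m : ℕ} {M : Type*} [TopologicalSpace M] [ChartedSpace (Coord (m + 1)) M]
  [IsManifold (𝓡 (m + 1)) ∞ M] {N : Type*} [TopologicalSpace N] [ChartedSpace (Coord m) N]
  [IsManifold (𝓡 m) ∞ N]
  {E : Type*} [NormedAddCommGroup E] [NormedSpace ℝ E]
  {g : BilinField (m + 1) M} {lam : ℝ} {B : E →L[ℝ] E →L[ℝ] ℝ} {ε κ : ℝ} {c : E} {d σ : ℝ}
  {j : M → E} {U : Set M} {kind : GeometryKind} {f : N → M} {b : BilinField m N} {F η : N → E}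
  {O : Set N} {s e : ℝ → ℝ}

omit [IsManifold (𝓡 m) ∞ N] in
/-- The derivative of the normal exponential map: its image is spanned by the velocity of the normal
geodesics and by the rescaled tangent space of the hypersurface. -/
theorem IsUmbilicalDevelopment.hasMFDerivAt_normalPoint
    (h : IsUmbilicalDevelopment b B ε κ c d σ F η O) (hlam : lam = ε * κ ^ 2)
    (hs : IsProfile lam s e) (v₀ : ℝ) {p : ℝ × N} (hp : p.2 ∈ O) :
    ∃ D : ℝ × Coord m →L[ℝ] E,
      HasMFDerivAt (𝓘(ℝ, ℝ).prod (𝓡 m)) 𝓘(ℝ, E)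
        (fun p : ℝ × N => normalPoint ε κ c s e (p.1 - v₀) (F p.2) (η p.2)) p D ∧
      ∀ a u, D (a, u) = a • ((1 - lam * e (p.1 - v₀)) • η p.2
          - (ε * κ * s (p.1 - v₀)) • (c + κ • F p.2))
        + (1 - lam * e (p.1 - v₀) - σ * s (p.1 - v₀)) • vectorDeriv m F p.2 u := by
  obtain ⟨L, hL, hL'⟩ := hasFDerivAt_normalPoint (ε := ε) (κ := κ) (c := c) hs (p.1 - v₀) (F p.2)
    (η p.2)
  have h1 : HasMFDerivAt (𝓘(ℝ, ℝ).prod (𝓡 m)) 𝓘(ℝ, ℝ) (fun p : ℝ × N => p.1 - v₀) p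
      (ContinuousLinearMap.fst ℝ ℝ (Coord m)) :=
    HasMFDerivAt.comp p ((hasFDerivAt_id p.1).sub_const v₀).hasMFDerivAt (hasMFDerivAt_fst p)
  have h2 : HasMFDerivAt (𝓘(ℝ, ℝ).prod (𝓡 m)) 𝓘(ℝ, E) (fun p : ℝ × N => F p.2) p
      ((vectorDeriv m F p.2).comp (ContinuousLinearMap.snd ℝ ℝ (Coord m))) :=
    HasMFDerivAt.comp p (h.mdifferentiableAt hp).hasMFDerivAt (hasMFDerivAt_snd p)
  have h3 : HasMFDerivAt (𝓘(ℝ, ℝ).prod (𝓡 m)) 𝓘(ℝ, E) (fun p : ℝ × N => η p.2) p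
      ((vectorDeriv m η p.2).comp (ContinuousLinearMap.snd ℝ ℝ (Coord m))) :=
    HasMFDerivAt.comp p (h.mdifferentiableAt_normal hp).hasMFDerivAt (hasMFDerivAt_snd p)
  have h4 : HasMFDerivAt (𝓘(ℝ, ℝ).prod (𝓡 m)) 𝓘(ℝ, ℝ × E × E)
      (fun p : ℝ × N => (p.1 - v₀, F p.2, η p.2)) p
      ((ContinuousLinearMap.fst ℝ ℝ (Coord m)).prod
        (((vectorDeriv m F p.2).comp (ContinuousLinearMap.snd ℝ ℝ (Coord m))).prod
          ((vectorDeriv m η p.2).comp (ContinuousLinearMap.snd ℝ ℝ (Coord m))))) :=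
    ⟨h1.1.prodMk (h2.1.prodMk h3.1), h1.2.prodMk (h2.2.prodMk h3.2)⟩
  refine ⟨L.comp _, HasMFDerivAt.comp p hL.hasMFDerivAt h4, fun a u => ?_⟩
  refine (hL' a (vectorDeriv m F p.2 u) (vectorDeriv m η p.2 u)).trans ?_
  rw [h.weingarten _ hp, hlam]
  module

/-- Gaussian normal coordinates along a developed umbilical hypersurface. -/
theorem IsUmbilicalDevelopment.exists_normal_coordinates
    (hdev : IsDevelopment g lam B ε κ c d j U) (hg : IsMetric kind g) (hf : Continuous f)
    (h : IsUmbilicalDevelopment b B ε κ c d σ (j ∘ f) η (f ⁻¹' U))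
    (hb : ∀ (x : N) (u : Coord m), (∀ w : Coord m, b x u w = 0) → u = 0) (hs : IsProfile lam s e)
    (v₀ : ℝ) {x₀ : N} (hx₀ : f x₀ ∈ U) :
    ∃ (δ : ℝ) (W : Set N) (Ψ : OpenPartialHomeomorph (ℝ × N) M), 0 < δ ∧ IsOpen W ∧ x₀ ∈ W ∧
      W ⊆ f ⁻¹' U ∧ Ψ.source = Ioo (v₀ - δ) (v₀ + δ) ×ˢ W ∧ Ψ.target ⊆ U ∧
      ContMDiffOn (𝓘(ℝ, ℝ).prod (𝓡 m)) (𝓡 (m + 1)) ∞ Ψ Ψ.source ∧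
      ContMDiffOn (𝓡 (m + 1)) (𝓘(ℝ, ℝ).prod (𝓡 m)) ∞ Ψ.symm Ψ.target ∧
      (∀ x ∈ W, Ψ (v₀, x) = f x) ∧
      (∀ p ∈ Ψ.source, j (Ψ p) = normalPoint ε κ c s e (p.1 - v₀) (j (f p.2)) (η p.2)) ∧
      ∀ p ∈ Ψ.source, ∀ (a a' : ℝ) (u w : TangentSpace (𝓡 m) p.2),
        g (Ψ p) (mfderiv (𝓘(ℝ, ℝ).prod (𝓡 m)) (𝓡 (m + 1)) Ψ p ((a, u) : ℝ × Coord m))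
          (mfderiv (𝓘(ℝ, ℝ).prod (𝓡 m)) (𝓡 (m + 1)) Ψ p ((a', w) : ℝ × Coord m))
        = a * a' + (1 - lam * e (p.1 - v₀) - σ * s (p.1 - v₀)) ^ 2 * b p.2 u w := by
  have := h.finiteDimensional
  obtain ⟨U', V, π, hxU', hU'U, hU'o, hπ⟩ := hdev.exists_inverse hg hx₀
  have hfU' : IsOpen (f ⁻¹' U') := hU'o.preimage hf
  -- the normal exponential map of the quadric, pulled back to the manifold by `π`
  set Y : ℝ × N → E := fun p => normalPoint ε κ c s e (p.1 - v₀) (j (f p.2)) (η p.2) with hY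
  have hYs : ContMDiffOn (𝓘(ℝ, ℝ).prod (𝓡 m)) 𝓘(ℝ, E) ∞ Y (univ ×ˢ (f ⁻¹' U)) := by
    have h1 : ContMDiffOn (𝓘(ℝ, ℝ).prod (𝓡 m)) 𝓘(ℝ, ℝ) ∞ (fun p : ℝ × N => p.1 - v₀)
        (univ ×ˢ (f ⁻¹' U)) := contMDiffOn_fst.sub contMDiffOn_const
    have h2 : ContMDiffOn (𝓘(ℝ, ℝ).prod (𝓡 m)) 𝓘(ℝ, E) ∞ (fun p : ℝ × N => j (f p.2))
        (univ ×ˢ (f ⁻¹' U)) := h.smooth.comp contMDiffOn_snd fun p hp => hp.2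
    have h3 : ContMDiffOn (𝓘(ℝ, ℝ).prod (𝓡 m)) 𝓘(ℝ, E) ∞ (fun p : ℝ × N => η p.2)
        (univ ×ˢ (f ⁻¹' U)) := h.smooth_normal.comp contMDiffOn_snd fun p hp => hp.2
    exact (contDiff_normalPoint hs).contMDiff.comp_contMDiffOn
      (h1.prodMk_space (h2.prodMk_space h3))
  have hYq : ∀ p : ℝ × N, p.2 ∈ f ⁻¹' U → 2 * B c (Y p) + κ * B (Y p) (Y p) = d := fun p hp =>
    normalPoint_mem_quadric h.symm hs h.sign hdev.curv h.norm_eq (h.quadric _ hp)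
      (h.normal_unit _ hp) (h.normal_tangent _ hp) _
  have hY0 : ∀ x, Y (v₀, x) = j (f x) := fun x => by
    simp only [hY, sub_self, normalPoint_zero hs]
  have hUo : IsOpen ((univ : Set ℝ) ×ˢ (f ⁻¹' U)) := isOpen_univ.prod h.isOpen
  set O : Set (ℝ × N) := ((univ ×ˢ (f ⁻¹' U)) ∩ Y ⁻¹' V) ∩ univ ×ˢ (f ⁻¹' U') with hO_def
  have hO : IsOpen O :=
    (hYs.continuousOn.isOpen_inter_preimage hUo hπ.isOpen).inter (isOpen_univ.prod hfU')
  have hOU : ∀ p ∈ O, p.2 ∈ f ⁻¹' U := fun p hp => hp.1.1.2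
  have hΨs : ContMDiffOn (𝓘(ℝ, ℝ).prod (𝓡 m)) (𝓡 (m + 1)) ∞ (π ∘ Y) O :=
    hπ.smooth.comp (hYs.mono fun p hp => hp.1.1) fun p hp => hp.1.2
  have hjπ : ∀ p ∈ O, j ((π ∘ Y) p) = Y p := fun p hp => hπ.right_inv _ hp.1.2 (hYq p (hOU p hp))
  have hπU : ∀ p ∈ O, (π ∘ Y) p ∈ U := fun p hp => hU'U (hπ.mapsTo_inv hp.1.2)
  have hπd : ∀ p ∈ O, MDifferentiableAt (𝓘(ℝ, ℝ).prod (𝓡 m)) (𝓡 (m + 1)) (π ∘ Y) p :=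
    fun p hp => (hΨs.contMDiffAt (hO.mem_nhds hp)).mdifferentiableAt (by simp)
  -- the composition with the isometric map `j` reveals the derivative
  have hder : ∀ p ∈ O, ∀ a u, (mfderiv (𝓡 (m + 1)) 𝓘(ℝ, E) j ((π ∘ Y) p)
      (mfderiv (𝓘(ℝ, ℝ).prod (𝓡 m)) (𝓡 (m + 1)) (π ∘ Y) p ((a, u) : ℝ × Coord m)) : E)
      = a • ((1 - lam * e (p.1 - v₀)) • η p.2
          - (ε * κ * s (p.1 - v₀)) • (c + κ • j (f p.2)))
        + (1 - lam * e (p.1 - v₀) - σ * s (p.1 - v₀)) • vectorDeriv m (j ∘ f) p.2 u := by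
    intro p hp a u
    obtain ⟨D, hD, hD'⟩ := h.hasMFDerivAt_normalPoint hdev.curv hs v₀ (hOU p hp)
    have h1 : j ∘ (π ∘ Y) =ᶠ[𝓝 p] Y := Filter.mem_of_superset (hO.mem_nhds hp) hjπ
    have h2 := mfderiv_comp p (hdev.mdifferentiableAt (hπU p hp)) (hπd p hp)
    have h3 : HasMFDerivAt (𝓘(ℝ, ℝ).prod (𝓡 m)) 𝓘(ℝ, E) (j ∘ (π ∘ Y)) p D :=
      HasMFDerivAt.congr_of_eventuallyEq hD h1
    exact (DFunLike.congr_fun (h2.symm.trans h3.mfderiv) ((a, u) : ℝ × Coord m)).trans (hD' a u)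
  have hmetric : ∀ p ∈ O, ∀ (a a' : ℝ) (u w : Coord m),
      g ((π ∘ Y) p)
        (mfderiv (𝓘(ℝ, ℝ).prod (𝓡 m)) (𝓡 (m + 1)) (π ∘ Y) p ((a, u) : ℝ × Coord m))
        (mfderiv (𝓘(ℝ, ℝ).prod (𝓡 m)) (𝓡 (m + 1)) (π ∘ Y) p ((a', w) : ℝ × Coord m))
        = a * a' + (1 - lam * e (p.1 - v₀) - σ * s (p.1 - v₀)) ^ 2 * b p.2 u w := by
    intro p hp a a' u w
    refine (hdev.isometry _ (hπU p hp) _ _).symm.trans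
      ((congrArg₂ (fun z z' => B z z') (hder p hp a u) (hder p hp a' w)).trans ?_)
    have hpU := hOU p hp
    have e1 : B (c + κ • j (f p.2)) (c + κ • j (f p.2)) = ε := h.quadric_sq hpU
    have e2 : B (c + κ • j (f p.2)) (η p.2) = 0 := h.normal_tangent _ hpU
    have e3 := h.normal_unit _ hpU
    have e4 := h.normal_orthogonal _ hpU
    have e5 : ∀ u, B (c + κ • j (f p.2)) (vectorDeriv m (j ∘ f) p.2 u) = 0 :=
      h.quadric_orthogonal hpU
    have e6 := h.isometry _ hpU u w
    have hsq := hs.sq_add (p.1 - v₀)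
    generalize c + κ • j (f p.2) = ξ at *
    generalize vectorDeriv m (j ∘ f) p.2 = D at *
    generalize η p.2 = η' at *
    have e2' : B η' ξ = 0 := by rw [h.symm, e2]
    have e4' : ∀ u, B (D u) η' = 0 := fun u => by rw [h.symm, e4]
    have e5' : ∀ u, B (D u) ξ = 0 := fun u => by rw [h.symm, e5]
    simp only [map_add, map_sub, map_smul, add_apply, sub_apply, smul_apply, smul_eq_mul, e1, e2,
      e3, e4, e5, e2', e4', e5']
    rw [← e6]
    have hl := hdev.curv
    linear_combination a * a' * ε * κ ^ 2 * s (p.1 - v₀) ^ 2 * h.sign + a * a' * lam * hsq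
      - a * a' * s (p.1 - v₀) ^ 2 * hl
  have hmem : (v₀, x₀) ∈ O :=
    ⟨⟨⟨mem_univ _, hx₀⟩, by rw [mem_preimage, hY0]; exact hπ.mapsTo hxU'⟩, mem_univ _, hxU'⟩
  have hinj : Function.Injective (mfderiv (𝓘(ℝ, ℝ).prod (𝓡 m)) (𝓡 (m + 1)) (π ∘ Y) (v₀, x₀)) := by
    refine (injective_iff_map_eq_zero (_ : ℝ × Coord m →L[ℝ] Coord (m + 1))).2 fun z hz => ?_
    obtain ⟨a, u⟩ := z
    have h1 : ∀ a' w, a * a' + (1 - lam * e 0 - σ * s 0) ^ 2 * b x₀ u w = 0 := fun a' w => by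
      have h2 := hmetric _ hmem a a' u w
      rw [sub_self] at h2
      refine h2.symm.trans ?_
      refine (congrArg (fun z : Coord (m + 1) => (g ((π ∘ Y) (v₀, x₀)) :
        Coord (m + 1) →L[ℝ] Coord (m + 1) →L[ℝ] ℝ) z _) hz).trans ?_
      exact DFunLike.congr_fun (map_zero (g ((π ∘ Y) (v₀, x₀)) :
        Coord (m + 1) →L[ℝ] Coord (m + 1) →L[ℝ] ℝ)) _
    rw [hs.e_zero, hs.s_zero] at h1
    have ha : a = 0 := by simpa using h1 1 0
    have hu : u = 0 := hb x₀ u fun w => by simpa using h1 0 w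
    rw [ha, hu]
    rfl
  obtain ⟨P, hP1, hP2, hP3, hP4⟩ := exists_openPartialHomeomorph_of_mfderiv_injective hO hΨs hmem
    hinj (by rw [Module.finrank_prod, Module.finrank_self, finrank_euclideanSpace_fin,
      finrank_euclideanSpace_fin, add_comm])
  obtain ⟨I', W, hI', hW, hvI', hxW, hsub⟩ := isOpen_prod_iff.1 P.open_source v₀ x₀ hP1
  obtain ⟨δ, hδ, hball⟩ := Metric.isOpen_iff.1 hI' v₀ hvI'
  rw [Real.ball_eq_Ioo] at hball
  have hsub' : Ioo (v₀ - δ) (v₀ + δ) ×ˢ W ⊆ P.source := (prod_mono hball le_rfl).trans hsub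
  set Ψ := P.restrOpen _ (isOpen_Ioo.prod hW) with hΨ
  have hsrc : Ψ.source = Ioo (v₀ - δ) (v₀ + δ) ×ˢ W := by
    rw [hΨ, OpenPartialHomeomorph.restrOpen_source, inter_eq_right.2 hsub']
  have hv₀ : v₀ ∈ Ioo (v₀ - δ) (v₀ + δ) := ⟨by linarith, by linarith⟩
  have hsO : Ψ.source ⊆ O := fun p hp => hP2 hp.1
  have hΨe : EqOn Ψ (π ∘ Y) Ψ.source := fun p hp => hP3 hp.1
  refine ⟨δ, W, Ψ, hδ, hW, hxW, fun x hx => ?_, hsrc, ?_, ?_, ?_, fun x hx => ?_, fun p hp => ?_,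
    fun p hp a a' u w => ?_⟩
  · exact hOU (v₀, x) (hP2 (hsub' ⟨hv₀, hx⟩))
  · intro q hq
    have h1 := hsO (Ψ.map_target hq)
    have h2 := hπU _ h1
    rwa [← hΨe (Ψ.map_target hq), Ψ.right_inv hq] at h2
  · exact (hΨs.mono hsO).congr hΨe
  · exact hP4.mono fun q hq => hq.1
  · have h1 : (v₀, x) ∈ Ψ.source := by rw [hsrc]; exact ⟨hv₀, hx⟩
    rw [hΨe h1]
    show π (Y (v₀, x)) = f x
    rw [hY0]
    exact hπ.left_inv _ (hsO h1).2.2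
  · rw [hΨe hp]
    exact hjπ p (hsO hp)
  · have h1 : Ψ =ᶠ[𝓝 p] π ∘ Y := Filter.mem_of_superset (Ψ.open_source.mem_nhds hp) hΨe
    rw [h1.mfderiv_eq, hΨe hp]
    exact hmetric p (hsO hp) a a' u w

end NormalCoordinates

section WarpedNormalForm

variable {m : ℕ} {M : Type*} [TopologicalSpace M] [ChartedSpace (Coord (m + 1)) M]
  [IsManifold (𝓡 (m + 1)) ∞ M] {N : Type*} [TopologicalSpace N] [ChartedSpace (Coord m) N]
  [IsManifold (𝓡 m) ∞ N]
  {g : BilinField (m + 1) M} {lam : ℝ} {kind : GeometryKind} {f : N → M}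
  {ν : ∀ x : N, TangentSpace (𝓡 (m + 1)) (f x)} {σ : N → ℝ}

/-- The Gaussian normal form of the metric along an umbilical hypersurface. The slice metric is
homothetic to the induced one, and the sign of the normal is chosen so that the principal curvature
is that of the slice. -/
theorem IsUmbilicalHypersurface.exists_warpedNormalForm
    (h : IsUmbilicalHypersurface kind g f ν σ) (hg : IsConstantCurvatureMetric kind lam g) {s : ℝ}
    (hs : ∀ x, σ x = s) {ℓ K v₀ : ℝ} {ρ : ℝ → ℝ} (hw : IsWarping lam ℓ ρ K)
    (ha : IsAdmissibleSlice s ℓ ρ v₀) :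
    ∃ γ : BilinField m N, IsConstantCurvatureMetric kind K γ ∧
      HasWarpedNormalForm g f ℓ ρ v₀ γ := by
  obtain ⟨S, e, hprof, hρ, hK⟩ := hw.exists_profile
  obtain ⟨hρ0, hsq⟩ := ha
  have hℓ : 0 < ℓ := hw.1
  have hne : ℓ * ρ (v₀ / ℓ) ≠ 0 := mul_ne_zero hℓ.ne' hρ0
  set k := deriv ρ (v₀ / ℓ) / (ℓ * ρ (v₀ / ℓ)) with hk
  have hr : 0 < |ℓ * ρ (v₀ / ℓ)|⁻¹ := inv_pos.2 (abs_pos.2 hne)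
  have hr2 : (|ℓ * ρ (v₀ / ℓ)|⁻¹) ^ 2 = ((ℓ * ρ (v₀ / ℓ)) ^ 2)⁻¹ := by rw [inv_pow, sq_abs]
  refine ⟨(|ℓ * ρ (v₀ / ℓ)|⁻¹) ^ 2 • inducedMetric (m := m) g f, ?_, fun x₀ => ?_⟩
  · have h1 := h.isConstantCurvatureMetric_smul hg hs hr
    have h2 : (lam + s ^ 2) / (|ℓ * ρ (v₀ / ℓ)|⁻¹) ^ 2 = K := by
      rw [hr2, div_inv_eq_mul, ← hsq, hk, ← hK (v₀ / ℓ)]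
      field_simp
    rwa [h2] at h1
  · obtain ⟨ε, κ, hε, hlam⟩ := exists_sign_mul_sq lam
    obtain ⟨B, c, d, j, U, hU, hdev⟩ := hg.exists_development hε hlam (f x₀)
    have h1 := h.isUmbilicalDevelopment hg.toIsMetric hdev hs
    -- for the normal pointing towards growing `v`, the slice of the line element satisfies
    -- `dη = k dF`, so its principal curvature in the convention `dη = -σ dF` is `-k`
    obtain ⟨η, h2⟩ : ∃ η, IsUmbilicalDevelopment (inducedMetric (m := m) g f) B ε κ c d (-k)
        (j ∘ f) η (f ⁻¹' U) := by
      rcases sq_eq_sq_iff_eq_or_eq_neg.1 hsq.symm with h3 | h3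
      · exact ⟨_, h3 ▸ h1.neg⟩
      · exact ⟨_, h3 ▸ h1⟩
    obtain ⟨δ, W, Ψ, hδ, hW, hx₀, -, hsrc, -, hsm, hsm', hΨ, -, hmet⟩ :=
      h2.exists_normal_coordinates hdev hg.toIsMetric h.smooth.continuous
        (fun x u hu => h.inducedMetric_nondegenerate (x := x) hg.toIsMetric hu) hprof v₀ hU
    refine ⟨δ, W, Ψ, hδ, hW, hx₀, hsrc, hsm, hsm', hΨ, fun p hp a b u w => ?_⟩
    rw [hmet p hp a b u w, hρ p.1 v₀]
    have h3 : ((|ℓ * ρ (v₀ / ℓ)|⁻¹) ^ 2 • inducedMetric (m := m) g f) p.2 u w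
        = ((ℓ * ρ (v₀ / ℓ)) ^ 2)⁻¹ * inducedMetric (m := m) g f p.2 u w := by
      rw [← hr2]
      rfl
    rw [h3, hk]
    field_simp
    ring

end WarpedNormalForm

/-! ### The equation of the hypersurface -/

section SliceFunction

set_option maxSynthPendingDepth 3

variable {m : ℕ} {N : Type*} [TopologicalSpace N] [ChartedSpace (Coord m) N]
  {E : Type*} [NormedAddCommGroup E] [NormedSpace ℝ E]
  {B : E →L[ℝ] E →L[ℝ] ℝ} {ε κ : ℝ} {c : E} {d σ lam : ℝ} {s e : ℝ → ℝ}
  {b : BilinField m N} {F η : N → E} {O : Set N}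

/-- A function whose zero set in the quadric is the umbilical hypersurface of principal curvature `σ`
through the point `F` with the unit normal `η` there: the section of the quadric by a hyperplane, or
by a hypersphere if the quadric is flat. -/
noncomputable def sliceFunction (B : E →L[ℝ] E →L[ℝ] ℝ) (σ : ℝ) (F η Y : E) : ℝ :=
  2 * B η (Y - F) - σ * B (Y - F) (Y - F)

theorem sliceFunction_self (B : E →L[ℝ] E →L[ℝ] ℝ) (σ : ℝ) (F η : E) :
    sliceFunction B σ F η F = 0 := by
  simp [sliceFunction]

theorem sliceFunction_eq (hB : ∀ a b, B a b = B b a) (F η Y : E) :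
    sliceFunction B σ F η Y = 2 * B (η + σ • F) Y - σ * B Y Y - (2 * B η F + σ * B F F) := by
  simp only [sliceFunction, map_sub, map_add, map_smul, sub_apply, add_apply, smul_apply,
    smul_eq_mul, hB Y F]
  ring

theorem sliceFunction_normalPoint (hB : ∀ a b, B a b = B b a) (hs : IsProfile lam s e)
    (hε : ε * ε = 1) (hlam : lam = ε * κ ^ 2) {F η : E}
    (hξ : B (c + κ • F) (c + κ • F) = ε) (hη : B η η = 1) (hξη : B (c + κ • F) η = 0) (t : ℝ) :
    sliceFunction B σ F η (normalPoint ε κ c s e t F η) = 2 * (s t - σ * e t) := by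
  have h1 : normalPoint ε κ c s e t F η - F = s t • η - (ε * κ * e t) • (c + κ • F) := by
    rw [normalPoint]
    module
  have hsq := hs.sq_add t
  rw [sliceFunction, h1]
  generalize c + κ • F = ξ at *
  simp only [map_sub, map_smul, sub_apply, smul_apply, smul_eq_mul, hξ, hη, hξη, hB η ξ]
  linear_combination -σ * hsq + σ * e t ^ 2 * hlam - σ * ε * κ ^ 2 * e t ^ 2 * hε

theorem eventually_eq_of_vectorDeriv_eq_zero [IsManifold (𝓡 m) ∞ N] (hO : IsOpen O)
    (hF : ContMDiffOn (𝓡 m) 𝓘(ℝ, E) ∞ F O) (h0 : ∀ x ∈ O, vectorDeriv m F x = 0) {x₀ : N}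
    (hx₀ : x₀ ∈ O) : ∀ᶠ x in 𝓝 x₀, F x = F x₀ := by
  set φ := chartAt (Coord m) x₀ with hφ_def
  have hφ : φ ∈ IsManifold.maximalAtlas (𝓡 m) ∞ N := IsManifold.chart_mem_maximalAtlas x₀
  have hxφ : x₀ ∈ φ.source := mem_chart_source _ _
  have hO' : IsOpen (φ.target ∩ φ.symm ⁻¹' O) := φ.symm.isOpen_inter_preimage hO
  have hmem : φ x₀ ∈ φ.target ∩ φ.symm ⁻¹' O :=
    ⟨φ.map_source hxφ, by rwa [mem_preimage, φ.left_inv hxφ]⟩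
  obtain ⟨r, hr, hball⟩ := Metric.isOpen_iff.1 hO' _ hmem
  have hd : DifferentiableOn ℝ (F ∘ φ.symm) (Metric.ball (φ x₀) r) :=
    ((hF.contDiffOn_comp_symm hφ).mono hball).differentiableOn (by simp)
  have h1 : ∀ y ∈ Metric.ball (φ x₀) r, (F ∘ φ.symm) y = (F ∘ φ.symm) (φ x₀) := fun y hy =>
    Metric.isOpen_ball.is_const_of_fderiv_eq_zero (convex_ball _ _).isPreconnected hd
      (fun z hz => by
        ext u
        rw [fderiv_comp_symm_eq_vectorDeriv hO hF hφ (hball hz).1 (hball hz).2,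
          h0 _ (hball hz).2]
        rfl) hy (Metric.mem_ball_self hr)
  filter_upwards [φ.open_source.mem_nhds hxφ,
    (φ.continuousAt hxφ) (Metric.ball_mem_nhds _ hr)] with x hx hx'
  simpa [φ.left_inv hx, φ.left_inv hxφ] using h1 (φ x) hx'

/-- The equation of a developed umbilical hypersurface does not depend on the base point. -/
theorem IsUmbilicalDevelopment.eventually_sliceFunction_eq [IsManifold (𝓡 m) ∞ N]
    (h : IsUmbilicalDevelopment b B ε κ c d σ F η O) {x₀ : N} (hx₀ : x₀ ∈ O) :
    ∀ᶠ x in 𝓝 x₀, ∀ Y, sliceFunction B σ (F x) (η x) Y = sliceFunction B σ (F x₀) (η x₀) Y := by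
  -- the coefficients of the equation `sliceFunction_eq` have derivative zero
  set ζ : N → E × ℝ := fun x =>
    (η x + σ • F x, 2 * B (η x) (F x) + σ * B (F x) (F x)) with hζ
  have hF := h.smooth
  have hη := h.smooth_normal
  set G : E × E → E × ℝ := fun z => (z.2 + σ • z.1, 2 * B z.2 z.1 + σ * B z.1 z.1) with hG
  have hGs : ContDiff ℝ ∞ G := by
    rw [hG]
    have hb : ∀ a a' : E × E → E, ContDiff ℝ ∞ a → ContDiff ℝ ∞ a' →
        ContDiff ℝ ∞ (fun z => B (a z) (a' z)) := fun a a' ha ha' =>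
      (B.contDiff.comp ha).clm_apply ha'
    have h1 := hb _ _ contDiff_snd contDiff_fst
    have h2 := hb _ _ contDiff_fst contDiff_fst
    fun_prop
  have hζs : ContMDiffOn (𝓡 m) 𝓘(ℝ, E × ℝ) ∞ ζ O :=
    hGs.contMDiff.comp_contMDiffOn (hF.prodMk_space hη)
  have hζ0 : ∀ x ∈ O, vectorDeriv m ζ x = 0 := by
    intro x hx
    let L : E × E →L[ℝ] E × ℝ := ((ContinuousLinearMap.snd ℝ E E)
        + σ • ContinuousLinearMap.fst ℝ E E).prod
        ((2 : ℝ) • ((B (η x)).comp (ContinuousLinearMap.fst ℝ E E)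
          + (B.flip (F x)).comp (ContinuousLinearMap.snd ℝ E E))
        + σ • ((B (F x)).comp (ContinuousLinearMap.fst ℝ E E)
          + (B.flip (F x)).comp (ContinuousLinearMap.fst ℝ E E)))
    have h1 : HasFDerivAt G L (F x, η x) := by
      have hf : HasFDerivAt (fun z : E × E => z.1) (ContinuousLinearMap.fst ℝ E E) (F x, η x) :=
        hasFDerivAt_fst
      have hs : HasFDerivAt (fun z : E × E => z.2) (ContinuousLinearMap.snd ℝ E E) (F x, η x) :=
        hasFDerivAt_snd
      refine ((hs.add (hf.const_smul σ)).prodMk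
        (((B.hasFDerivAt_of_bilinear hs hf).const_mul 2).add
          ((B.hasFDerivAt_of_bilinear hf hf).const_mul σ))).congr_fderiv ?_
      ext <;> simp [L]
    have h2 : HasMFDerivAt (𝓡 m) 𝓘(ℝ, E × E) (fun x => (F x, η x)) x
        ((vectorDeriv m F x).prod (vectorDeriv m η x)) :=
      ⟨(h.mdifferentiableAt hx).hasMFDerivAt.1.prodMk (h.mdifferentiableAt_normal hx).hasMFDerivAt.1,
        (h.mdifferentiableAt hx).hasMFDerivAt.2.prodMk
          (h.mdifferentiableAt_normal hx).hasMFDerivAt.2⟩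
    have h3 : vectorDeriv m ζ x = L.comp ((vectorDeriv m F x).prod (vectorDeriv m η x)) :=
      (HasMFDerivAt.comp (g := G) x h1.hasMFDerivAt h2).mfderiv
    rw [h3]
    ext u
    · show vectorDeriv m η x u + σ • vectorDeriv m F x u = 0
      rw [h.weingarten x hx]
      module
    · show 2 * (B (η x) (vectorDeriv m F x u) + B (vectorDeriv m η x u) (F x))
        + σ * (B (F x) (vectorDeriv m F x u) + B (vectorDeriv m F x u) (F x)) = 0
      rw [h.weingarten x hx, h.normal_orthogonal x hx, h.symm (F x), map_smul, smul_apply,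
        smul_eq_mul]
      ring
  filter_upwards [eventually_eq_of_vectorDeriv_eq_zero h.isOpen hζs hζ0 hx₀] with x hx Y
  rw [sliceFunction_eq h.symm, sliceFunction_eq h.symm]
  have h1 := congrArg Prod.fst hx
  have h2 := congrArg Prod.snd hx
  simp only [hζ] at h1 h2
  rw [h1, h2]

end SliceFunction

section Slices

variable {m : ℕ} {M : Type*} [TopologicalSpace M] [ChartedSpace (Coord (m + 1)) M]
  [IsManifold (𝓡 (m + 1)) ∞ M] {N : Type*} [TopologicalSpace N] [ChartedSpace (Coord m) N]
  [IsManifold (𝓡 m) ∞ N]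
  {E : Type*} [NormedAddCommGroup E] [NormedSpace ℝ E]
  {g : BilinField (m + 1) M} {lam : ℝ} {B : E →L[ℝ] E →L[ℝ] ℝ} {ε κ : ℝ} {c : E} {d σ : ℝ}
  {j : M → E} {U : Set M} {kind : GeometryKind} {f : N → M} {b : BilinField m N} {η : N → E}

/-- Near each of its points, an umbilical hypersurface is the zero set of its slice function: in
Gaussian normal coordinates the latter depends on the distance only, with nonzero derivative. -/
theorem IsUmbilicalDevelopment.exists_isOpen_image_eq
    (hdev : IsDevelopment g lam B ε κ c d j U) (hg : IsMetric kind g) (hf : Continuous f)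
    (h : IsUmbilicalDevelopment b B ε κ c d σ (j ∘ f) η (f ⁻¹' U))
    (hb : ∀ (x : N) (u : Coord m), (∀ w : Coord m, b x u w = 0) → u = 0) {x₀ : N}
    (hx₀ : f x₀ ∈ U) :
    ∃ (O : Set M) (W : Set N), IsOpen O ∧ O ⊆ U ∧ IsOpen W ∧ x₀ ∈ W ∧
      f '' W = {q | q ∈ O ∧ sliceFunction B σ (j (f x₀)) (η x₀) (j q) = 0} := by
  -- only the profile functions of curvature `lam` are taken from the line element
  obtain ⟨ℓ, ρ, K, v₀, hw, -⟩ := exists_admissibleSlice lam 0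
  obtain ⟨s, e, hs, -⟩ := hw.exists_profile
  obtain ⟨δ, W, Ψ, hδ, hW, hxW, hWU, hsrc, htU, -, -, hΨ, hj, -⟩ :=
    h.exists_normal_coordinates hdev hg hf hb hs 0 hx₀
  have hd : HasDerivAt (fun t => s t - σ * e t) (1 - lam * e 0 - σ * s 0) 0 :=
    (hs.hasDerivAt_s 0).sub ((hs.hasDerivAt_e 0).const_mul σ)
  have hne := hd.eventually_ne (c := 0) (by simp [hs.e_zero, hs.s_zero])
  rw [eventually_nhdsWithin_iff, Metric.eventually_nhds_iff_ball] at hne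
  obtain ⟨δ', hδ', hne⟩ := hne
  obtain ⟨W₀, hW₀, hW₀o, hxW₀⟩ := eventually_nhds_iff.1
    (h.eventually_sliceFunction_eq hx₀)
  have hsub : (Ioo (0 - δ) (0 + δ) ∩ Metric.ball 0 δ') ×ˢ (W ∩ W₀) ⊆ Ψ.source := by
    rw [hsrc]
    exact prod_mono inter_subset_left inter_subset_left
  have h0 : (0 : ℝ) ∈ Ioo (0 - δ) (0 + δ) ∩ Metric.ball 0 δ' :=
    ⟨⟨by linarith, by linarith⟩, Metric.mem_ball_self hδ'⟩
  refine ⟨Ψ '' ((Ioo (0 - δ) (0 + δ) ∩ Metric.ball 0 δ') ×ˢ (W ∩ W₀)), W ∩ W₀,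
    Ψ.isOpen_image_of_subset_source ((isOpen_Ioo.inter Metric.isOpen_ball).prod (hW.inter hW₀o)) hsub,
    ?_, hW.inter hW₀o, ⟨hxW, hxW₀⟩, Subset.antisymm ?_ ?_⟩
  · rintro _ ⟨p, hp, rfl⟩
    exact htU (Ψ.map_source (hsub hp))
  · rintro _ ⟨x, hx, rfl⟩
    refine ⟨⟨(0, x), ⟨h0, hx⟩, hΨ x hx.1⟩, ?_⟩
    rw [← show sliceFunction B σ (j (f x)) (η x) (j (f x))
      = sliceFunction B σ (j (f x₀)) (η x₀) (j (f x)) from hW₀ x hx.2 _]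
    exact sliceFunction_self _ _ _ _
  · rintro _ ⟨⟨⟨t, x⟩, hp, rfl⟩, hq⟩
    have hx : f x ∈ U := hWU hp.2.1
    rw [← show sliceFunction B σ (j (f x)) (η x) (j (Ψ (t, x)))
      = sliceFunction B σ (j (f x₀)) (η x₀) (j (Ψ (t, x))) from hW₀ x hp.2.2 _, hj _ (hsub hp),
      sub_zero] at hq
    replace hq := (sliceFunction_normalPoint h.symm hs h.sign hdev.curv (h.quadric_sq hx)
      (h.normal_unit _ hx) (h.normal_tangent _ hx) t).symm.trans hq
    have ht : t = 0 := by
      by_contra hne'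
      exact hne t hp.1.2 hne' (by linarith)
    refine ⟨x, hp.2, ?_⟩
    rw [ht, hΨ x hp.2.1]

end Slices

/-! ### Normal forms of scalar products -/

section ScalarProducts

/-- The number of negative directions of a metric of the given kind. -/
def GeometryKind.index : GeometryKind → ℕ
  | GeometryKind.space => 0
  | GeometryKind.spacetime => 1

/-- The sign of the `i`-th coordinate in the standard scalar product of the given kind. -/
def GeometryKind.sign (kind : GeometryKind) (i : ℕ) : ℝ := if i < kind.index then -1 else 1

variable {V : Type*} [AddCommGroup V] [Module ℝ V] {kind : GeometryKind}

/-- Two vectors of negative square in a Lorentzian scalar product are not orthogonal. -/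
theorem HasSignature.apply_ne_zero {b : V →ₗ[ℝ] V →ₗ[ℝ] ℝ} (hb : ∀ u v, b u v = b v u)
    (h : HasSignature GeometryKind.spacetime (fun u v => b u v)) {x y : V} (hx : b x x < 0)
    (hy : b y y < 0) : b x y ≠ 0 := by
  intro hxy
  obtain ⟨e, -, he2⟩ := h
  have hex : b e x ≠ 0 := fun h0 => (he2 x h0 (by rintro rfl; simp at hx)).not_gt hx
  -- a combination orthogonal to the distinguished vector
  set z := b e y • x - b e x • y with hz
  have h1 : b e z = 0 := by
    simp only [hz, map_sub, map_smul, smul_eq_mul]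
    ring
  have h2 : b z z = b e y ^ 2 * b x x + b e x ^ 2 * b y y := by
    simp only [hz, map_sub, map_smul, LinearMap.sub_apply, LinearMap.smul_apply, smul_eq_mul, hxy,
      hb y x]
    ring
  have h3 : b z z < 0 := by
    rw [h2]
    have := mul_neg_of_pos_of_neg (pow_pos (abs_pos.2 hex) 2) hy
    rw [sq_abs] at this
    nlinarith [sq_nonneg (b e y)]
  exact (he2 z h1 (by rintro h0; simp [h0] at h3)).not_gt h3

/-- Sylvester's law of inertia for the scalar products of the two kinds. -/
theorem HasSignature.exists_equiv [FiniteDimensional ℝ V] {m : ℕ}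
    (hV : Module.finrank ℝ V = m) {b : V →ₗ[ℝ] V →ₗ[ℝ] ℝ} (hb : ∀ u v, b u v = b v u)
    (h : HasSignature kind (fun u v => b u v)) :
    ∃ L : (Fin m → ℝ) ≃ₗ[ℝ] V, ∀ x y, b (L x) (L y) = ∑ i : Fin m, kind.sign i * (x i * y i) := by
  subst hV
  set Q : QuadraticForm ℝ V := LinearMap.BilinMap.toQuadraticMap b with hQ
  have hQa : ∀ u, Q u = b u u := fun u => rfl
  have hassoc : ∀ u v, QuadraticMap.associated (R := ℝ) Q u v = b u v := fun u v => by
    rw [QuadraticMap.associated_apply]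
    simp only [hQa, map_add, LinearMap.add_apply, hb v u]
    simp
    ring
  -- diagonalize with entries `w i = ± 1`
  obtain ⟨w, hw, ⟨L₀⟩⟩ := QuadraticForm.equivalent_one_neg_one_weighted_sum_squared Q
    fun u hu => h.nondegenerate hb fun v => by rw [← hassoc, hu]
  have hL₀ : ∀ x, Q (L₀.symm x) = ∑ i, w i * (x i * x i) := fun x => by
    rw [← L₀.map_app, QuadraticMap.weightedSumSquares_apply]
    simp
  have hbL : ∀ x y, b (L₀.symm x) (L₀.symm y) = ∑ i, w i * (x i * y i) := fun x y => by
    have h1 := hL₀ (x + y)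
    have h2 : L₀.symm (x + y) = L₀.symm x + L₀.symm y := map_add L₀.toLinearEquiv.symm x y
    rw [h2, hQa] at h1
    have h3 := hL₀ x
    have h4 := hL₀ y
    rw [hQa] at h3 h4
    simp only [map_add, LinearMap.add_apply, hb (L₀.symm y) (L₀.symm x), h3, h4, Pi.add_apply] at h1
    have h5 : ∑ i, w i * ((x i + y i) * (x i + y i)) = ∑ i, w i * (x i * x i)
        + 2 * ∑ i, w i * (x i * y i) + ∑ i, w i * (y i * y i) := by
      rw [Finset.mul_sum, ← Finset.sum_add_distrib, ← Finset.sum_add_distrib]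
      exact Finset.sum_congr rfl fun i _ => by ring
    linarith
  have hdiag : ∀ i k, b (L₀.symm (Pi.single i 1)) (L₀.symm (Pi.single k 1))
      = if i = k then w i else 0 := fun i k => by
    rw [hbL]
    simp [Pi.single_apply]
    by_cases hik : i = k
    · simp [hik]
    · simp [hik, Ne.symm hik]
  -- it remains to permute the coordinates
  suffices hp : ∃ τ : Equiv.Perm (Fin (Module.finrank ℝ V)), ∀ i, w (τ i) = kind.sign i by
    obtain ⟨τ, hτ⟩ := hp
    refine ⟨(LinearEquiv.funCongrLeft ℝ ℝ τ.symm).trans L₀.toLinearEquiv.symm, fun x y => ?_⟩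
    refine (hbL _ _).trans ?_
    rw [← Equiv.sum_comp τ]
    refine Finset.sum_congr rfl fun i _ => ?_
    rw [hτ]
    simp [LinearEquiv.funCongrLeft]
  cases kind with
  | space =>
    refine ⟨1, fun i => (hw i).resolve_left fun hi => ?_⟩
    have h1 := h (L₀.symm (Pi.single i 1)) fun h0 => by
      have h2 := hdiag i i
      rw [h0, if_pos rfl, hi] at h2
      simp at h2
    simp only [hdiag, if_true, hi] at h1
    norm_num at h1
  | spacetime =>
    obtain ⟨k, hk⟩ : ∃ k, w k = -1 := by
      by_contra hne
      push Not at hne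
      obtain ⟨e, he1, -⟩ := h
      have h1 := hL₀ (L₀ e)
      rw [hQa, L₀.symm_apply_apply] at h1
      refine he1.not_ge (h1.ge.trans' (Finset.sum_nonneg fun i _ => ?_))
      rw [(hw i).resolve_left (hne i), one_mul]
      exact mul_self_nonneg _
    -- only one entry is negative, by `HasSignature.apply_ne_zero`
    have huniq : ∀ i, i ≠ k → w i = 1 := fun i hik => (hw i).resolve_left fun hi =>
      HasSignature.apply_ne_zero hb h (x := L₀.symm (Pi.single i 1))
        (y := L₀.symm (Pi.single k 1)) (by rw [hdiag, if_pos rfl, hi]; norm_num)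
        (by rw [hdiag, if_pos rfl, hk]; norm_num) (by rw [hdiag, if_neg hik])
    have hpos : 0 < Module.finrank ℝ V := lt_of_le_of_lt (Nat.zero_le _) k.isLt
    refine ⟨Equiv.swap ⟨0, hpos⟩ k, fun i => ?_⟩
    by_cases hi : i = ⟨0, hpos⟩
    · rw [hi, Equiv.swap_apply_left, hk]
      simp [GeometryKind.sign, GeometryKind.index]
    · have hi' : ¬ (i : ℕ) < 1 := fun h0 => hi (Fin.ext (by simpa using h0))
      have hs : GeometryKind.spacetime.sign i = 1 := by
        exact if_neg hi'
      rw [hs]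
      refine huniq _ fun h0 => hi ?_
      exact (Equiv.swap ⟨0, hpos⟩ k).injective (h0.trans (Equiv.swap_apply_left _ _).symm)

end ScalarProducts

/-! ### Rigid motions of the pseudo-Euclidean spaces -/

section RigidMotions

set_option maxSynthPendingDepth 3

variable {E₁ E₂ : Type*} [NormedAddCommGroup E₁] [NormedSpace ℝ E₁]
  [NormedAddCommGroup E₂] [NormedSpace ℝ E₂]
  {B₁ : E₁ →L[ℝ] E₁ →L[ℝ] ℝ} {B₂ : E₂ →L[ℝ] E₂ →L[ℝ] ℝ} {κ : ℝ} {c₁ : E₁} {c₂ : E₂} {d₁ d₂ : ℝ}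

/-- The affine map with linear part `L` which carries `F₁` to `F₂`. -/
def affineMove (F₁ : E₁) (F₂ : E₂) (L : E₁ ≃L[ℝ] E₂) (Y : E₁) : E₂ := F₂ + L (Y - F₁)

theorem affineMove_self (F₁ : E₁) (F₂ : E₂) (L : E₁ ≃L[ℝ] E₂) : affineMove F₁ F₂ L F₁ = F₂ := by
  simp [affineMove]

theorem affineMove_sub (F₁ : E₁) (F₂ : E₂) (L : E₁ ≃L[ℝ] E₂) (Y : E₁) :
    affineMove F₁ F₂ L Y - F₂ = L (Y - F₁) := by
  simp [affineMove]

theorem affineMove_symm_apply (F₁ : E₁) (F₂ : E₂) (L : E₁ ≃L[ℝ] E₂) (Y : E₁) :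
    affineMove F₂ F₁ L.symm (affineMove F₁ F₂ L Y) = Y := by
  simp [affineMove]

theorem affineMove_apply_symm (F₁ : E₁) (F₂ : E₂) (L : E₁ ≃L[ℝ] E₂) (Y : E₂) :
    affineMove F₁ F₂ L (affineMove F₂ F₁ L.symm Y) = Y := by
  simp [affineMove]

theorem hasFDerivAt_affineMove (F₁ : E₁) (F₂ : E₂) (L : E₁ ≃L[ℝ] E₂) (Y : E₁) :
    HasFDerivAt (affineMove F₁ F₂ L) (L : E₁ →L[ℝ] E₂) Y :=
  (L.hasFDerivAt.comp Y ((hasFDerivAt_id Y).sub_const F₁)).const_add F₂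

theorem contDiff_affineMove (F₁ : E₁) (F₂ : E₂) (L : E₁ ≃L[ℝ] E₂) :
    ContDiff ℝ ∞ (affineMove F₁ F₂ L) := by
  unfold affineMove
  exact contDiff_const.add (L.contDiff.comp (contDiff_id.sub contDiff_const))

theorem isometry_symm {L : E₁ ≃L[ℝ] E₂} (hL : ∀ a b, B₂ (L a) (L b) = B₁ a b) (a b : E₂) :
    B₁ (L.symm a) (L.symm b) = B₂ a b := by
  rw [← hL, L.apply_symm_apply, L.apply_symm_apply]

/-- The equation of the quadric, centred at one of its points. -/
theorem quadric_iff (hB : ∀ a b, B₁ a b = B₁ b a) {F : E₁} (hF : 2 * B₁ c₁ F + κ * B₁ F F = d₁)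
    (Y : E₁) : 2 * B₁ c₁ Y + κ * B₁ Y Y = d₁ ↔
      2 * B₁ (c₁ + κ • F) (Y - F) + κ * B₁ (Y - F) (Y - F) = 0 := by
  simp only [map_sub, map_add, map_smul, add_apply, sub_apply, smul_apply, smul_eq_mul, hB Y F]
  constructor <;> intro h
  · linear_combination h - hF
  · linear_combination h + hF

theorem affineMove_mem_quadric (hB₁ : ∀ a b, B₁ a b = B₁ b a) (hB₂ : ∀ a b, B₂ a b = B₂ b a)
    {F₁ : E₁} {F₂ : E₂} (hF₁ : 2 * B₁ c₁ F₁ + κ * B₁ F₁ F₁ = d₁)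
    (hF₂ : 2 * B₂ c₂ F₂ + κ * B₂ F₂ F₂ = d₂) {L : E₁ ≃L[ℝ] E₂}
    (hL : ∀ a b, B₂ (L a) (L b) = B₁ a b) (hξ : L (c₁ + κ • F₁) = c₂ + κ • F₂) {Y : E₁}
    (hY : 2 * B₁ c₁ Y + κ * B₁ Y Y = d₁) :
    2 * B₂ c₂ (affineMove F₁ F₂ L Y) + κ * B₂ (affineMove F₁ F₂ L Y) (affineMove F₁ F₂ L Y)
      = d₂ := by
  rw [quadric_iff hB₂ hF₂, affineMove_sub, ← hξ, hL, hL]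
  exact (quadric_iff hB₁ hF₁ Y).1 hY

theorem sliceFunction_affineMove {F₁ η₁ : E₁} {F₂ η₂ : E₂} {L : E₁ ≃L[ℝ] E₂}
    (hL : ∀ a b, B₂ (L a) (L b) = B₁ a b) (hη : L η₁ = η₂) (σ : ℝ) (Y : E₁) :
    sliceFunction B₂ σ F₂ η₂ (affineMove F₁ F₂ L Y) = sliceFunction B₁ σ F₁ η₁ Y := by
  rw [sliceFunction, affineMove_sub, ← hη, hL, hL, sliceFunction]

variable {m : ℕ} {N₁ N₂ : Type*} [TopologicalSpace N₁] [ChartedSpace (Coord m) N₁]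
  [TopologicalSpace N₂] [ChartedSpace (Coord m) N₂]
  {b₁ : BilinField m N₁} {b₂ : BilinField m N₂} {ε σ : ℝ} {G₁ η₁ : N₁ → E₁} {G₂ η₂ : N₂ → E₂}
  {O₁ : Set N₁} {O₂ : Set N₂} {kind : GeometryKind}

/-- Orthonormal coordinates of the ambient space at a point of a developed hypersurface, adapted to
its tangent space, its normal and the normal of the quadric. -/
theorem IsUmbilicalDevelopment.exists_frame (h : IsUmbilicalDevelopment b₁ B₁ ε κ c₁ d₁ σ G₁ η₁ O₁)
    {x : N₁} (hx : x ∈ O₁)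
    (hs : HasSignature kind (fun u v : Coord m => (b₁ x : Coord m →L[ℝ] Coord m →L[ℝ] ℝ) u v)) :
    ∃ L : ((Fin m → ℝ) × ℝ × ℝ) ≃L[ℝ] E₁,
      (∀ y z, B₁ (L y) (L z) = ∑ i : Fin m, kind.sign i * (y.1 i * z.1 i) + y.2.1 * z.2.1
        + ε * (y.2.2 * z.2.2)) ∧
      L (0, 1, 0) = η₁ x ∧ L (0, 0, 1) = c₁ + κ • G₁ x := by
  have := h.finiteDimensional
  set b : Coord m →L[ℝ] Coord m →L[ℝ] ℝ := b₁ x with hb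
  have hbD : ∀ u w, B₁ (vectorDeriv m G₁ x u) (vectorDeriv m G₁ x w) = b u w := h.isometry x hx
  have hbs : ∀ u w, b u w = b w u := fun u w => by rw [← hbD, h.symm, hbD]
  obtain ⟨S, hS⟩ := HasSignature.exists_equiv (V := Coord m) finrank_euclideanSpace_fin
    (b := LinearMap.mk₂ ℝ (fun u w => b u w) (by simp) (by simp) (by simp) (by simp)) hbs hs
  obtain ⟨L, hL⟩ := exists_adapted_frame (V := Coord m) (D := vectorDeriv m G₁ x)
    (by rw [h.finrank_eq, finrank_euclideanSpace_fin]) h.symm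
    (fun u hu => hs.nondegenerate hbs fun w => (hbD u w).symm.trans (hu w)) h.sign_ne_zero
    (h.normal_unit x hx) (h.quadric_sq hx) (h.normal_tangent x hx) (h.normal_orthogonal x hx)
    (h.quadric_orthogonal hx)
  refine ⟨(S.toContinuousLinearEquiv.prodCongr (ContinuousLinearEquiv.refl ℝ (ℝ × ℝ))).trans L,
    fun y z => ?_, ?_, ?_⟩
  · have h1 : ∀ y : (Fin m → ℝ) × ℝ × ℝ,
        ((S.toContinuousLinearEquiv.prodCongr (ContinuousLinearEquiv.refl ℝ (ℝ × ℝ))).trans L) y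
        = vectorDeriv m G₁ x (S y.1) + y.2.1 • η₁ x + y.2.2 • (c₁ + κ • G₁ x) := fun y => hL _
    have e1 : B₁ (η₁ x) (c₁ + κ • G₁ x) = 0 := by rw [h.symm, h.normal_tangent x hx]
    have e2 := h.normal_tangent x hx
    have e3 := h.quadric_sq hx
    have e4 : ∀ u, B₁ (vectorDeriv m G₁ x u) (η₁ x) = 0 := fun u => by
      rw [h.symm, h.normal_orthogonal x hx]
    have e5 : ∀ u, B₁ (vectorDeriv m G₁ x u) (c₁ + κ • G₁ x) = 0 := fun u => by
      rw [h.symm, h.quadric_orthogonal hx]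
    have e6 := h.quadric_orthogonal hx
    have e7 : b (S y.1) (S z.1) = _ := hS y.1 z.1
    rw [h1, h1]
    generalize c₁ + κ • G₁ x = ξ at *
    simp only [map_add B₁, add_apply, map_add (B₁ _), map_smul, smul_apply, smul_eq_mul, e1, e2, e3,
      e4, e5, e6, h.normal_orthogonal x hx, h.normal_unit x hx, hbD, e7]
    ring
  · exact (hL _).trans (by simp)
  · exact (hL _).trans (by simp)

/-- Two pointed umbilical hypersurfaces with the same principal curvature are related by a linear
isometry of the ambient spaces which identifies the normal vectors. -/
theorem IsUmbilicalDevelopment.exists_linear_isometry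
    (h₁ : IsUmbilicalDevelopment b₁ B₁ ε κ c₁ d₁ σ G₁ η₁ O₁)
    (h₂ : IsUmbilicalDevelopment b₂ B₂ ε κ c₂ d₂ σ G₂ η₂ O₂) {x₁ : N₁} {x₂ : N₂} (hx₁ : x₁ ∈ O₁)
    (hx₂ : x₂ ∈ O₂)
    (hs₁ : HasSignature kind (fun u v : Coord m => (b₁ x₁ : Coord m →L[ℝ] Coord m →L[ℝ] ℝ) u v))
    (hs₂ : HasSignature kind (fun u v : Coord m => (b₂ x₂ : Coord m →L[ℝ] Coord m →L[ℝ] ℝ) u v)) :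
    ∃ L : E₁ ≃L[ℝ] E₂, (∀ a b, B₂ (L a) (L b) = B₁ a b) ∧ L (η₁ x₁) = η₂ x₂ ∧
      L (c₁ + κ • G₁ x₁) = c₂ + κ • G₂ x₂ := by
  obtain ⟨L₁, h1, h2, h3⟩ := h₁.exists_frame hx₁ hs₁
  obtain ⟨L₂, h4, h5, h6⟩ := h₂.exists_frame hx₂ hs₂
  refine ⟨L₁.symm.trans L₂, fun a b => ?_, ?_, ?_⟩
  · obtain ⟨y, rfl⟩ := L₁.surjective a
    obtain ⟨z, rfl⟩ := L₁.surjective b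
    rw [h1]
    exact (congrArg₂ (fun a b => B₂ (L₂ a) (L₂ b)) (L₁.symm_apply_apply y)
      (L₁.symm_apply_apply z)).trans (h4 y z)
  · rw [← h2, ← h5]
    exact congrArg L₂ (L₁.symm_apply_apply _)
  · rw [← h3, ← h6]
    exact congrArg L₂ (L₁.symm_apply_apply _)

end RigidMotions

/-! ### Isometries from rigid motions -/

section Isometries

variable {n : ℕ} {M : Type*} [TopologicalSpace M] [ChartedSpace (Coord n) M]
  {E₁ E₂ : Type*} [NormedAddCommGroup E₁] [NormedSpace ℝ E₁]
  [NormedAddCommGroup E₂] [NormedSpace ℝ E₂]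
  {g : BilinField n M} {lam : ℝ} {B₁ : E₁ →L[ℝ] E₁ →L[ℝ] ℝ} {B₂ : E₂ →L[ℝ] E₂ →L[ℝ] ℝ} {ε κ : ℝ}
  {c₁ : E₁} {c₂ : E₂} {d₁ d₂ : ℝ} {j₁ : M → E₁} {j₂ : M → E₂} {U₁ U₂ : Set M} {V₁ : Set E₁}
  {V₂ : Set E₂} {π₁ : E₁ → M} {π₂ : E₂ → M}

/-- A map which two developments turn into a rigid motion is isometric. -/
theorem isometry_of_comp_eq_affineMove (h₁ : IsDevelopment g lam B₁ ε κ c₁ d₁ j₁ U₁)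
    (h₂ : IsDevelopment g lam B₂ ε κ c₂ d₂ j₂ U₂) {F₁ : E₁} {F₂ : E₂} {L : E₁ ≃L[ℝ] E₂}
    (hL : ∀ a b, B₂ (L a) (L b) = B₁ a b) {Φ : M → M} {S : Set M} (hS : IsOpen S) (hSU : S ⊆ U₁)
    (hΦU : MapsTo Φ S U₂) (hΦ : ∀ q ∈ S, j₂ (Φ q) = affineMove F₁ F₂ L (j₁ q)) {q : M} (hq : q ∈ S)
    (hd : MDifferentiableAt (𝓡 n) (𝓡 n) Φ q) (u w : TangentSpace (𝓡 n) q) :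
    g (Φ q) (mfderiv (𝓡 n) (𝓡 n) Φ q u) (mfderiv (𝓡 n) (𝓡 n) Φ q w) = g q u w := by
  have h3 : HasMFDerivAt (𝓡 n) 𝓘(ℝ, E₂) (affineMove F₁ F₂ L ∘ j₁) q
      ((L : E₁ →L[ℝ] E₂).comp (mfderiv (𝓡 n) 𝓘(ℝ, E₁) j₁ q)) :=
    HasMFDerivAt.comp q (hasFDerivAt_affineMove F₁ F₂ L (j₁ q)).hasMFDerivAt
      (h₁.mdifferentiableAt (hSU hq)).hasMFDerivAt
  have h4 : j₂ ∘ Φ =ᶠ[𝓝 q] affineMove F₁ F₂ L ∘ j₁ :=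
    Filter.mem_of_superset (hS.mem_nhds hq) hΦ
  have h5 := (HasMFDerivAt.congr_of_eventuallyEq h3 h4).mfderiv
  have h6 := mfderiv_comp q (h₂.mdifferentiableAt (hΦU hq)) hd
  have h7 : ∀ u : TangentSpace (𝓡 n) q, (mfderiv (𝓡 n) 𝓘(ℝ, E₂) j₂ (Φ q)
      (mfderiv (𝓡 n) (𝓡 n) Φ q u) : E₂) = L (mfderiv (𝓡 n) 𝓘(ℝ, E₁) j₁ q u : E₁) := fun u =>
    DFunLike.congr_fun (h6.symm.trans h5) u
  refine (h₂.isometry _ (hΦU hq) _ _).symm.trans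
    ((congrArg₂ (fun z z' => B₂ z z') (h7 u) (h7 w)).trans ?_)
  exact (hL _ _).trans (h₁.isometry q (hSU hq) u w)

/-- A rigid motion of the pseudo-Euclidean spaces which respects the quadrics induces a local
isometry. -/
theorem IsDevelopment.exists_localIsometry (h₁ : IsDevelopment g lam B₁ ε κ c₁ d₁ j₁ U₁)
    (h₂ : IsDevelopment g lam B₂ ε κ c₂ d₂ j₂ U₂)
    (hπ₁ : IsDevelopmentInverse (n := n) B₁ κ c₁ d₁ j₁ U₁ V₁ π₁)
    (hπ₂ : IsDevelopmentInverse (n := n) B₂ κ c₂ d₂ j₂ U₂ V₂ π₂) {p₁ p₂ : M} (hp₁ : p₁ ∈ U₁)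
    (hp₂ : p₂ ∈ U₂) {L : E₁ ≃L[ℝ] E₂} (hL : ∀ a b, B₂ (L a) (L b) = B₁ a b)
    (hξ : L (c₁ + κ • j₁ p₁) = c₂ + κ • j₂ p₂) :
    ∃ Φ : OpenPartialHomeomorph M M, IsLocalIsometry g Φ ∧ p₁ ∈ Φ.source ∧ Φ p₁ = p₂ ∧
      Φ.source ⊆ U₁ ∧ Φ.target ⊆ U₂ ∧
      ∀ q ∈ Φ.source, j₂ (Φ q) = affineMove (j₁ p₁) (j₂ p₂) L (j₁ q) := by
  set A := affineMove (j₁ p₁) (j₂ p₂) L with hA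
  set A' := affineMove (j₂ p₂) (j₁ p₁) L.symm with hA'
  have hAA' : ∀ Y, A' (A Y) = Y := affineMove_symm_apply _ _ _
  have hA'A : ∀ Y, A (A' Y) = Y := affineMove_apply_symm _ _ _
  have hξ' : L.symm (c₂ + κ • j₂ p₂) = c₁ + κ • j₁ p₁ := by rw [← hξ, L.symm_apply_apply]
  have hAq : ∀ q ∈ U₁, 2 * B₂ c₂ (A (j₁ q)) + κ * B₂ (A (j₁ q)) (A (j₁ q)) = d₂ := fun q hq =>
    affineMove_mem_quadric h₁.symm h₂.symm (h₁.quadric _ hp₁) (h₂.quadric _ hp₂) hL hξ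
      (h₁.quadric _ hq)
  have hA'q : ∀ q ∈ U₂, 2 * B₁ c₁ (A' (j₂ q)) + κ * B₁ (A' (j₂ q)) (A' (j₂ q)) = d₁ := fun q hq =>
    affineMove_mem_quadric h₂.symm h₁.symm (h₂.quadric _ hp₂) (h₁.quadric _ hp₁) (isometry_symm hL)
      hξ' (h₂.quadric _ hq)
  have hs₁ : ContMDiffOn (𝓡 n) 𝓘(ℝ, E₂) ∞ (A ∘ j₁) U₁ :=
    (contDiff_affineMove _ _ _).contMDiff.comp_contMDiffOn h₁.smooth
  have hs₂ : ContMDiffOn (𝓡 n) 𝓘(ℝ, E₁) ∞ (A' ∘ j₂) U₂ :=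
    (contDiff_affineMove _ _ _).contMDiff.comp_contMDiffOn h₂.smooth
  set S := U₁ ∩ (A ∘ j₁) ⁻¹' V₂ with hS
  set T := U₂ ∩ (A' ∘ j₂) ⁻¹' V₁ with hT
  have hSo : IsOpen S := hs₁.continuousOn.isOpen_inter_preimage h₁.isOpen hπ₂.isOpen
  have hTo : IsOpen T := hs₂.continuousOn.isOpen_inter_preimage h₂.isOpen hπ₁.isOpen
  have hjΦ : ∀ q ∈ S, j₂ (π₂ (A (j₁ q))) = A (j₁ q) := fun q hq =>
    hπ₂.right_inv _ hq.2 (hAq q hq.1)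
  have hjΦ' : ∀ q ∈ T, j₁ (π₁ (A' (j₂ q))) = A' (j₂ q) := fun q hq =>
    hπ₁.right_inv _ hq.2 (hA'q q hq.1)
  have hΦs : ContMDiffOn (𝓡 n) (𝓡 n) ∞ (π₂ ∘ A ∘ j₁) S :=
    hπ₂.smooth.comp (hs₁.mono inter_subset_left) fun q hq => hq.2
  have hΦs' : ContMDiffOn (𝓡 n) (𝓡 n) ∞ (π₁ ∘ A' ∘ j₂) T :=
    hπ₁.smooth.comp (hs₂.mono inter_subset_left) fun q hq => hq.2
  let Φ : OpenPartialHomeomorph M M :=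
    { toFun := π₂ ∘ A ∘ j₁
      invFun := π₁ ∘ A' ∘ j₂
      source := S
      target := T
      map_source' := fun q hq => by
        refine ⟨hπ₂.mapsTo_inv hq.2, ?_⟩
        show A' (j₂ (π₂ (A (j₁ q)))) ∈ V₁
        rw [hjΦ q hq, hAA']
        exact hπ₁.mapsTo hq.1
      map_target' := fun q hq => by
        refine ⟨hπ₁.mapsTo_inv hq.2, ?_⟩
        show A (j₁ (π₁ (A' (j₂ q)))) ∈ V₂
        rw [hjΦ' q hq, hA'A]
        exact hπ₂.mapsTo hq.1
      left_inv' := fun q hq => by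
        show π₁ (A' (j₂ (π₂ (A (j₁ q))))) = q
        rw [hjΦ q hq, hAA', hπ₁.left_inv q hq.1]
      right_inv' := fun q hq => by
        show π₂ (A (j₁ (π₁ (A' (j₂ q))))) = q
        rw [hjΦ' q hq, hA'A, hπ₂.left_inv q hq.1]
      open_source := hSo
      open_target := hTo
      continuousOn_toFun := hΦs.continuousOn
      continuousOn_invFun := hΦs'.continuousOn }
  have hAp : A (j₁ p₁) = j₂ p₂ := affineMove_self _ _ _
  refine ⟨Φ, ⟨hΦs, hΦs', fun q hq u w => ?_⟩, ⟨hp₁, ?_⟩, ?_, inter_subset_left, inter_subset_left,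
    hjΦ⟩
  · exact isometry_of_comp_eq_affineMove h₁ h₂ hL hSo inter_subset_left
      (fun q hq => hπ₂.mapsTo_inv hq.2) hjΦ hq
      ((hΦs.contMDiffAt (hSo.mem_nhds hq)).mdifferentiableAt (by simp)) u w
  · show A (j₁ p₁) ∈ V₂
    rw [hAp]
    exact hπ₂.mapsTo hp₂
  · show π₂ (A (j₁ p₁)) = p₂
    rw [hAp, hπ₂.left_inv _ hp₂]

end Isometries

section ImagesOfSlices

variable {M N₁ N₂ : Type*} [TopologicalSpace M] [TopologicalSpace N₁] [TopologicalSpace N₂]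

/-- A local homeomorphism which respects the equations of two hypersurfaces maps a piece of the first
hypersurface onto a piece of the second one. -/
theorem exists_image_image_eq {f₁ : N₁ → M} {f₂ : N₂ → M} (hf₁ : Continuous f₁)
    (hf₂ : Continuous f₂) {x₁ : N₁} {x₂ : N₂} {Φ : OpenPartialHomeomorph M M}
    (hx : f₁ x₁ ∈ Φ.source) (hΦ : Φ (f₁ x₁) = f₂ x₂) {O₁ O₂ : Set M} {W₁ : Set N₁} {W₂ : Set N₂}
    {H₁ H₂ : M → ℝ} (hO₁ : IsOpen O₁) (hO₂ : IsOpen O₂) (hW₁ : IsOpen W₁) (hW₂ : IsOpen W₂)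
    (hxW₁ : x₁ ∈ W₁) (hxW₂ : x₂ ∈ W₂) (hS₁ : f₁ '' W₁ = {q | q ∈ O₁ ∧ H₁ q = 0})
    (hS₂ : f₂ '' W₂ = {q | q ∈ O₂ ∧ H₂ q = 0}) (hH : ∀ q ∈ Φ.source, H₂ (Φ q) = H₁ q) :
    ∃ (W₁ : Set N₁) (W₂ : Set N₂), IsOpen W₁ ∧ x₁ ∈ W₁ ∧ IsOpen W₂ ∧ x₂ ∈ W₂ ∧
      f₁ '' W₁ ⊆ Φ.source ∧ Φ '' (f₁ '' W₁) = f₂ '' W₂ := by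
  set S := Φ.source ∩ Φ ⁻¹' O₂ ∩ O₁ with hS
  have hSo : IsOpen S := (Φ.isOpen_inter_preimage hO₂).inter hO₁
  have hSsrc : S ⊆ Φ.source := fun q hq => hq.1.1
  have hTo : IsOpen (Φ '' S) := Φ.isOpen_image_of_subset_source hSo hSsrc
  have h1 : ∀ {x}, x ∈ W₁ → f₁ x ∈ O₁ ∧ H₁ (f₁ x) = 0 := fun {x} hx => by
    have h := mem_image_of_mem f₁ hx
    rw [hS₁] at h
    exact h
  have h2 : ∀ {x}, x ∈ W₂ → f₂ x ∈ O₂ ∧ H₂ (f₂ x) = 0 := fun {x} hx => by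
    have h := mem_image_of_mem f₂ hx
    rw [hS₂] at h
    exact h
  have hxS : f₁ x₁ ∈ S := ⟨⟨hx, by rw [mem_preimage, hΦ]; exact (h2 hxW₂).1⟩, (h1 hxW₁).1⟩
  refine ⟨W₁ ∩ f₁ ⁻¹' S, W₂ ∩ f₂ ⁻¹' (Φ '' S), hW₁.inter (hSo.preimage hf₁), ⟨hxW₁, hxS⟩,
    hW₂.inter (hTo.preimage hf₂), ⟨hxW₂, f₁ x₁, hxS, hΦ⟩, ?_, Subset.antisymm ?_ ?_⟩
  · rintro _ ⟨x, hx, rfl⟩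
    exact hSsrc hx.2
  · rintro _ ⟨_, ⟨x, ⟨hxW, hxS⟩, rfl⟩, rfl⟩
    obtain ⟨y, hyW, hy⟩ : Φ (f₁ x) ∈ f₂ '' W₂ := by
      rw [hS₂]
      exact ⟨hxS.1.2, by rw [hH _ hxS.1.1, (h1 hxW).2]⟩
    exact ⟨y, ⟨hyW, f₁ x, hxS, hy.symm⟩, hy⟩
  · rintro _ ⟨y, ⟨hyW, q, hqS, hq⟩, rfl⟩
    obtain ⟨x, hxW, rfl⟩ : q ∈ f₁ '' W₁ := by
      rw [hS₁]
      exact ⟨hqS.2, by rw [← hH _ hqS.1.1, hq, (h2 hyW).2]⟩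
    exact ⟨f₁ x, ⟨x, ⟨hxW, hqS⟩, rfl⟩, hq⟩

end ImagesOfSlices

section LocalRigidity

variable {m : ℕ} {M : Type*} [TopologicalSpace M] [ChartedSpace (Coord (m + 1)) M]
  [IsManifold (𝓡 (m + 1)) ∞ M] {g : BilinField (m + 1) M} {lam : ℝ} {kind : GeometryKind}
  {N₁ N₂ : Type*} [TopologicalSpace N₁] [ChartedSpace (Coord m) N₁] [IsManifold (𝓡 m) ∞ N₁]
  [TopologicalSpace N₂] [ChartedSpace (Coord m) N₂] [IsManifold (𝓡 m) ∞ N₂]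
  {f₁ : N₁ → M} {f₂ : N₂ → M} {ν₁ : ∀ x : N₁, TangentSpace (𝓡 (m + 1)) (f₁ x)}
  {ν₂ : ∀ x : N₂, TangentSpace (𝓡 (m + 1)) (f₂ x)} {σ₁ : N₁ → ℝ} {σ₂ : N₂ → ℝ}

/-- The development of an umbilical hypersurface with the normal reversed if necessary, so that the
principal curvature has a prescribed sign. -/
theorem IsUmbilicalHypersurface.exists_isUmbilicalDevelopment {E : Type*} [NormedAddCommGroup E]
    [NormedSpace ℝ E] {B : E →L[ℝ] E →L[ℝ] ℝ} {ε κ : ℝ} {c : E} {d : ℝ} {j : M → E} {U : Set M}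
    (h : IsUmbilicalHypersurface kind g f₁ ν₁ σ₁) (hg : IsMetric kind g)
    (hdev : IsDevelopment g lam B ε κ c d j U) {s s' : ℝ} (hs : ∀ x, σ₁ x = s)
    (hs' : s ^ 2 = s' ^ 2) :
    ∃ η, IsUmbilicalDevelopment (inducedMetric (m := m) g f₁) B ε κ c d s' (j ∘ f₁) η
      (f₁ ⁻¹' U) := by
  have h1 := h.isUmbilicalDevelopment hg hdev hs
  rcases sq_eq_sq_iff_eq_or_eq_neg.1 hs'.symm with h3 | h3
  · exact ⟨_, h3 ▸ h1⟩
  · exact ⟨_, h3 ▸ h1.neg⟩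

/-- Umbilical hypersurfaces with the same squared principal curvature are locally congruent. -/
theorem IsUmbilicalHypersurface.exists_localIsometry
    (h₁ : IsUmbilicalHypersurface kind g f₁ ν₁ σ₁) (h₂ : IsUmbilicalHypersurface kind g f₂ ν₂ σ₂)
    (hg : IsConstantCurvatureMetric kind lam g) {s₁ s₂ : ℝ} (hs₁ : ∀ x, σ₁ x = s₁)
    (hs₂ : ∀ x, σ₂ x = s₂) (hs : s₁ ^ 2 = s₂ ^ 2) (x₁ : N₁) (x₂ : N₂) :
    ∃ Φ : OpenPartialHomeomorph M M, IsLocalIsometry g Φ ∧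
      f₁ x₁ ∈ Φ.source ∧ Φ (f₁ x₁) = f₂ x₂ ∧
      ∃ (W₁ : Set N₁) (W₂ : Set N₂), IsOpen W₁ ∧ x₁ ∈ W₁ ∧ IsOpen W₂ ∧ x₂ ∈ W₂ ∧
        f₁ '' W₁ ⊆ Φ.source ∧ Φ '' (f₁ '' W₁) = f₂ '' W₂ := by
  obtain ⟨ε, κ, hε, hlam⟩ := exists_sign_mul_sq lam
  obtain ⟨B₁, c₁, d₁, j₁, U₁', hU₁', hdev₁'⟩ := hg.exists_development hε hlam (f₁ x₁)
  obtain ⟨B₂, c₂, d₂, j₂, U₂', hU₂', hdev₂'⟩ := hg.exists_development hε hlam (f₂ x₂)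
  obtain ⟨U₁, V₁, π₁, hU₁, hUU₁, hUo₁, hπ₁⟩ := hdev₁'.exists_inverse hg.toIsMetric hU₁'
  obtain ⟨U₂, V₂, π₂, hU₂, hUU₂, hUo₂, hπ₂⟩ := hdev₂'.exists_inverse hg.toIsMetric hU₂'
  have hdev₁ := hdev₁'.mono hUU₁ hUo₁
  have hdev₂ := hdev₂'.mono hUU₂ hUo₂
  have hu₁ := h₁.isUmbilicalDevelopment hg.toIsMetric hdev₁ hs₁
  obtain ⟨η₂, hu₂⟩ := h₂.exists_isUmbilicalDevelopment hg.toIsMetric hdev₂ hs₂ hs.symm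
  obtain ⟨L, hL, hLη, hLξ⟩ := hu₁.exists_linear_isometry hu₂ hU₁ hU₂ (h₁.signature x₁)
    (h₂.signature x₂)
  obtain ⟨Φ, hΦ, hx, hΦx, hsrc, htgt, hjΦ⟩ := hdev₁.exists_localIsometry hdev₂ hπ₁ hπ₂ hU₁ hU₂ hL hLξ
  obtain ⟨O₁, W₁, hO₁, -, hW₁, hxW₁, hS₁⟩ := hu₁.exists_isOpen_image_eq hdev₁ hg.toIsMetric
    h₁.smooth.continuous (fun x u hu => h₁.inducedMetric_nondegenerate (x := x) hg.toIsMetric hu) hU₁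
  obtain ⟨O₂, W₂, hO₂, -, hW₂, hxW₂, hS₂⟩ := hu₂.exists_isOpen_image_eq hdev₂ hg.toIsMetric
    h₂.smooth.continuous (fun x u hu => h₂.inducedMetric_nondegenerate (x := x) hg.toIsMetric hu) hU₂
  refine ⟨Φ, hΦ, hx, hΦx, exists_image_image_eq h₁.smooth.continuous h₂.smooth.continuous hx hΦx hO₁
    hO₂ hW₁ hW₂ hxW₁ hxW₂ hS₁ hS₂ fun q hq => ?_⟩
  rw [hjΦ q hq]
  exact sliceFunction_affineMove hL hLη _ _

end LocalRigidity

/-! ### Global isometries and complete slices -/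

section GlobalIsometries

variable {n : ℕ} {M : Type*} [TopologicalSpace M] [ChartedSpace (Coord n) M]
  [IsManifold (𝓡 n) ∞ M]
  {E : Type*} [NormedAddCommGroup E] [NormedSpace ℝ E]
  {g : BilinField n M} {lam : ℝ} {B : E →L[ℝ] E →L[ℝ] ℝ} {ε κ : ℝ} {c : E} {d : ℝ} {j : M → E}
  {kind : GeometryKind}

/-- A map into the manifold is smooth if its composition with a topologically embedded development
is. -/
theorem IsDevelopment.contMDiff_of_comp (h : IsDevelopment g lam B ε κ c d j univ)
    (hg : IsMetric kind g) (hj : Topology.IsEmbedding j) {Φ : M → M}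
    (hΦ : ContMDiff (𝓡 n) 𝓘(ℝ, E) ∞ (j ∘ Φ)) : ContMDiff (𝓡 n) (𝓡 n) ∞ Φ := by
  have hc : Continuous Φ := hj.continuous_iff.2 hΦ.continuous
  intro q
  obtain ⟨U, V, π, hU, -, hUo, hπ⟩ := h.exists_inverse hg (mem_univ (Φ q))
  have h1 : ContMDiffAt (𝓡 n) (𝓡 n) ∞ (π ∘ (j ∘ Φ)) q :=
    ContMDiffAt.comp q (hπ.smooth.contMDiffAt (hπ.isOpen.mem_nhds (hπ.mapsTo hU))) (hΦ q)
  refine h1.congr_of_eventuallyEq ?_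
  filter_upwards [hc.continuousAt.preimage_mem_nhds (hUo.mem_nhds hU)] with p hp
  exact (hπ.left_inv _ hp).symm

/-- A rigid motion which preserves the image of an embedded development induces a global
isometry. -/
theorem IsDevelopment.exists_globalIsometry (h : IsDevelopment g lam B ε κ c d j univ)
    (hg : IsMetric kind g) (hj : Topology.IsEmbedding j) {p₁ p₂ : M} {L : E ≃L[ℝ] E}
    (hL : ∀ a b, B (L a) (L b) = B a b)
    (hA : ∀ Y ∈ range j, affineMove (j p₁) (j p₂) L Y ∈ range j)
    (hA' : ∀ Y ∈ range j, affineMove (j p₂) (j p₁) L.symm Y ∈ range j) :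
    ∃ Φ : M ≃ₘ^∞⟮𝓡 n, 𝓡 n⟯ M, IsGlobalIsometry g Φ ∧ Φ p₁ = p₂ ∧
      ∀ q, j (Φ q) = affineMove (j p₁) (j p₂) L (j q) := by
  choose Φ hΦ using fun q => hA (j q) (mem_range_self q)
  choose Ψ hΨ using fun q => hA' (j q) (mem_range_self q)
  have hjs : ContMDiff (𝓡 n) 𝓘(ℝ, E) ∞ j := contMDiffOn_univ.1 h.smooth
  have hΦs : ContMDiff (𝓡 n) (𝓡 n) ∞ Φ := h.contMDiff_of_comp hg hj
    (((contDiff_affineMove (j p₁) (j p₂) L).contMDiff.comp hjs).congr hΦ)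
  have hΨs : ContMDiff (𝓡 n) (𝓡 n) ∞ Ψ := h.contMDiff_of_comp hg hj
    (((contDiff_affineMove (j p₂) (j p₁) L.symm).contMDiff.comp hjs).congr hΨ)
  refine ⟨⟨⟨Φ, Ψ, fun q => hj.injective ?_, fun q => hj.injective ?_⟩, hΦs, hΨs⟩,
    fun q u w => ?_, hj.injective ?_, hΦ⟩
  · rw [hΨ, hΦ, affineMove_symm_apply]
  · rw [hΦ, hΨ, affineMove_apply_symm]
  · exact isometry_of_comp_eq_affineMove h h hL isOpen_univ (subset_univ _) (mapsTo_univ _ _)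
      (fun q _ => hΦ q) (mem_univ q) ((hΦs q).mdifferentiableAt (by simp)) u w
  · exact (hΦ p₁).trans (affineMove_self _ _ _)

end GlobalIsometries

section CompleteSlices

variable {m : ℕ} {M : Type*} [TopologicalSpace M] [ChartedSpace (Coord (m + 1)) M]
  [IsManifold (𝓡 (m + 1)) ∞ M] {g : BilinField (m + 1) M} {lam : ℝ} {kind : GeometryKind}
  {N : Type*} [TopologicalSpace N] [ChartedSpace (Coord m) N] [IsManifold (𝓡 m) ∞ N]
  [PreconnectedSpace N]
  {E : Type*} [NormedAddCommGroup E] [NormedSpace ℝ E] {B : E →L[ℝ] E →L[ℝ] ℝ} {ε κ : ℝ} {c : E}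
  {d σ : ℝ} {j : M → E} {b : BilinField m N} {f : N → M} {η : N → E}

theorem IsUmbilicalDevelopment.sliceFunction_eq_of_univ {F : N → E}
    (h : IsUmbilicalDevelopment b B ε κ c d σ F η univ) (x x₀ : N) (Y : E) :
    sliceFunction B σ (F x) (η x) Y = sliceFunction B σ (F x₀) (η x₀) Y := by
  have h1 : IsLocallyConstant fun x => sliceFunction B σ (F x) (η x) Y :=
    (IsLocallyConstant.iff_eventually_eq _).2 fun x =>
      (h.eventually_sliceFunction_eq (mem_univ x)).mono fun _ hx => hx Y
  exact h1.apply_eq_of_isPreconnected isPreconnected_univ (mem_univ x) (mem_univ x₀)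

/-- The zero set of the slice function at one point contains the whole connected hypersurface. -/
theorem IsUmbilicalDevelopment.sliceFunction_apply_eq_zero {F : N → E}
    (h : IsUmbilicalDevelopment b B ε κ c d σ F η univ) (x x₀ : N) :
    sliceFunction B σ (F x₀) (η x₀) (F x) = 0 := by
  rw [← h.sliceFunction_eq_of_univ x x₀, sliceFunction_self]

/-- A closed umbilical hypersurface is all of the slice which contains it, if that slice is
connected: by `IsUmbilicalDevelopment.exists_isOpen_image_eq` it is open in the slice. -/
theorem IsUmbilicalDevelopment.range_eq (hdev : IsDevelopment g lam B ε κ c d j univ)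
    (hg : IsMetric kind g) (hf : Continuous f)
    (h : IsUmbilicalDevelopment b B ε κ c d σ (j ∘ f) η univ)
    (hb : ∀ (x : N) (u : Coord m), (∀ w : Coord m, b x u w = 0) → u = 0) (x₀ : N)
    (hS : IsPreconnected {q | sliceFunction B σ (j (f x₀)) (η x₀) (j q) = 0})
    (hcl : IsClosed (range f)) :
    range f = {q | sliceFunction B σ (j (f x₀)) (η x₀) (j q) = 0} := by
  have hsub : range f ⊆ {q | sliceFunction B σ (j (f x₀)) (η x₀) (j q) = 0} := by
    rintro _ ⟨x, rfl⟩
    exact h.sliceFunction_apply_eq_zero x x₀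
  refine hsub.antisymm fun q hq => ?_
  have h' : IsUmbilicalDevelopment b B ε κ c d σ (j ∘ f) η (f ⁻¹' univ) := h
  choose O W hO _ _ hxW hOW using fun x =>
    h'.exists_isOpen_image_eq hdev hg hf hb (mem_univ (f x))
  have hOf : ∀ x p, p ∈ O x → sliceFunction B σ (j (f x₀)) (η x₀) (j p) = 0 → p ∈ range f := by
    intro x p hp hp0
    have h1 : p ∈ f '' W x := by
      rw [hOW]
      exact ⟨hp, (h.sliceFunction_eq_of_univ x x₀ (j p)).trans hp0⟩
    exact image_subset_range _ _ h1
  have hfO : ∀ x, f x ∈ O x := fun x => by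
    have h1 := mem_image_of_mem f (hxW x)
    rw [hOW] at h1
    exact h1.1
  by_contra hqf
  obtain ⟨p, hp, hpO, hpf⟩ := hS (⋃ x, O x) (range f)ᶜ (isOpen_iUnion hO) hcl.isOpen_compl
    (fun p _ => (em (p ∈ range f)).imp
      (fun ⟨x, hx⟩ => mem_iUnion.2 ⟨x, hx ▸ hfO x⟩) id)
    ⟨f x₀, hsub (mem_range_self x₀), mem_iUnion.2 ⟨x₀, hfO x₀⟩⟩ ⟨q, hq, hqf⟩
  obtain ⟨x, hx⟩ := mem_iUnion.1 hpO
  exact hpf (hOf x p hx hp)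

end CompleteSlices

/-! ### Connectedness of the model slices -/

section Connectedness

/-- A family of round spheres of dimension at least one, possibly degenerating to points, over a
connected base is connected. -/
theorem isPreconnected_sphere_bundle {X V : Type*} [TopologicalSpace X] [NormedAddCommGroup V]
    [NormedSpace ℝ V] (hV : 1 < Module.rank ℝ V) {I : Set X} (hI : IsPreconnected I) {h : X → ℝ}
    (hh : Continuous h) (h0 : ∀ x ∈ I, 0 ≤ h x) :
    IsPreconnected {p : X × V | p.1 ∈ I ∧ ‖p.2‖ ^ 2 = h p.1} := by
  have := rank_pos_iff_nontrivial.1 (zero_lt_one.trans hV)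
  have h1 : {p : X × V | p.1 ∈ I ∧ ‖p.2‖ ^ 2 = h p.1}
      = (fun p : X × V => (p.1, √(h p.1) • p.2)) '' (I ×ˢ Metric.sphere (0 : V) 1) := by
    ext ⟨x, y⟩
    constructor
    · rintro ⟨hx, hy⟩
      have hr : √(h x) = ‖y‖ := by rw [← hy]; exact Real.sqrt_sq (norm_nonneg y)
      obtain ⟨u, hu, huy⟩ : ∃ u : V, ‖u‖ = 1 ∧ ‖y‖ • u = y := by
        rcases eq_or_ne y 0 with rfl | hy0
        · obtain ⟨u, hu⟩ := exists_norm_eq V zero_le_one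
          exact ⟨u, hu, by simp⟩
        · exact ⟨‖y‖⁻¹ • y, norm_smul_inv_norm (𝕜 := ℝ) hy0,
            smul_inv_smul₀ (norm_ne_zero_iff.2 hy0) y⟩
      exact ⟨(x, u), ⟨hx, mem_sphere_zero_iff_norm.2 hu⟩, Prod.ext rfl (by simpa [hr] using huy)⟩
    · rintro ⟨⟨x', u⟩, ⟨hx, hu⟩, he⟩
      obtain ⟨rfl, rfl⟩ := Prod.ext_iff.1 he
      refine ⟨hx, ?_⟩
      rw [norm_smul, mem_sphere_zero_iff_norm.1 hu, mul_one, Real.norm_eq_abs, sq_abs]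
      exact Real.sq_sqrt (h0 _ hx)
  rw [h1]
  refine (hI.prod (isPreconnected_sphere hV 0 1)).image _ (Continuous.continuousOn ?_)
  fun_prop

theorem one_lt_rank_euclideanSpace {k : ℕ} (hk : 2 ≤ k) :
    1 < Module.rank ℝ (EuclideanSpace ℝ (Fin k)) := by
  rw [← Module.finrank_eq_rank, finrank_euclideanSpace_fin]
  exact_mod_cast hk

/-- The coordinate form of a complete umbilical hypersurface of curvature `μ` of a model: `z` are
tangential coordinates at a base point and `D` is the square of the chord from the base point. -/
theorem isPreconnected_sliceCoordinates (kind : GeometryKind) {m : ℕ} (hm : 2 ≤ m) (μ : ℝ) :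
    IsPreconnected {p : (Fin m → ℝ) × ℝ |
      ∑ i : Fin m, kind.sign i * (p.1 i * p.1 i) = p.2 - μ * p.2 ^ 2 / 4 ∧
        (kind = GeometryKind.space → 0 ≤ p.2)} := by
  cases kind with
  | space =>
    -- a family of spheres over the interval of admissible `D`
    have hI : IsPreconnected {D : ℝ | 0 ≤ D ∧ μ * D ≤ 4} :=
      ((convex_Ici 0).inter (convex_halfSpace_le (IsLinearMap.isLinearMap_smul μ) 4)).isPreconnected
    have h1 := isPreconnected_sphere_bundle (one_lt_rank_euclideanSpace hm) hI
      (h := fun D => D - μ * D ^ 2 / 4) (by fun_prop)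
      (fun D hD => by nlinarith [mul_nonneg hD.1 (sub_nonneg.2 hD.2)])
    convert h1.image (fun p => ((p.2.ofLp, p.1) : (Fin m → ℝ) × ℝ))
      (Continuous.continuousOn (by fun_prop)) using 1
    ext ⟨z, D⟩
    simp only [mem_ofPred_eq, mem_image, Prod.exists, Prod.mk.injEq, EuclideanSpace.real_norm_sq_eq,
      GeometryKind.sign, GeometryKind.index, Nat.not_lt_zero, if_false, one_mul, forall_const]
    constructor
    · rintro ⟨hz, hD⟩
      refine ⟨D, WithLp.toLp 2 z, ⟨⟨hD, ?_⟩, ?_⟩, rfl, rfl⟩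
      · have h2 : 0 ≤ D - μ * D ^ 2 / 4 := hz ▸ Finset.sum_nonneg fun i _ => mul_self_nonneg (z i)
        by_contra! h3
        have hD0 : 0 < D := hD.lt_of_ne fun h => by
          simp [← h] at h3
          linarith
        nlinarith [mul_pos hD0 (sub_pos.2 h3)]
      · rw [← hz]
        exact Finset.sum_congr rfl fun i _ => pow_two (z i)
    · rintro ⟨D, y, ⟨⟨hD, -⟩, hy⟩, rfl, rfl⟩
      refine ⟨?_, hD⟩
      rw [← hy]
      exact Finset.sum_congr rfl fun i _ => (pow_two (y i)).symm
  | spacetime =>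
    obtain ⟨k, rfl⟩ : ∃ k, m = k + 1 := ⟨m - 1, by omega⟩
    have hq : ∀ z : Fin (k + 1) → ℝ,
        ∑ i : Fin (k + 1), GeometryKind.spacetime.sign i * (z i * z i)
          = -(z 0 ^ 2) + ∑ i : Fin k, z i.succ ^ 2 := fun z => by
      simp [Fin.sum_univ_succ, GeometryKind.sign, GeometryKind.index, pow_two]
    simp only [hq, reduceCtorEq, false_implies, and_true]
    rcases lt_trichotomy μ 0 with hμ | rfl | hμ
    · -- a circle bundle over the space of the spatial coordinates
      obtain ⟨r, hr0, rfl⟩ : ∃ r : ℝ, 0 < r ∧ μ = -r ^ 2 :=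
        ⟨√(-μ), Real.sqrt_pos.2 (by linarith), by rw [Real.sq_sqrt (by linarith), neg_neg]⟩
      have h1 := isPreconnected_sphere_bundle (one_lt_rank_euclideanSpace le_rfl)
        (isPreconnected_univ (α := Fin k → ℝ)) (h := fun z => ∑ i, z i ^ 2 + 1 / r ^ 2)
        (by fun_prop) (fun z _ => by positivity)
      convert h1.image (fun p => ((Fin.cons (p.2 0) p.1 : Fin (k + 1) → ℝ),
        2 / r * p.2 1 - 2 / r ^ 2)) (Continuous.continuousOn (by fun_prop)) using 1
      ext ⟨z, D⟩
      simp only [mem_ofPred_eq, mem_image, Prod.exists, Prod.mk.injEq, mem_univ, true_and,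
        EuclideanSpace.real_norm_sq_eq, Fin.sum_univ_two]
      constructor
      · intro hz
        refine ⟨Fin.tail z, !₂[z 0, r / 2 * D + 1 / r], ?_, ?_, ?_⟩
        · simp only [Fin.tail, Matrix.cons_val_zero, Matrix.cons_val_one]
          field_simp
          linear_combination (-4 * r ^ 2) * hz
        · simp
        · simp only [Matrix.cons_val_one, Matrix.cons_val_zero]
          field_simp
          ring
      · rintro ⟨z', u, hu, rfl, rfl⟩
        simp only [Fin.cons_zero, Fin.cons_succ]
        field_simp
        field_simp at hu
        linear_combination -4 * hu
    · -- a graph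
      have h1 : IsPreconnected (univ : Set (Fin (k + 1) → ℝ)) := isPreconnected_univ
      convert h1.image (fun z => (z, -(z 0 ^ 2) + ∑ i : Fin k, z i.succ ^ 2))
        (Continuous.continuousOn (by fun_prop)) using 1
      ext ⟨z, D⟩
      simp [eq_comm]
    · -- a bundle of spheres over the time axis
      obtain ⟨r, hr0, rfl⟩ : ∃ r : ℝ, 0 < r ∧ μ = r ^ 2 :=
        ⟨√μ, Real.sqrt_pos.2 hμ, (Real.sq_sqrt hμ.le).symm⟩
      have h1 := isPreconnected_sphere_bundle (one_lt_rank_euclideanSpace hm)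
        (isPreconnected_univ (α := ℝ)) (h := fun t => t ^ 2 + 1 / r ^ 2)
        (by fun_prop) (fun z _ => by positivity)
      convert h1.image (fun p => ((Fin.cons p.1 (fun i => p.2 i.succ) : Fin (k + 1) → ℝ),
        2 / r ^ 2 + 2 / r * p.2 0)) (Continuous.continuousOn (by fun_prop)) using 1
      ext ⟨z, D⟩
      simp only [mem_ofPred_eq, mem_image, Prod.exists, Prod.mk.injEq, mem_univ, true_and,
        EuclideanSpace.real_norm_sq_eq, Fin.sum_univ_succ]
      constructor
      · intro hz
        refine ⟨z 0, WithLp.toLp 2 (Fin.cons (r / 2 * D - 1 / r) (Fin.tail z)), ?_, ?_, ?_⟩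
        · simp only [Fin.tail, Fin.cons_zero, Fin.cons_succ]
          field_simp
          linear_combination (4 * r ^ 2) * hz
        · simp only [Fin.cons_succ]
          exact Fin.cons_self_tail z
        · simp only [Fin.cons_zero]
          field_simp
          ring
      · rintro ⟨t, u, hu, rfl, rfl⟩
        simp only [Fin.cons_zero, Fin.cons_succ]
        field_simp
        field_simp at hu
        linear_combination 4 * hu

end Connectedness

/-! ### The standard models -/

section Models

variable {n : ℕ} {M : Type*} [TopologicalSpace M] [ChartedSpace (Coord n) M]
  {kind : GeometryKind} {lam : ℝ} {g : BilinField n M} {ι : M → Coord (n + 1)}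

/-- `modelForm` as a continuous bilinear form. -/
noncomputable def modelFormL (kind : GeometryKind) (lam : ℝ) (n : ℕ) :
    Coord (n + 1) →L[ℝ] Coord (n + 1) →L[ℝ] ℝ :=
  ∑ i : Fin (n + 1), (if (i : ℕ) < modelIndex kind lam then (-1 : ℝ) else 1) •
    (ContinuousLinearMap.mul ℝ ℝ).bilinearComp (EuclideanSpace.proj i) (EuclideanSpace.proj i)

theorem modelFormL_apply (kind : GeometryKind) (lam : ℝ) (Y Z : Coord (n + 1)) :
    modelFormL kind lam n Y Z = modelForm kind lam Y Z := by
  simp only [modelFormL, modelForm, sum_apply, smul_apply, smul_eq_mul,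
    ContinuousLinearMap.bilinearComp_apply, ContinuousLinearMap.mul_apply',
    PiLp.proj_apply]

theorem modelForm_comm (kind : GeometryKind) (lam : ℝ) (Y Z : Coord (n + 1)) :
    modelForm kind lam Y Z = modelForm kind lam Z Y := by
  simp only [modelForm, mul_comm (Y _)]

theorem modelForm_space_nonneg (hlam : 0 ≤ lam) (Y : Coord (n + 1)) :
    0 ≤ modelForm GeometryKind.space lam Y Y := by
  simp only [modelForm, modelIndex, hlam.not_gt, if_false, add_zero, Nat.not_lt_zero, one_mul]
  exact Finset.sum_nonneg fun i _ => mul_self_nonneg (Y i)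

theorem modelForm_hyperbolic (hlam : lam < 0) (Y Z : Coord (n + 1)) :
    modelForm GeometryKind.space lam Y Z
      = -(Y 0 * Z 0) + ∑ i : Fin n, Y i.succ * Z i.succ := by
  simp [modelForm, modelIndex, hlam, Fin.sum_univ_succ]

theorem modelForm_single_last (hn : 1 ≤ n) (hlam : 0 ≤ lam) (Y : Coord (n + 1)) :
    modelForm kind lam (EuclideanSpace.single (Fin.last n) 1) Y = Y (Fin.last n) := by
  have h1 : ¬ n < modelIndex kind lam := by
    cases kind <;> simp [modelIndex, hlam.not_gt]
    omega
  rw [modelForm, Finset.sum_eq_single (Fin.last n)]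
  · simp [h1]
  · intro i _ hi
    simp [hi]
  · simp

/-- The two sheets of a hyperboloid are distinguished by the sign of the square of a chord. -/
theorem hyperbolic_sheet_iff (hlam : lam < 0) {F Y : Coord (n + 1)} (hF0 : 0 < F 0)
    (hF : modelForm GeometryKind.space lam F F = 1 / lam)
    (hY : modelForm GeometryKind.space lam Y Y = 1 / lam) :
    0 < Y 0 ↔ 0 ≤ modelForm GeometryKind.space lam (Y - F) (Y - F) := by
  have hcs := Finset.sum_mul_sq_le_sq_mul_sq Finset.univ (fun i : Fin n => Y i.succ)
    (fun i => F i.succ)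
  have hsub : modelForm GeometryKind.space lam (Y - F) (Y - F)
      = 2 / lam - 2 * modelForm GeometryKind.space lam Y F := by
    simp only [← modelFormL_apply] at hF hY ⊢
    simp only [map_sub, sub_apply]
    simp only [modelFormL_apply] at hF hY ⊢
    rw [hF, hY, modelForm_comm _ _ F Y]
    ring
  rw [hsub]
  simp only [modelForm_hyperbolic hlam] at hF hY ⊢
  have ha : 0 < -(1 / lam) := by
    have := one_div_neg.2 hlam
    linarith
  have h2 : 2 / lam = -2 * -(1 / lam) := by ring
  rw [h2]
  simp only [← pow_two] at hF hY
  set a := -(1 / lam) with hadef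
  set P := ∑ i : Fin n, Y i.succ ^ 2 with hP
  set Q := ∑ i : Fin n, F i.succ ^ 2 with hQ
  set R := ∑ i : Fin n, Y i.succ * F i.succ with hR
  have hP0 : 0 ≤ P := Finset.sum_nonneg fun i _ => sq_nonneg _
  have hQ0 : 0 ≤ Q := Finset.sum_nonneg fun i _ => sq_nonneg _
  have hY2 : Y 0 ^ 2 = a + P := by linarith
  have hF2 : F 0 ^ 2 = a + Q := by linarith
  have hprod : (Y 0 * F 0) ^ 2 = (a + P) * (a + Q) := by rw [mul_pow, hY2, hF2]
  -- the arithmetic-geometric mean inequality for the mixed term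
  have hmean : 2 * R ≤ P + Q := by
    have h3 : (2 * R) ^ 2 ≤ (P + Q) ^ 2 := by nlinarith [sq_nonneg (P - Q)]
    exact (abs_le_of_sq_le_sq' h3 (by linarith)).2
  constructor
  · intro hY0
    have h3 : (a + R) ^ 2 ≤ (Y 0 * F 0) ^ 2 := by rw [hprod]; nlinarith
    have h4 := (abs_le_of_sq_le_sq' h3 (by positivity)).2
    linarith
  · intro h
    by_contra! hY0
    have h3 : R ^ 2 ≤ (-(Y 0 * F 0)) ^ 2 := by rw [neg_sq, hprod]; nlinarith
    have h4 := (abs_le_of_sq_le_sq' h3 (by nlinarith)).1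
    nlinarith

/-- The embedding of a model is a development, with the model as its quadric, up to the choice of a
sheet for hyperbolic space. -/
theorem IsModelEmbedding.exists_isDevelopment (hn : 1 ≤ n)
    (h : IsModelEmbedding kind lam g ι) :
    ∃ (ε κ : ℝ) (c : Coord (n + 1)) (d : ℝ),
      IsDevelopment g lam (modelFormL kind lam n) ε κ c d ι univ ∧
      (∀ Y, 2 * modelFormL kind lam n c Y + κ * modelFormL kind lam n Y Y = d ↔
        (lam = 0 → Y (Fin.last n) = 0) ∧ (lam ≠ 0 → modelForm kind lam Y Y = 1 / lam)) ∧
      (lam ≠ 0 → c = 0 ∧ κ ≠ 0) ∧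
      (lam = 0 → κ = 0 ∧ ∀ Y, modelFormL kind lam n c Y = Y (Fin.last n)) := by
  have hι : ∀ q, ι q ∈ modelSet kind lam n := fun q => h.range_eq ▸ mem_range_self q
  have hiso : ∀ q ∈ (univ : Set M), ∀ u w : TangentSpace (𝓡 n) q,
      modelFormL kind lam n (mfderiv (𝓡 n) (𝓡 (n + 1)) ι q u)
        (mfderiv (𝓡 n) (𝓡 (n + 1)) ι q w) = g q u w := fun q _ u w =>
    (modelFormL_apply _ _ _ _).trans (h.isometry q u w).symm
  have hsymm : ∀ a b, modelFormL kind lam n a b = modelFormL kind lam n b a := fun a b => by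
    rw [modelFormL_apply, modelFormL_apply, modelForm_comm]
  rcases eq_or_ne lam 0 with rfl | hlam
  · have hc : ∀ Y, modelFormL kind 0 n (EuclideanSpace.single (Fin.last n) 1) Y
        = Y (Fin.last n) := fun Y => by
      rw [modelFormL_apply, modelForm_single_last hn le_rfl]
    have hquad : ∀ Y, 2 * modelFormL kind 0 n (EuclideanSpace.single (Fin.last n) 1) Y
        + 0 * modelFormL kind 0 n Y Y = 0 ↔
        ((0 : ℝ) = 0 → Y (Fin.last n) = 0) ∧
          ((0 : ℝ) ≠ 0 → modelForm kind 0 Y Y = 1 / 0) := fun Y => by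
      rw [hc]
      simp
    refine ⟨1, 0, EuclideanSpace.single (Fin.last n) 1, 0, ⟨isOpen_univ, by simp, hsymm,
      by norm_num, by norm_num, by rw [hc]; simp, h.smooth.contMDiffOn, hiso, fun q _ => ?_⟩, hquad,
      fun h0 => (h0 rfl).elim, fun _ => ⟨rfl, hc⟩⟩
    exact (hquad _).2 ⟨(hι q).1, (hι q).2.1⟩
  · obtain ⟨ε, κ, hε, hκ⟩ := exists_sign_mul_sq lam
    have hκ0 : κ ≠ 0 := by
      rintro rfl
      exact hlam (by simpa using hκ)
    have hquad : ∀ Y, 2 * modelFormL kind lam n 0 Y + κ * modelFormL kind lam n Y Y = κ / lam ↔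
        (lam = 0 → Y (Fin.last n) = 0) ∧ (lam ≠ 0 → modelForm kind lam Y Y = 1 / lam) := by
      intro Y
      simp only [hlam, false_implies, true_and, ne_eq, not_false_eq_true, forall_const, map_zero,
        zero_apply, mul_zero, zero_add, ← modelFormL_apply]
      rw [div_eq_mul_one_div κ lam, mul_right_inj' hκ0]
    refine ⟨ε, κ, 0, κ / lam, ⟨isOpen_univ, by simp, hsymm, hε, hκ, ?_, h.smooth.contMDiffOn, hiso,
      fun q _ => ?_⟩, hquad, fun _ => ⟨rfl, hκ0⟩, fun h0 => (hlam h0).elim⟩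
    · simp only [map_zero, zero_add]
      rw [← mul_div_assoc, div_eq_iff hlam]
      linear_combination -ε * hκ - κ ^ 2 * hε
    · exact (hquad _).2 ⟨(hι q).1, (hι q).2.1⟩

/-- Membership in a model, in terms of the chord from a given point of it. -/
theorem mem_modelSet_iff {F : Coord (n + 1)} (hF : F ∈ modelSet kind lam n) (Y : Coord (n + 1)) :
    Y ∈ modelSet kind lam n ↔
      ((lam = 0 → Y (Fin.last n) = 0) ∧ (lam ≠ 0 → modelForm kind lam Y Y = 1 / lam)) ∧
        (kind = GeometryKind.space → 0 ≤ modelForm kind lam (Y - F) (Y - F)) := by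
  have h1 : Y ∈ modelSet kind lam n ↔
      ((lam = 0 → Y (Fin.last n) = 0) ∧ (lam ≠ 0 → modelForm kind lam Y Y = 1 / lam)) ∧
        (kind = GeometryKind.space → lam < 0 → 0 < Y 0) := and_assoc.symm
  rw [h1, and_congr_right_iff]
  rintro ⟨-, hY⟩
  refine forall_congr' fun hk => ?_
  subst hk
  rcases lt_or_ge lam 0 with hlam | hlam
  · rw [← hyperbolic_sheet_iff hlam (hF.2.2 rfl hlam) (hF.2.1 hlam.ne) (hY hlam.ne)]
    simp [hlam]
  · simp [hlam.not_gt, modelForm_space_nonneg hlam]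

end Models

/-! ### Umbilical hypersurfaces of the models -/

section SliceCoordinates

variable {m : ℕ} {N : Type*} [TopologicalSpace N] [ChartedSpace (Coord m) N] {b : BilinField m N}
  {E : Type*} [NormedAddCommGroup E] [NormedSpace ℝ E] {B : E →L[ℝ] E →L[ℝ] ℝ} {ε κ : ℝ} {c : E}
  {d σ : ℝ} {F η : N → E} {O : Set N} {kind : GeometryKind}

/-- In the frame of tangent vectors, normal and quadric normal at a base point the slice through that
point has the coordinates of `isPreconnected_sliceCoordinates`. -/
theorem IsUmbilicalDevelopment.isPreconnected_slice (hm : 2 ≤ m)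
    (h : IsUmbilicalDevelopment b B ε κ c d σ F η O) {x : N} (hx : x ∈ O)
    (hs : HasSignature kind (fun u v : Coord m => (b x : Coord m →L[ℝ] Coord m →L[ℝ] ℝ) u v)) :
    IsPreconnected {Y | (2 * B c Y + κ * B Y Y = d ∧
      (kind = GeometryKind.space → 0 ≤ B (Y - F x) (Y - F x))) ∧
        sliceFunction B σ (F x) (η x) Y = 0} := by
  obtain ⟨L, hL, hLη, hLξ⟩ := h.exists_frame hx hs
  have hη : ∀ y, B (η x) (L y) = y.2.1 := fun y => by
    rw [← hLη, hL]
    simp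
  have hξ : ∀ y, B (c + κ • F x) (L y) = ε * y.2.2 := fun y => by
    rw [← hLξ, hL]
    simp
  have hε := h.sign
  convert (isPreconnected_sliceCoordinates kind hm (ε * κ ^ 2 + σ ^ 2)).image
    (fun p => F x + L (p.1, σ * p.2 / 2, -(ε * κ * p.2 / 2)))
    (Continuous.continuousOn (by fun_prop)) using 1
  ext Y
  simp only [mem_ofPred_eq, quadric_iff h.symm (h.quadric x hx), sliceFunction, mem_image,
    Prod.exists]
  constructor
  · rintro ⟨⟨hq, hk⟩, hsl⟩
    obtain ⟨⟨z, p, r⟩, hy⟩ := L.surjective (Y - F x)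
    rw [← hy] at hq hk hsl
    rw [hξ] at hq
    rw [hη] at hsl
    rw [hL] at hk hq hsl
    dsimp only at hk hq hsl
    set D := ∑ i : Fin m, kind.sign i * (z i * z i) + p * p + ε * (r * r) with hD
    have hp : p = σ * D / 2 := by linarith
    have hr : r = -(ε * κ * D / 2) := by linear_combination ε / 2 * hq - r * hε
    refine ⟨z, D, ⟨?_, hk⟩, ?_⟩
    · have hr2 : r * r = κ ^ 2 * D ^ 2 / 4 := by
        rw [hr]
        linear_combination κ ^ 2 * D ^ 2 / 4 * hε
      have hp2 : p * p = σ ^ 2 * D ^ 2 / 4 := by rw [hp]; ring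
      linear_combination -hD - hp2 - ε * hr2
    · rw [← hp, ← hr, hy]
      abel
  · rintro ⟨z, D, ⟨hz, hk⟩, rfl⟩
    have hD : B (L (z, σ * D / 2, -(ε * κ * D / 2))) (L (z, σ * D / 2, -(ε * κ * D / 2))) = D := by
      rw [hL, hz]
      linear_combination ε * κ ^ 2 * D ^ 2 / 4 * hε
    simp only [add_sub_cancel_left, hD, hξ, hη]
    refine ⟨⟨?_, hk⟩, by ring⟩
    linear_combination -κ * D * hε

end SliceCoordinates

section ModelSlices

variable {n : ℕ} {kind : GeometryKind} {lam κ σ : ℝ} {c F η : Coord (n + 1)}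

/-- The section of a model by a slice equation is one of the listed hypersurfaces. -/
theorem isModelSlice_sliceFunction (hF : F ∈ modelSet kind lam n)
    (hη : modelFormL kind lam n η η = 1) (hξη : modelFormL kind lam n (c + κ • F) η = 0)
    (hne : lam ≠ 0 → c = 0 ∧ κ ≠ 0)
    (hz : lam = 0 → κ = 0 ∧ ∀ Y, modelFormL kind lam n c Y = Y (Fin.last n)) :
    IsModelSlice kind lam σ
      {Y | Y ∈ modelSet kind lam n ∧ sliceFunction (modelFormL kind lam n) σ F η Y = 0} := by
  set B := modelFormL kind lam n with hB
  have hBf : ∀ Y Z, modelForm kind lam Y Z = B Y Z := fun Y Z => (modelFormL_apply _ _ _ _).symm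
  have hs : ∀ a b, B a b = B b a := fun a b => by rw [← hBf, ← hBf, modelForm_comm]
  by_cases hlam : lam = 0
  · obtain ⟨rfl, hc⟩ := hz hlam
    have hmem : ∀ Y : Coord (n + 1), Y (Fin.last n) = 0 → Y ∈ modelSet kind lam n := fun Y hY =>
      ⟨fun _ => hY, fun h => (h hlam).elim, fun _ h => (h.ne hlam).elim⟩
    have hηl : η (Fin.last n) = 0 := by
      rw [← hc]
      simpa using hξη
    by_cases hσ : σ = 0
    · subst hσ
      refine Or.inr (Or.inl ⟨hlam, rfl, η, hmem η hηl, B η F, by rw [hBf, hη], ?_⟩)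
      ext Y
      simp only [mem_ofPred_eq, hBf, sliceFunction, map_sub, zero_mul, sub_zero]
      refine and_congr_right fun _ => ⟨fun h => by linarith, fun h => by linarith⟩
    · refine Or.inr (Or.inr ⟨hlam, hσ, F + σ⁻¹ • η, hmem _ ?_, ?_⟩)
      · simp [hηl, hF.1 hlam]
      · ext Y
        refine and_congr_right fun _ => ?_
        have h1 : B (Y - (F + σ⁻¹ • η)) (Y - (F + σ⁻¹ • η))
            = 1 / σ ^ 2 - σ⁻¹ * sliceFunction B σ F η Y := by
          rw [← sub_sub, sliceFunction]
          generalize Y - F = v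
          simp only [map_sub, map_smul, sub_apply, smul_apply, smul_eq_mul, hη, hs v η]
          field_simp
          ring
        rw [hBf, h1, sub_eq_self, mul_eq_zero, or_iff_right (inv_ne_zero hσ)]
  · obtain ⟨rfl, hκ⟩ := hne hlam
    have hFη : B F η = 0 := by
      rw [zero_add, map_smul, smul_apply, smul_eq_mul] at hξη
      exact (mul_eq_zero.1 hξη).resolve_left hκ
    have hFF : B F F = 1 / lam := (hBf _ _).symm.trans (hF.2.1 hlam)
    refine Or.inl ⟨hlam, η + σ • F, ?_, ?_⟩
    · simp only [hBf, map_add, map_smul, add_apply, smul_apply, smul_eq_mul, hη, hs η F, hFη, hFF]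
      ring
    · ext Y
      refine and_congr_right fun hY => ?_
      have hYY : B Y Y = 1 / lam := (hBf _ _).symm.trans (hY.2.1 hlam)
      rw [sliceFunction_eq hs, hBf, hYY, hFF, hs η F, hFη]
      constructor <;> intro h
      · linear_combination h / 2
      · linear_combination 2 * h

end ModelSlices

section Models

variable {m : ℕ} {M : Type*} [TopologicalSpace M] [ChartedSpace (Coord (m + 1)) M]
  [IsManifold (𝓡 (m + 1)) ∞ M] {g : BilinField (m + 1) M} {lam : ℝ} {kind : GeometryKind}
  {ι : M → Coord (m + 1 + 1)}
  {N : Type*} [TopologicalSpace N] [ChartedSpace (Coord m) N] [IsManifold (𝓡 m) ∞ N]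
  {f : N → M} {ν : ∀ x : N, TangentSpace (𝓡 (m + 1)) (f x)} {σ : N → ℝ}
  {ε κ : ℝ} {c : Coord (m + 1 + 1)} {d s : ℝ} {η : N → Coord (m + 1 + 1)}

omit [IsManifold (𝓡 (m + 1)) ∞ M] [IsManifold (𝓡 m) ∞ N] in
/-- The slice of a model which contains a given umbilical hypersurface is connected. -/
theorem IsModelEmbedding.isPreconnected_slice (hm : 2 ≤ m) (hι : IsModelEmbedding kind lam g ι)
    (hquad : ∀ Y, 2 * modelFormL kind lam (m + 1) c Y + κ * modelFormL kind lam (m + 1) Y Y = d ↔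
        (lam = 0 → Y (Fin.last (m + 1)) = 0) ∧ (lam ≠ 0 → modelForm kind lam Y Y = 1 / lam))
    {b : BilinField m N}
    (hu : IsUmbilicalDevelopment b (modelFormL kind lam (m + 1)) ε κ c d s (ι ∘ f) η univ) {x : N}
    (hs : HasSignature kind (fun u v : Coord m => (b x : Coord m →L[ℝ] Coord m →L[ℝ] ℝ) u v)) :
    IsPreconnected
      {q | sliceFunction (modelFormL kind lam (m + 1)) s (ι (f x)) (η x) (ι q) = 0} := by
  have hF : ι (f x) ∈ modelSet kind lam (m + 1) := hι.range_eq ▸ mem_range_self _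
  have h1 : ι '' {q | sliceFunction (modelFormL kind lam (m + 1)) s (ι (f x)) (η x) (ι q) = 0}
      = {Y | (2 * modelFormL kind lam (m + 1) c Y + κ * modelFormL kind lam (m + 1) Y Y = d ∧
        (kind = GeometryKind.space →
          0 ≤ modelFormL kind lam (m + 1) (Y - (ι ∘ f) x) (Y - (ι ∘ f) x))) ∧
        sliceFunction (modelFormL kind lam (m + 1)) s ((ι ∘ f) x) (η x) Y = 0} := by
    ext Y
    rw [mem_ofPred_eq, hquad, modelFormL_apply, Function.comp_apply, ← mem_modelSet_iff hF,
      ← hι.range_eq]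
    constructor
    · rintro ⟨q, hq, rfl⟩
      exact ⟨mem_range_self q, hq⟩
    · rintro ⟨⟨q, rfl⟩, hq⟩
      exact ⟨q, hq, rfl⟩
  rw [← hι.embedding.isInducing.isPreconnected_image, h1]
  exact hu.isPreconnected_slice hm (mem_univ x) hs

/-- An umbilical hypersurface of a model lies in one of the listed hypersurfaces, and fills it if it
is closed. -/
theorem IsUmbilicalHypersurface.exists_isModelSlice [ConnectedSpace N] (hm : 2 ≤ m)
    (h : IsUmbilicalHypersurface kind g f ν σ) (hg : IsMetric kind g) (hs : ∀ x, σ x = s)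
    (hι : IsModelEmbedding kind lam g ι) :
    ∃ S : Set (Coord (m + 1 + 1)), IsModelSlice kind lam s S ∧
      ι '' range f ⊆ S ∧ (IsClosed (range f) → ι '' range f = S) := by
  obtain ⟨ε, κ, c, d, hdev, hquad, hne, hz⟩ := hι.exists_isDevelopment (by omega)
  have hu := h.isUmbilicalDevelopment hg hdev hs
  rw [preimage_univ] at hu
  obtain ⟨x₀⟩ := (inferInstance : Nonempty N)
  have hmem : ∀ q, ι q ∈ modelSet kind lam (m + 1) := fun q => hι.range_eq ▸ mem_range_self q
  refine ⟨_, isModelSlice_sliceFunction (hmem (f x₀)) (hu.normal_unit x₀ (mem_univ _))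
    (hu.normal_tangent x₀ (mem_univ _)) hne hz, ?_, fun hcl => ?_⟩
  · rintro _ ⟨_, ⟨x, rfl⟩, rfl⟩
    exact ⟨hmem _, hu.sliceFunction_apply_eq_zero x x₀⟩
  · have h1 := hu.range_eq hdev hg h.smooth.continuous
      (fun x u hu => h.inducedMetric_nondegenerate (x := x) hg hu) x₀
      (hι.isPreconnected_slice hm hquad hu (h.signature x₀)) hcl
    rw [h1]
    ext Y
    constructor
    · rintro ⟨q, hq, rfl⟩
      exact ⟨hmem q, hq⟩
    · rintro ⟨hY, hq⟩
      obtain ⟨q, rfl⟩ := hι.range_eq.symm ▸ hY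
      exact ⟨q, hq, rfl⟩

/-- A rigid motion of the ambient space which respects the quadric normals at two points of a model
preserves the model. -/
theorem affineMove_mem_modelSet {n : ℕ} {κ : ℝ} {c : Coord (n + 1)} {d : ℝ}
    (hquad : ∀ Y, 2 * modelFormL kind lam n c Y + κ * modelFormL kind lam n Y Y = d ↔
        (lam = 0 → Y (Fin.last n) = 0) ∧ (lam ≠ 0 → modelForm kind lam Y Y = 1 / lam))
    {F₁ F₂ : Coord (n + 1)} (hF₁ : F₁ ∈ modelSet kind lam n) (hF₂ : F₂ ∈ modelSet kind lam n)
    {L : Coord (n + 1) ≃L[ℝ] Coord (n + 1)}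
    (hL : ∀ a b, modelFormL kind lam n (L a) (L b) = modelFormL kind lam n a b)
    (hξ : L (c + κ • F₁) = c + κ • F₂) {Y : Coord (n + 1)} (hY : Y ∈ modelSet kind lam n) :
    affineMove F₁ F₂ L Y ∈ modelSet kind lam n := by
  have hs : ∀ a b, modelFormL kind lam n a b = modelFormL kind lam n b a := fun a b => by
    rw [modelFormL_apply, modelFormL_apply, modelForm_comm]
  rw [mem_modelSet_iff hF₁, ← hquad] at hY
  rw [mem_modelSet_iff hF₂, ← hquad, affineMove_sub]
  refine ⟨affineMove_mem_quadric hs hs ((hquad F₁).2 ⟨hF₁.1, hF₁.2.1⟩)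
    ((hquad F₂).2 ⟨hF₂.1, hF₂.2.1⟩) hL hξ hY.1, ?_⟩
  rw [← modelFormL_apply, hL, modelFormL_apply]
  exact hY.2

variable {N₁ N₂ : Type*} [TopologicalSpace N₁] [ChartedSpace (Coord m) N₁]
  [IsManifold (𝓡 m) ∞ N₁] [ConnectedSpace N₁]
  [TopologicalSpace N₂] [ChartedSpace (Coord m) N₂] [IsManifold (𝓡 m) ∞ N₂] [ConnectedSpace N₂]
  {f₁ : N₁ → M} {f₂ : N₂ → M} {ν₁ : ∀ x : N₁, TangentSpace (𝓡 (m + 1)) (f₁ x)}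
  {ν₂ : ∀ x : N₂, TangentSpace (𝓡 (m + 1)) (f₂ x)} {σ₁ : N₁ → ℝ} {σ₂ : N₂ → ℝ}

/-- Umbilical hypersurfaces of a model with the same squared principal curvature are congruent by a
global isometry, locally in general and globally if they are closed. -/
theorem IsUmbilicalHypersurface.exists_globalIsometry (hm : 2 ≤ m)
    (h₁ : IsUmbilicalHypersurface kind g f₁ ν₁ σ₁) (h₂ : IsUmbilicalHypersurface kind g f₂ ν₂ σ₂)
    (hg : IsMetric kind g) {s₁ s₂ : ℝ} (hs₁ : ∀ x, σ₁ x = s₁)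
    (hs₂ : ∀ x, σ₂ x = s₂) (hs : s₁ ^ 2 = s₂ ^ 2) (hι : IsModelEmbedding kind lam g ι) (x₁ : N₁)
    (x₂ : N₂) :
    ∃ Φ : M ≃ₘ^∞⟮𝓡 (m + 1), 𝓡 (m + 1)⟯ M, IsGlobalIsometry g Φ ∧
      Φ (f₁ x₁) = f₂ x₂ ∧
      (∃ (W₁ : Set N₁) (W₂ : Set N₂), IsOpen W₁ ∧ x₁ ∈ W₁ ∧ IsOpen W₂ ∧ x₂ ∈ W₂ ∧
        Φ '' (f₁ '' W₁) = f₂ '' W₂) ∧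
      (IsClosed (range f₁) → IsClosed (range f₂) → Φ '' range f₁ = range f₂) := by
  obtain ⟨ε, κ, c, d, hdev, hquad, -, -⟩ := hι.exists_isDevelopment (by omega)
  have hu₁ := h₁.isUmbilicalDevelopment hg hdev hs₁
  obtain ⟨η₂, hu₂⟩ := h₂.exists_isUmbilicalDevelopment hg hdev hs₂ hs.symm
  have hmem : ∀ q, ι q ∈ modelSet kind lam (m + 1) := fun q => hι.range_eq ▸ mem_range_self q
  obtain ⟨L, hL, hLη, hLξ⟩ := hu₁.exists_linear_isometry hu₂ (mem_univ (f₁ x₁))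
    (mem_univ (f₂ x₂)) (h₁.signature x₁) (h₂.signature x₂)
  have hLξ' : L.symm (c + κ • ι (f₂ x₂)) = c + κ • ι (f₁ x₁) := by
    rw [L.symm_apply_eq]
    exact hLξ.symm
  obtain ⟨Φ, hΦ, hΦx, hιΦ⟩ := hdev.exists_globalIsometry hg hι.embedding (p₁ := f₁ x₁)
    (p₂ := f₂ x₂) hL
    (fun Y hY => by
      rw [hι.range_eq] at hY ⊢
      exact affineMove_mem_modelSet hquad (hmem _) (hmem _) hL hLξ hY)
    (fun Y hY => by
      rw [hι.range_eq] at hY ⊢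
      exact affineMove_mem_modelSet hquad (hmem _) (hmem _) (isometry_symm hL) hLξ' hY)
  have hslice := fun q => (congrArg _ (hιΦ q)).trans
    (sliceFunction_affineMove (F₁ := ι (f₁ x₁)) (F₂ := ι (f₂ x₂)) hL hLη s₁ (ι q))
  have hb₁ := fun x u hu => h₁.inducedMetric_nondegenerate (x := x) hg (u := u) hu
  have hb₂ := fun x u hu => h₂.inducedMetric_nondegenerate (x := x) hg (u := u) hu
  refine ⟨Φ, hΦ, hΦx, ?_, fun hcl₁ hcl₂ => ?_⟩
  · obtain ⟨O₁, W₁, hO₁, -, hW₁, hxW₁, hS₁⟩ := hu₁.exists_isOpen_image_eq hdev hg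
      h₁.smooth.continuous hb₁ (mem_univ (f₁ x₁))
    obtain ⟨O₂, W₂, hO₂, -, hW₂, hxW₂, hS₂⟩ := hu₂.exists_isOpen_image_eq hdev hg
      h₂.smooth.continuous hb₂ (mem_univ (f₂ x₂))
    obtain ⟨W₁', W₂', hW₁', hx₁, hW₂', hx₂, -, hW⟩ := exists_image_image_eq
      (Φ := Φ.toHomeomorph.toOpenPartialHomeomorph) h₁.smooth.continuous h₂.smooth.continuous
      (mem_univ _) hΦx hO₁ hO₂ hW₁ hW₂ hxW₁ hxW₂ hS₁ hS₂ fun q _ => hslice q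
    exact ⟨W₁', W₂', hW₁', hx₁, hW₂', hx₂, hW⟩
  · rw [preimage_univ] at hu₁ hu₂
    rw [hu₁.range_eq hdev hg h₁.smooth.continuous hb₁ x₁
      (hι.isPreconnected_slice hm hquad hu₁ (h₁.signature x₁)) hcl₁,
      hu₂.range_eq hdev hg h₂.smooth.continuous hb₂ x₂
      (hι.isPreconnected_slice hm hquad hu₂ (h₂.signature x₂)) hcl₂]
    ext p
    constructor
    · rintro ⟨q, hq, rfl⟩
      exact (hslice q).trans hq
    · intro hp
      obtain ⟨q, rfl⟩ := Φ.surjective p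
      exact ⟨q, (hslice q).symm.trans hp, rfl⟩

end Models

theorem mainTheorem3 (kind : GeometryKind) (m : ℕ) (hm : 2 ≤ m) (lam : ℝ)
    {M : Type*} [TopologicalSpace M] [T2Space M] [SecondCountableTopology M]
    [ChartedSpace (Coord (m + 1)) M] [IsManifold (𝓡 (m + 1)) ∞ M]
    (g : BilinField (m + 1) M) (hg : IsConstantCurvatureMetric kind lam g) :
    -- one hypersurface: `σ` is constant, intrinsic curvature, Gaussian normal form
    (∀ (N : Type*) [TopologicalSpace N] [T2Space N] [SecondCountableTopology N]
        [ConnectedSpace N] [ChartedSpace (Coord m) N] [IsManifold (𝓡 m) ∞ N]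
        (f : N → M) (ν : ∀ x : N, TangentSpace (𝓡 (m + 1)) (f x)) (σ : N → ℝ),
        IsUmbilicalHypersurface kind g f ν σ →
        ∃ sigma : ℝ, (∀ x, σ x = sigma) ∧
          IsConstantCurvatureMetric kind (lam + sigma ^ 2) (inducedMetric (m := m) g f) ∧
          (∃ (ℓ : ℝ) (ρ : ℝ → ℝ) (K v₀ : ℝ),
            IsWarping lam ℓ ρ K ∧ IsAdmissibleSlice sigma ℓ ρ v₀) ∧
          (∀ (ℓ : ℝ) (ρ : ℝ → ℝ) (K v₀ : ℝ),
            IsWarping lam ℓ ρ K → IsAdmissibleSlice sigma ℓ ρ v₀ →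
            ∃ γ : BilinField m N, IsConstantCurvatureMetric kind K γ ∧
              HasWarpedNormalForm g f ℓ ρ v₀ γ) ∧
          -- in the standard space(-time)s: the explicit list of hypersurfaces
          (∀ ι : M → Coord (m + 1 + 1), IsModelEmbedding kind lam g ι →
            ∃ S : Set (Coord (m + 1 + 1)), IsModelSlice kind lam sigma S ∧
              ι '' range f ⊆ S ∧ (IsClosed (range f) → ι '' range f = S))) ∧
    -- two hypersurfaces with the same `σ²`: rigidity
    (∀ (N₁ N₂ : Type*)
        [TopologicalSpace N₁] [T2Space N₁] [SecondCountableTopology N₁] [ConnectedSpace N₁]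
        [ChartedSpace (Coord m) N₁] [IsManifold (𝓡 m) ∞ N₁]
        [TopologicalSpace N₂] [T2Space N₂] [SecondCountableTopology N₂] [ConnectedSpace N₂]
        [ChartedSpace (Coord m) N₂] [IsManifold (𝓡 m) ∞ N₂]
        (f₁ : N₁ → M) (ν₁ : ∀ x : N₁, TangentSpace (𝓡 (m + 1)) (f₁ x)) (σ₁ : N₁ → ℝ)
        (f₂ : N₂ → M) (ν₂ : ∀ x : N₂, TangentSpace (𝓡 (m + 1)) (f₂ x)) (σ₂ : N₂ → ℝ),
        IsUmbilicalHypersurface kind g f₁ ν₁ σ₁ → IsUmbilicalHypersurface kind g f₂ ν₂ σ₂ →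
        (∀ x₁ x₂, σ₁ x₁ ^ 2 = σ₂ x₂ ^ 2) →
        ∀ (x₁ : N₁) (x₂ : N₂),
          -- in every constant curvature space(-time): a local isometry
          (∃ Φ : OpenPartialHomeomorph M M, IsLocalIsometry g Φ ∧
            f₁ x₁ ∈ Φ.source ∧ Φ (f₁ x₁) = f₂ x₂ ∧
            ∃ (W₁ : Set N₁) (W₂ : Set N₂), IsOpen W₁ ∧ x₁ ∈ W₁ ∧ IsOpen W₂ ∧ x₂ ∈ W₂ ∧
              f₁ '' W₁ ⊆ Φ.source ∧ Φ '' (f₁ '' W₁) = f₂ '' W₂) ∧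
          -- in the standard ones: a global isometry
          ((∃ ι : M → Coord (m + 1 + 1), IsModelEmbedding kind lam g ι) →
            ∃ Φ : M ≃ₘ^∞⟮𝓡 (m + 1), 𝓡 (m + 1)⟯ M, IsGlobalIsometry g Φ ∧
              Φ (f₁ x₁) = f₂ x₂ ∧
              (∃ (W₁ : Set N₁) (W₂ : Set N₂), IsOpen W₁ ∧ x₁ ∈ W₁ ∧ IsOpen W₂ ∧ x₂ ∈ W₂ ∧
                Φ '' (f₁ '' W₁) = f₂ '' W₂) ∧
              (IsClosed (range f₁) → IsClosed (range f₂) → Φ '' range f₁ = range f₂))) := by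
  refine ⟨fun N _ _ _ _ _ _ f ν σ h => ?_,
    fun N₁ N₂ _ _ _ _ _ _ _ _ _ _ _ _ f₁ ν₁ σ₁ f₂ ν₂ σ₂ h₁ h₂ hσ x₁ x₂ => ?_⟩
  · obtain ⟨s, hs⟩ := h.exists_eq_const hm hg
    refine ⟨s, hs, ?_, exists_admissibleSlice lam s,
      fun ℓ ρ K v₀ hw ha => h.exists_warpedNormalForm hg hs hw ha,
      fun ι hι => h.exists_isModelSlice hm hg.toIsMetric hs hι⟩
    have h1 := h.isConstantCurvatureMetric_smul hg hs one_pos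
    rwa [one_pow, div_one, one_smul] at h1
  · obtain ⟨s₁, hs₁⟩ := h₁.exists_eq_const hm hg
    obtain ⟨s₂, hs₂⟩ := h₂.exists_eq_const hm hg
    have hs : s₁ ^ 2 = s₂ ^ 2 := by rw [← hs₁ x₁, ← hs₂ x₂, hσ]
    exact ⟨h₁.exists_localIsometry h₂ hg hs₁ hs₂ hs x₁ x₂, fun ⟨ι, hι⟩ =>
      h₁.exists_globalIsometry hm h₂ hg.toIsMetric hs₁ hs₂ hs hι x₁ x₂⟩
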